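/- **Setting.** Let $f^1,f_F:\mathbb R^d\times\mathbb R^m\to\mathbb R^d$ and $\phi:\mathbb R^d\to\mathbb R$ be $C^1$, let $g:\mathbb R^d\to\mathbb R$ be $C^2$, and put $f^2(x,z,u)=f_F(x,u)+g_x(x)^Tz$ for $z\in\mathbb R$. Let $t_0<t_t<t_f$, and let $u^1$ (control used before the transition) and $u^2$ (control used after it) be bounded on $[t_0,t_f]$ and continuous there off a finite set $B\not\ni t_t$. Let $x$ be continuous on $[t_0,t_f]$ with $g(x(t))\ne0$ on $[t_0,t_t)$ and, off $B$, $$x'=f^1(x,u^1)\ \text{ on }[t_0,t_t],\qquad x'=f^2(x,z,u^2)\ \text{ on }[t_t,t_f],\qquad g(x)=0\ \text{ on }[t_t,t_f].$$ Assume that $g_x(x(t))g_x(x(t))^T\neq0$ on $[t_t,t_f]$ (index 2) and that $g_x(x(t_t))f^1(x(t_t),u^1(t_t))\ne0$. Let $\lambda_f$ (continuous on $[t_t,t_f]$) and $\lambda_g$ satisfy $$\lambda_f'=-f^2_x(x,z,u^2)^T\lambda_f+g_x(x)^T\lambda_g\ \text{ (off }B),\qquad g_x(x)\lambda_f=0\qquad\text{on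 }[t_t,t_f],$$ and $\phi_x^T(x(t_f))+\lambda_f(t_f)=\nu\, g_x^T(x(t_f))$ for some $\nu\in\mathbb R$. The continuous jump $\pi_t$ is given, together with $\lambda_f(t_t^-)$, by $$\lambda_f(t_t^-)=\lambda_f(t_t)-\pi_t\,g_x^T(x(t_t)),$$ $$\lambda_f(t_t^-)^Tf^1(x(t_t),u^1(t_t))=\lambda_f(t_t)^Tf^2(x(t_t),z(t_t),u^2(t_t))-\lambda_g(t_t)g(x(t_t)).$$ **Discretization.** Take an $s$-stage Runge–Kutta scheme $(a_{ij},b_i)$ with $A=(a_{ij})$ invertible, $b$ equal to a row of $A$, and $\sum_i b_i=1$ (for example a Radau IIA scheme). A discrete trajectory has $K$ steps with step sizes $h(k)>0$, mesh points $t(k)=t_0+\sum_{j<k}h(j)$ with $t(K)=t_f$, a transition step $0<k_t<K$, states $x(k)$ with $x(0)=x(t_0)$, and stages $x_i(k+1),z_i(k+1)$. With $u(k)=u^1(t(k))$ and $\varphi_i=f^1(x_i(k+1),u(k))$ for $k<k_t$, and with $u(k)=u^2(t(k))$ and $\varphi_i=f^2(x_i(k+1),z_i(k+1),u(k))$ for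 $k_t\le k<K$, $$x_i(k+1)=x(k)+h(k)\sum_j a_{ij}\varphi_j,\qquad x(k+1)=x(k)+h(k)\sum_i b_i\varphi_i,$$ and $g(x_i(k+1))=0$ for all $i$ if $k\ge k_t$. Moreover $g(x(k))$ is nonzero with the sign of $g(x(0))$ for $k<k_t$, and $g(x(k_t))=0$. Write these systems as $F^1(X^1(k+1),X^1(k),u(k),h(k))=0$ for $k<k_t$ and $F^2(X^2(k+1),X^2(k),u(k),h(k))=0$ for $k\ge k_t$, where $X^1=(x_1,\dots,x_s,x)$, $X^2=(x_1,z_1,\dots,x_s,z_s,x)$ and each equation is written as left side minus right side (with $-g(x_i(k+1))$ for the algebraic ones). Let $F^\ell_{X^+},F^\ell_X,F^\ell_h$ be the partial derivatives of $F^\ell$ with respect to $X^\ell(k+1)$, $X^\ell(k)$ and $h$, evaluated at step $k$. The discrete adjoint is given by $\Lambda^2(K)=(0,\dots,0,\lambda_f(K))$ with $\phi_x^T(x(K))+\lambda_f(K)=\nu_K\, g_x^T(x(K))$ for some $\nu_K\in\mathbb R$ and $g_x(x(K))\lambda_f(K)=0$, and by $$\Lambda^2(k)=-F^2_X(k)^T[F^2_{X^+}(k)]^{-T}\Lambda^2(k+1),\qquad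 k=K-1,\dots,k_t;$$ the vector at $k=k_t$ is denoted $\Lambda^{2+}(k_t)$. The last blocks of $\Lambda^2(k)$ and $\Lambda^{2+}(k_t)$ are $\lambda_f^2(k)$ and $\lambda_f^{2+}(k_t)$. The discrete jump conditions for the unknowns $\lambda^{1-}(k_t)$ and $\pi(k_t)$ are, with $\Lambda^{1-}(k_t)=(0,\dots,0,\lambda^{1-}(k_t))$, $$\lambda^{1-}(k_t)+\pi(k_t)\,g_x(x(k_t))^T=\lambda_f^{2+}(k_t),$$ $$\Lambda^{1-}(k_t)^T[F^1_{X^+}(k_t-1)]^{-1}F^1_h(k_t-1)=\Lambda^2(k_t+1)^T[F^2_{X^+}(k_t)]^{-1}F^2_h(k_t).$$ Put $w(k_t-1)=[F^1_{X^+}(k_t-1)]^{-1}F^1_h(k_t-1)$, with stage components $w^i$; put $w(k_t)=[F^2_{X^+}(k_t)]^{-1}F^2_h(k_t)$, with stage components $(w_f^i,w_g^i)$; and let $$I_1=h(k_t-1)\sum_i b_if^1_{xi}w^i-\sum_ib_if^1(x_i(k_t),u(k_t-1)),$$ $$I_2=h(k_t)\sum_ib_i\bigl(f^2_{xi}w_f^i+f^2_{zi}w_g^i\bigr)-\sum_ib_if^2(x_i(k_t+1),z_i(k_t+1),u(k_t)),$$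 where $f^1_{xi}$ is evaluated at $(x_i(k_t),u(k_t-1))$ and $f^2_{xi},f^2_{zi}$ at $(x_i(k_t+1),z_i(k_t+1),u(k_t))$. **Claim.** Consider a sequence of such discrete trajectories, with their discrete adjoints, whose maximal step size tends to $0$. Assume that all matrices $F^1_{X^+}(k)$ ($k<k_t$) and $F^2_{X^+}(k)$ ($k_t\le k<K$) are invertible, and that $f^1,f^1_x$, respectively $f^2,f^2_x,f^2_z$, are uniformly bounded on a region containing all the points $(x_i(k+1),u(k))$, $k<k_t$, respectively $(x_i(k+1),z_i(k+1),u(k))$, $k\ge k_t$. Then: 1. whenever $g_x(x(k_t))I_1\ne0$, the discrete jump conditions have a unique solution, namely $$\pi(k_t)=\frac{\lambda_f^2(k_t+1)^T(-I_2)-\lambda_f^{2+}(k_t)^T(-I_1)}{g_x(x(k_t))\,I_1},\qquad \lambda^{1-}(k_t)=\lambda_f^{2+}(k_t)-\pi(k_t)\,g_x(x(k_t))^T;$$ 2. $g_x(x(k_t))I_1\neq0$ for all sufficiently late members of the sequence; 3. $\pi(k_t)\to\pi_t$ along the sequence, both for $\pi(k_t)$ given by the formula and for any $\pi(k_t)$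 that eventually satisfy the discrete jump conditions. -/

import Mathlib

open Filter Topology Set

noncomputable section

/-- The state space `ℝ^d`. -/
abbrev State (d : ℕ) := EuclideanSpace ℝ (Fin d)

/-- The control space `ℝ^m`. -/
abbrev Control (m : ℕ) := EuclideanSpace ℝ (Fin m)

/-- The data of the hybrid optimal control problem: `x' = f1 (x, u)` before the transition,
`x' = fF (x, u) + g_x(x)ᵀ z`, `0 = g (x)` in the sliding mode, endpoint cost `phi`. -/
structure HybridSystem (d m : ℕ) where
  f1 : State d → Control m → State d
  fF : State d → Control m → State d
  g : State d → ℝ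
  phi : State d → ℝ

namespace HybridSystem

variable {d m : ℕ}

/-- The column vector `g_x(x)ᵀ`. -/
def gxT (S : HybridSystem d m) (x : State d) : State d := gradient S.g x

/-- The sliding vector field `f²(x, z, u) = f_F(x, u) + g_x(x)ᵀ z`. -/
def f2 (S : HybridSystem d m) (x : State d) (z : ℝ) (u : Control m) : State d :=
  S.fF x u + z • S.gxT x

/-- Partial derivative `f¹_x`. -/
def f1x (S : HybridSystem d m) (x : State d) (u : Control m) : State d →L[ℝ] State d :=
  fderiv ℝ (fun y => S.f1 y u) x

/-- Partial derivative `f²_x`. -/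
def f2x (S : HybridSystem d m) (x : State d) (z : ℝ) (u : Control m) :
    State d →L[ℝ] State d :=
  fderiv ℝ (fun y => S.f2 y z u) x

/-- Partial derivative `f²_z`. -/
def f2z (S : HybridSystem d m) (x : State d) (z : ℝ) (u : Control m) : State d :=
  deriv (fun ζ => S.f2 x ζ u) z

/-- Smoothness of the problem data. -/
structure Smooth (S : HybridSystem d m) : Prop where
  f1 : ContDiff ℝ 1 (fun p : State d × Control m => S.f1 p.1 p.2)
  fF : ContDiff ℝ 1 (fun p : State d × Control m => S.fF p.1 p.2)
  g : ContDiff ℝ 2 S.g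
  phi : ContDiff ℝ 1 S.phi

end HybridSystem

/-- `u` is bounded on `[a, b]` and continuous there off the finite set `B`. -/
structure PiecewiseControl {m : ℕ} (u : ℝ → Control m) (a b : ℝ) (B : Finset ℝ) : Prop where
  bounded : Bornology.IsBounded (u '' Icc a b)
  cont : ContinuousOn u (Icc a b \ B)

/-- The continuous hybrid trajectory on `[t0, tf]` entering the sliding mode at time `tt`:
control `u1` is used before the transition, `u2` after it.  The differential equations hold
off the finite set `B` of control discontinuities. -/
structure IsHybridTrajectory {d m : ℕ} (S : HybridSystem d m) (u1 u2 : ℝ → Control m)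
    (B : Finset ℝ) (t0 tt tf : ℝ) (x : ℝ → State d) (z : ℝ → ℝ) : Prop where
  start_lt : t0 < tt
  lt_final : tt < tf
  cont : ContinuousOn x (Icc t0 tf)
  ode : ∀ t ∈ Icc t0 tt, t ∉ B → HasDerivWithinAt x (S.f1 (x t) (u1 t)) (Icc t0 tt) t
  before : ∀ t ∈ Ico t0 tt, S.g (x t) ≠ 0
  dae_diff : ∀ t ∈ Icc tt tf, t ∉ B →
    HasDerivWithinAt x (S.f2 (x t) (z t) (u2 t)) (Icc tt tf) t
  dae_alg : ∀ t ∈ Icc tt tf, S.g (x t) = 0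

/-- The continuous adjoint equations of the sliding phase, with their terminal conditions.
`lf tt` is the value `λ_f(t_t⁺)`. -/
structure IsSlidingAdjoint {d m : ℕ} (S : HybridSystem d m) (u2 : ℝ → Control m)
    (B : Finset ℝ) (tt tf : ℝ) (x : ℝ → State d) (z : ℝ → ℝ)
    (lf : ℝ → State d) (lg : ℝ → ℝ) : Prop where
  cont : ContinuousOn lf (Icc tt tf)
  diff : ∀ t ∈ Icc tt tf, t ∉ B →
    HasDerivWithinAt lf
      (-(ContinuousLinearMap.adjoint (S.f2x (x t) (z t) (u2 t)) (lf t)) + lg t • S.gxT (x t))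
      (Icc tt tf) t
  alg : ∀ t ∈ Icc tt tf, inner ℝ (lf t) (S.gxT (x t)) = 0
  terminal : ∃ ν : ℝ, gradient S.phi (x tf) + lf tf = ν • S.gxT (x tf)

/-- The jump conditions of the continuous adjoint variable at `tt` for the unknowns
`lm = λ_f(t_t⁻)` and `p = π_t`. -/
def ContinuousJump {d m : ℕ} (S : HybridSystem d m) (u1 u2 : ℝ → Control m) (tt : ℝ)
    (x : ℝ → State d) (z : ℝ → ℝ) (lf : ℝ → State d) (lg : ℝ → ℝ)
    (lm : State d) (p : ℝ) : Prop :=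
  lm = lf tt - p • S.gxT (x tt) ∧
  inner ℝ lm (S.f1 (x tt) (u1 tt)) =
    inner ℝ (lf tt) (S.fF (x tt) (u2 tt)) + inner ℝ (lf tt) (z tt • S.gxT (x tt))
      - lg tt * S.g (x tt)

/-- Coefficients of an `s`-stage Runge--Kutta scheme. -/
structure RKTableau (s : ℕ) where
  A : Matrix (Fin s) (Fin s) ℝ
  b : Fin s → ℝ

/-- The properties of the Radau IIA schemes that are used: `A` is invertible, the weights
are a row of `A` (stiff accuracy, the last row for Radau IIA), and `∑ bᵢ = 1`. -/
structure RKTableau.StifflyAccurate {s : ℕ} (T : RKTableau s) : Prop where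
  invertible : IsUnit T.A.det
  row : ∃ r : Fin s, ∀ j, T.A r j = T.b j
  sum_b : ∑ i, T.b i = 1

/-- The three-stage Radau IIA scheme. -/
def radauIIA3 : RKTableau 3 where
  A := !![(88 - 7 * √6) / 360, (296 - 169 * √6) / 1800, (-2 + 3 * √6) / 225;
          (296 + 169 * √6) / 1800, (88 + 7 * √6) / 360, (-2 - 3 * √6) / 225;
          (16 - √6) / 36, (16 + √6) / 36, 1 / 9]
  b := ![(16 - √6) / 36, (16 + √6) / 36, 1 / 9]

theorem radauIIA3_stifflyAccurate : radauIIA3.StifflyAccurate := by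
  have h6 : √6 ^ 2 = (6 : ℝ) := Real.sq_sqrt (by norm_num)
  refine ⟨?_, ⟨2, ?_⟩, ?_⟩
  · have hdet : radauIIA3.A.det = 1 / 60 := by
      simp only [radauIIA3, Matrix.det_fin_three, Matrix.of_apply, Matrix.cons_val',
        Matrix.cons_val_zero, Matrix.cons_val_one, Matrix.cons_val]
      linear_combination (31 / 15000 : ℝ) * h6
    rw [hdet]
    exact isUnit_iff_ne_zero.mpr (by norm_num)
  · intro j
    fin_cases j <;> simp [radauIIA3]
  · simp [radauIIA3, Fin.sum_univ_three]
    ring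

/-- Augmented states `X¹ = (x₁, …, x_s, x)`. -/
abbrev Aug1 (d s : ℕ) := (Fin s → State d) × State d

/-- Augmented states `X² = (x₁, z₁, …, x_s, z_s, x)`. -/
abbrev Aug2 (d s : ℕ) := (Fin s → State d × ℝ) × State d

section Scheme

variable {d m s : ℕ}

/-- The implicit discrete state equation map `F¹(X⁺, X, u, h)` of the first phase. -/
def F1 (S : HybridSystem d m) (T : RKTableau s) (Xp X : Aug1 d s) (u : Control m) (h : ℝ) :
    Aug1 d s :=
  (fun i => Xp.1 i - X.2 - h • ∑ j, T.A i j • S.f1 (Xp.1 j) u,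
    Xp.2 - X.2 - h • ∑ i, T.b i • S.f1 (Xp.1 i) u)

/-- The implicit discrete state equation map `F²(X⁺, X, u, h)` of the sliding phase. -/
def F2 (S : HybridSystem d m) (T : RKTableau s) (Xp X : Aug2 d s) (u : Control m) (h : ℝ) :
    Aug2 d s :=
  (fun i => ((Xp.1 i).1 - X.2 - h • ∑ j, T.A i j • S.f2 (Xp.1 j).1 (Xp.1 j).2 u,
      -S.g (Xp.1 i).1),
    Xp.2 - X.2 - h • ∑ i, T.b i • S.f2 (Xp.1 i).1 (Xp.1 i).2 u)

end Scheme

/-- The data of one discrete hybrid trajectory: `K` steps, transition at step `kt`, step sizes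
`h k`, controls `u k`, states `x k`, stage values `xs k i = xᵢ(k)` and `zs k i = zᵢ(k)`. -/
structure DiscreteRun (d m s : ℕ) where
  K : ℕ
  kt : ℕ
  h : ℕ → ℝ
  u : ℕ → Control m
  x : ℕ → State d
  xs : ℕ → Fin s → State d
  zs : ℕ → Fin s → ℝ

namespace DiscreteRun

variable {d m s : ℕ}

/-- The time instant `t(k)`. -/
def time (D : DiscreteRun d m s) (t0 : ℝ) (k : ℕ) : ℝ := t0 + ∑ j ∈ Finset.range k, D.h j

/-- The augmented state `X¹(k)`. -/
def X1 (D : DiscreteRun d m s) (k : ℕ) : Aug1 d s := (D.xs k, D.x k)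

/-- The augmented state `X²(k)`. -/
def X2 (D : DiscreteRun d m s) (k : ℕ) : Aug2 d s := (fun i => (D.xs k i, D.zs k i), D.x k)

/-- `D` is produced by the scheme: `F¹ = 0` on the steps `k < kt`, `F² = 0` on the steps
`kt ≤ k < K`; the controls are sampled from `u1` and `u2`; `g` does not change its sign on
the discrete states before step `kt`, and step `kt` lies on the switching surface. -/
structure IsSolution (D : DiscreteRun d m s) (S : HybridSystem d m) (T : RKTableau s)
    (u1 u2 : ℝ → Control m) (t0 tf : ℝ) (x0 : State d) : Prop where
  kt_pos : 0 < D.kt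
  kt_lt : D.kt < D.K
  h_pos : ∀ k < D.K, 0 < D.h k
  final : D.time t0 D.K = tf
  init : D.x 0 = x0
  control1 : ∀ k < D.kt, D.u k = u1 (D.time t0 k)
  control2 : ∀ k, D.kt ≤ k → k < D.K → D.u k = u2 (D.time t0 k)
  step1 : ∀ k < D.kt, F1 S T (D.X1 (k + 1)) (D.X1 k) (D.u k) (D.h k) = 0
  step2 : ∀ k, D.kt ≤ k → k < D.K → F2 S T (D.X2 (k + 1)) (D.X2 k) (D.u k) (D.h k) = 0
  no_sign_change : ∀ k < D.kt, 0 < S.g x0 * S.g (D.x k)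
  transition : S.g (D.x D.kt) = 0

/-- The Jacobian `F¹_{X⁺}(k)`. -/
def F1Xp (D : DiscreteRun d m s) (S : HybridSystem d m) (T : RKTableau s) (k : ℕ) :
    Aug1 d s →L[ℝ] Aug1 d s :=
  fderiv ℝ (fun Y => F1 S T Y (D.X1 k) (D.u k) (D.h k)) (D.X1 (k + 1))

/-- The derivative `F¹_h(k)`. -/
def F1h (D : DiscreteRun d m s) (S : HybridSystem d m) (T : RKTableau s) (k : ℕ) :
    Aug1 d s :=
  deriv (fun η => F1 S T (D.X1 (k + 1)) (D.X1 k) (D.u k) η) (D.h k)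

/-- The Jacobian `F²_{X⁺}(k)`. -/
def F2Xp (D : DiscreteRun d m s) (S : HybridSystem d m) (T : RKTableau s) (k : ℕ) :
    Aug2 d s →L[ℝ] Aug2 d s :=
  fderiv ℝ (fun Y => F2 S T Y (D.X2 k) (D.u k) (D.h k)) (D.X2 (k + 1))

/-- The Jacobian `F²_X(k)`. -/
def F2X (D : DiscreteRun d m s) (S : HybridSystem d m) (T : RKTableau s) (k : ℕ) :
    Aug2 d s →L[ℝ] Aug2 d s :=
  fderiv ℝ (fun Y => F2 S T (D.X2 (k + 1)) Y (D.u k) (D.h k)) (D.X2 k)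

/-- The derivative `F²_h(k)`. -/
def F2h (D : DiscreteRun d m s) (S : HybridSystem d m) (T : RKTableau s) (k : ℕ) :
    Aug2 d s :=
  deriv (fun η => F2 S T (D.X2 (k + 1)) (D.X2 k) (D.u k) η) (D.h k)

/-- The matrices `F¹_{X⁺}`, `F²_{X⁺}` are invertible along the discrete trajectory. -/
structure Invertible (D : DiscreteRun d m s) (S : HybridSystem d m) (T : RKTableau s) :
    Prop where
  phase1 : ∀ k < D.kt, (D.F1Xp S T k).IsInvertible
  phase2 : ∀ k, D.kt ≤ k → k < D.K → (D.F2Xp S T k).IsInvertible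

/-- All stage points of the discrete trajectory lie in the regions `N1` and `N2`. -/
structure StagesIn (D : DiscreteRun d m s) (N1 : Set (State d × Control m))
    (N2 : Set (State d × ℝ × Control m)) : Prop where
  phase1 : ∀ k < D.kt, ∀ i, (D.xs (k + 1) i, D.u k) ∈ N1
  phase2 : ∀ k, D.kt ≤ k → k < D.K → ∀ i, (D.xs (k + 1) i, D.zs (k + 1) i, D.u k) ∈ N2

/-- The row vector `(0, …, 0, lᵀ)` on `Aug1`. -/
def row1 (l : State d) : Aug1 d s →L[ℝ] ℝ :=
  (innerSL ℝ l).comp (ContinuousLinearMap.snd ℝ (Fin s → State d) (State d))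

/-- The row vector `(0, …, 0, lᵀ)` on `Aug2`. -/
def row2 (l : State d) : Aug2 d s →L[ℝ] ℝ :=
  (innerSL ℝ l).comp (ContinuousLinearMap.snd ℝ (Fin s → State d × ℝ) (State d))

/-- The last block `λ_f` of the row vector `Λᵀ`. -/
def lamPart (L : Aug2 d s →L[ℝ] ℝ) : State d :=
  (InnerProductSpace.toDual ℝ (State d)).symm
    (L.comp (ContinuousLinearMap.inr ℝ (Fin s → State d × ℝ) (State d)))

/-- The discrete adjoint equations of the sliding phase: `L k` is the row vector `Λ²(k)ᵀ`
for `kt < k ≤ K` and `L kt` is `Λ²⁺(kt)ᵀ`. -/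
structure IsAdjoint (D : DiscreteRun d m s) (S : HybridSystem d m) (T : RKTableau s)
    (L : ℕ → Aug2 d s →L[ℝ] ℝ) : Prop where
  terminal : ∃ (l : State d) (ν : ℝ), L D.K = row2 l ∧
    gradient S.phi (D.x D.K) + l = ν • S.gxT (D.x D.K) ∧
    inner ℝ l (S.gxT (D.x D.K)) = 0
  step : ∀ k, D.kt ≤ k → k < D.K →
    L k = -(((L (k + 1)).comp (D.F2Xp S T k).inverse).comp (D.F2X S T k))

/-- The discrete jump conditions at step `kt` for the unknowns `lm = λ¹⁻(kt)`, `p = π(kt)`: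
transversality, and continuity of the discrete Hamiltonian. -/
def Jump (D : DiscreteRun d m s) (S : HybridSystem d m) (T : RKTableau s)
    (L : ℕ → Aug2 d s →L[ℝ] ℝ) (lm : State d) (p : ℝ) : Prop :=
  lm + p • S.gxT (D.x D.kt) = lamPart (L D.kt) ∧
  row1 lm ((D.F1Xp S T (D.kt - 1)).inverse (D.F1h S T (D.kt - 1))) =
    L (D.kt + 1) ((D.F2Xp S T D.kt).inverse (D.F2h S T D.kt))

/-- The vector `h(kt-1) ∑ bᵢ f¹_{xᵢ} wⁱ(kt-1) - ∑ bᵢ f¹(xᵢ(kt), u(kt-1))`, where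
`w(kt-1) = F¹_{X⁺}(kt-1)⁻¹ F¹_h(kt-1)`. -/
def increment1 (D : DiscreteRun d m s) (S : HybridSystem d m) (T : RKTableau s) : State d :=
  let k := D.kt - 1
  let w := (D.F1Xp S T k).inverse (D.F1h S T k)
  D.h k • ∑ i, T.b i • S.f1x (D.xs D.kt i) (D.u k) (w.1 i)
    - ∑ i, T.b i • S.f1 (D.xs D.kt i) (D.u k)

/-- The vector `h(kt) ∑ bᵢ f²_{xᵢ} w_fⁱ(kt) + h(kt) ∑ bᵢ f²_{zᵢ} w_gⁱ(kt)
- ∑ bᵢ f²(xᵢ(kt+1), zᵢ(kt+1), u(kt))`, where `w(kt) = F²_{X⁺}(kt)⁻¹ F²_h(kt)`. -/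
def increment2 (D : DiscreteRun d m s) (S : HybridSystem d m) (T : RKTableau s) : State d :=
  let k := D.kt
  let w := (D.F2Xp S T k).inverse (D.F2h S T k)
  D.h k • ∑ i, T.b i • S.f2x (D.xs (k + 1) i) (D.zs (k + 1) i) (D.u k) (w.1 i).1
    + D.h k • ∑ i, T.b i • (w.1 i).2 • S.f2z (D.xs (k + 1) i) (D.zs (k + 1) i) (D.u k)
    - ∑ i, T.b i • S.f2 (D.xs (k + 1) i) (D.zs (k + 1) i) (D.u k)

/-- The denominator of the explicit formula for the discrete jump. -/
def jumpDenom (D : DiscreteRun d m s) (S : HybridSystem d m) (T : RKTableau s) : ℝ :=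
  fderiv ℝ S.g (D.x D.kt) (D.increment1 S T)

/-- The explicit formula for the discrete jump `π(kt)`. -/
def jumpFormula (D : DiscreteRun d m s) (S : HybridSystem d m) (T : RKTableau s)
    (L : ℕ → Aug2 d s →L[ℝ] ℝ) : ℝ :=
  (inner ℝ (lamPart (L (D.kt + 1))) (-(D.increment2 S T))
    - inner ℝ (lamPart (L D.kt)) (-(D.increment1 S T))) / D.jumpDenom S T

end DiscreteRun

end

/-!
The discrete jump conditions are a linear system of two equations. The vector
`w = F_{X⁺}⁻¹ F_h` is minus the derivative of one step with respect to its length. Its last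
component is `I₁` before the transition and `I₂` after it, so that the second condition reads
`⟪λ¹⁻, I₁⟫ = ⟪λ², I₂⟫`; inserting `λ¹⁻ = λ²⁺ - π g_xᵀ` gives the explicit formula
(`DiscreteRun.jump_iff_eq_jumpFormula`). It remains to find the limits of the quantities in the
formula and to see that the denominator stays away from zero.

*Before the transition.* The discrete states follow the trajectory by a Gronwall argument. The
controls are only piecewise continuous, so the consistency error of the individual steps is not
uniformly small; but the steps that meet a small neighbourhood of the discontinuities have small
total length (`exists_sum_euler_error_le`, `exists_forward_convergence`). The transition
time is not prescribed. As `g(x)` has no zero before `tt`, the discrete transition cannot occur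
much earlier. If it occurred much later, the discrete trajectory would be continued with `f¹`
across the surface, which it crosses transversally because `g_x f¹ ≠ 0` at `tt`, and `g` would
change its sign (`exists_transition_time`). Therefore `x(k_t)` converges, and `I₁ → -f¹`
(`exists_increment1_limit`), which settles the denominator.

*In the sliding mode.* The index condition lets `z` be eliminated: the trajectory solves
`x' = f_red(x, u)`, where `f_red` is `f²` with `z` chosen such that `f²` is tangent to the level
sets of `g`, and the adjoint solves a linear equation `λ' = -R(x, u) λ`. No convergence of the
stage values `z_i` is assumed. It is obtained from the bound on the slopes `f²` alone: the
constraints `g(x_i) = 0`, together with the invertibility of `A`, force the slopes to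
be tangent up to `O(h)`, hence `f²(x_i, z_i, u) = f_red(x, u) + O(h)`
(`exists_slidingBounds`). So the discrete states are an Euler scheme for the reduced equation up to
`O(h²)` per step (`exists_phase2_convergence`).

*The adjoint.* Transposing `F²_X` and `F²_{X⁺}`, one step of the discrete adjoint is characterised
by `⟪λ(k), v⟫ = ⟪λ(k+1), ξ⟫` for every `v`, where `ξ` is the linearised step started from `v`
(`DiscreteRun.IsAdjoint.exists_tangent_step`). The vectors `ξ` are tangent, so only the tangential
part of `λ(k+1)` enters. For tangent `v` the linearised step is an Euler step of the transposed
adjoint equation up to `o(h)` (`SlidingBounds.exists_adjoint_tangent_bound`), and a backward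
Gronwall argument from the terminal condition yields uniform convergence of the tangential parts
(`exists_adjoint_convergence`). For normal `v` the linearised multipliers are of size `1 / h` and
absorb `v` within one step, so that the normal component of `λ(k)` is `O(h)`
(`SlidingBounds.exists_adjoint_normal_bound`). Likewise `I₂` is tangent and converges to `-f_red`.

In the limit the formula becomes `(⟪λ_f, f_red⟫ - ⟪λ_f, f¹⟫) / (-g_x f¹)`, which is the continuous
jump, because `g` vanishes at the transition and `λ_f` is orthogonal to `g_xᵀ`
(`ContinuousJump.eq_div`).
-/

noncomputable section
open MeasureTheory

/-! ### Consistency of the Euler scheme for piecewise continuous right-hand sides -/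

/-- Off an open set of small measure, a function that is continuous off a finite set has a
uniform modulus of continuity. -/
theorem exists_modulus_off_small_open {E : Type*} [NormedAddCommGroup E] {v : ℝ → E} {a b : ℝ}
    {B : Finset ℝ} (hv : ContinuousOn v (Icc a b \ B)) {ε η : ℝ} (hε : 0 < ε) (hη : 0 < η) :
    ∃ U : Set ℝ, IsOpen U ∧ volume U < ENNReal.ofReal η ∧ ∃ δ > 0, ∀ t ∈ Icc a b, t ∉ U →
      ∀ s ∈ Icc a b, |s - t| ≤ δ → ‖v t - v s‖ ≤ ε := by
  rcases lt_or_ge b a with hab | hab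
  · exact ⟨∅, isOpen_empty, by simpa using hη, 1, one_pos, fun t ht => absurd (ht.1.trans ht.2)
      (not_le.mpr hab)⟩
  have hB : volume (B : Set ℝ) < ENNReal.ofReal η := by
    rw [B.finite_toSet.measure_zero]; simpa using hη
  obtain ⟨U, hBU, hU, hUη⟩ := (B : Set ℝ).exists_isOpen_lt_of_lt _ hB
  refine ⟨U, hU, hUη, ?_⟩
  have hK : IsCompact (Icc a b \ U) := isCompact_Icc.diff hU
  have hc : ∀ t ∈ Icc a b \ U, ContinuousAt (fun s => v (projIcc a b hab s)) t := by
    intro t ht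
    have htB : t ∈ Icc a b \ B := ⟨ht.1, fun h => ht.2 (hBU h)⟩
    have h1 : ContinuousWithinAt v (Icc a b) t := by
      refine (hv t htB).mono_of_mem_nhdsWithin ?_
      have : ((B : Set ℝ)ᶜ) ∈ 𝓝 t := B.finite_toSet.isClosed.isOpen_compl.mem_nhds htB.2
      exact inter_mem self_mem_nhdsWithin (mem_nhdsWithin_of_mem_nhds this)
    have h2 : Tendsto (fun s => (projIcc a b hab s : ℝ)) (𝓝 t) (𝓝[Icc a b] t) := by
      refine tendsto_nhdsWithin_iff.mpr ⟨?_, Eventually.of_forall fun s => (projIcc a b hab s).2⟩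
      have := (continuous_subtype_val.comp (continuous_projIcc (h := hab))).tendsto t
      simpa [Function.comp_def, projIcc_of_mem hab ht.1] using this
    have h3 : (fun s => v (projIcc a b hab s)) t = v t := by simp [projIcc_of_mem hab ht.1]
    unfold ContinuousAt
    rw [h3]
    exact h1.tendsto.comp h2
  have := hK.uniformContinuousAt_of_continuousAt _ hc (Metric.dist_mem_uniformity hε)
  obtain ⟨δ, hδ, hδ'⟩ := Metric.mem_uniformity_dist.mp this
  refine ⟨δ / 2, by positivity, fun t ht htU s hs hst => ?_⟩
  have h4 := hδ' (a := t) (b := s) (by rw [dist_comm, Real.dist_eq]; linarith) ⟨ht, htU⟩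
  simp only [mem_ofPred_eq, projIcc_of_mem hab ht, projIcc_of_mem hab hs, dist_eq_norm] at h4
  exact h4.le

/-- A bounded function that is continuous off a finite set is interval integrable. -/
theorem intervalIntegrable_of_bounded_of_continuousOn_diff {E : Type*} [NormedAddCommGroup E]
    {v : ℝ → E} {a b M : ℝ}
    {B : Finset ℝ} (hv : ContinuousOn v (Icc a b \ B)) (hM : ∀ t ∈ Icc a b, ‖v t‖ ≤ M)
    {s t : ℝ} (hs : a ≤ s) (hst : s ≤ t) (ht : t ≤ b) : IntervalIntegrable v volume s t := by
  rw [intervalIntegrable_iff_integrableOn_Icc_of_le hst]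
  have hm : MeasurableSet (Icc a b \ (B : Set ℝ)) :=
    measurableSet_Icc.diff B.measurableSet
  have h1 : AEStronglyMeasurable v (volume.restrict (Icc a b)) := by
    have := hv.aestronglyMeasurable hm (μ := volume)
    have he : (Icc a b \ (B : Set ℝ) : Set ℝ) =ᵐ[volume] Icc a b :=
      sdiff_null_ae_eq_self (B.finite_toSet.measure_zero _)
    rwa [Measure.restrict_congr_set he] at this
  have h2 : IntegrableOn v (Icc a b) :=
    Integrable.of_bound h1 M
      ((ae_restrict_iff' measurableSet_Icc).mpr (Eventually.of_forall hM))
  exact h2.mono_set (Icc_subset_Icc hs ht)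

/-- The local errors of the explicit Euler scheme add up to a small amount on fine meshes,
for a function `y` whose derivative `v` is bounded and continuous off a finite set.  The mesh may
start slightly before the left end point `a`, where `y` is continued by the constant `y a`. -/
theorem exists_sum_euler_error_le {E : Type*} [NormedAddCommGroup E] [NormedSpace ℝ E]
    [CompleteSpace E] {y v : ℝ → E} {c a b M : ℝ} {B : Finset ℝ} (hca : c ≤ a) (hab : a ≤ b)
    (hy : ContinuousOn y (Icc a b)) (hd : ∀ t ∈ Ioo a b, t ∉ B → HasDerivAt y (v t) t)
    (hM : ∀ t ∈ Icc c b, ‖v t‖ ≤ M) (hv : ContinuousOn v (Icc a b \ B)) {ε : ℝ} (hε : 0 < ε) :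
    ∃ δ > 0, ∀ (t : ℕ → ℝ) (p q : ℕ), p ≤ q →
      (∀ k, p ≤ k → k < q → t k ≤ t (k + 1) ∧ t (k + 1) ≤ t k + δ) → c ≤ t p → a - δ ≤ t p →
      t q ≤ b →
      ∑ k ∈ Finset.Ico p q,
        ‖y (max a (t (k + 1))) - y (max a (t k)) - (t (k + 1) - t k) • v (t k)‖ ≤ ε := by
  have hM0 : 0 ≤ M := (norm_nonneg _).trans (hM a ⟨hca, hab⟩)
  have hMab : ∀ t ∈ Icc a b, ‖v t‖ ≤ M := fun t ht => hM t ⟨hca.trans ht.1, ht.2⟩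
  set ε₁ := ε / (2 * (b - c + 1)) with hε₁
  have hbc : 0 < b - c + 1 := by linarith
  have hε₁0 : 0 < ε₁ := by positivity
  set η := ε / (16 * (M + 1)) with hη
  have hη0 : 0 < η := by positivity
  obtain ⟨U, hUo, hUη, δ₁, hδ₁, hmod⟩ := exists_modulus_off_small_open hv hε₁0 hη0
  refine ⟨min δ₁ η, lt_min hδ₁ hη0, fun t p q hpq hstep hcp hap hqb => ?_⟩
  set δ := min δ₁ η with hδdef
  -- off `W` the oscillation of `v` over a step is at most `ε₁`
  set W : Set ℝ := U ∪ Ico (a - δ) (a + δ) with hW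
  have hWm : MeasurableSet W := hUo.measurableSet.union measurableSet_Ico
  have hδ0 : 0 < δ := lt_min hδ₁ hη0
  have hWvol : volume W ≤ ENNReal.ofReal (3 * η) := by
    calc volume W ≤ volume U + volume (Ico (a - δ) (a + δ)) := measure_union_le _ _
      _ ≤ ENNReal.ofReal η + ENNReal.ofReal (2 * η) := by
        gcongr
        rw [Real.volume_Ico]
        exact ENNReal.ofReal_le_ofReal (by linarith [min_le_right δ₁ η])
      _ = ENNReal.ofReal (3 * η) := by
        rw [← ENNReal.ofReal_add hη0.le (by positivity)]; ring_nf
  have hWfin : volume W ≠ ⊤ := (hWvol.trans_lt ENNReal.ofReal_lt_top).ne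
  set φ : ℝ → ℝ := fun s => ε₁ + 2 * M * W.indicator (fun _ => 1) s with hφ
  have hind : Integrable (W.indicator (fun _ => (1 : ℝ))) volume :=
    (integrable_indicator_iff hWm).mpr (integrableOn_const hWfin)
  have hφi : ∀ s r, IntervalIntegrable φ volume s r := fun s r =>
    intervalIntegrable_const.add (hind.intervalIntegrable.const_mul _)
  have hφW : ∀ s ∈ W, φ s = ε₁ + 2 * M := fun s hs => by simp [hφ, hs]
  have hφge : ∀ s, ε₁ ≤ φ s := fun s => by
    have : 0 ≤ W.indicator (fun _ => (1 : ℝ)) s := indicator_nonneg (by simp) s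
    simp only [hφ]; nlinarith
  have hmono : ∀ k, p ≤ k → k ≤ q → t p ≤ t k := by
    intro k hk
    induction k, hk using Nat.le_induction with
    | base => intro _; exact le_rfl
    | succ k hk ih => intro h; exact (ih (by omega)).trans (hstep k hk (by omega)).1
  have hmono' : ∀ k, k ≤ q → p ≤ k → t k ≤ t q := by
    intro k hk
    induction hk using Nat.decreasingInduction with
    | self => intro _; exact le_rfl
    | of_succ k hk ih => intro h; exact (hstep k h hk).1.trans (ih (by omega))
  have hftc : ∀ s r, a ≤ s → s ≤ r → r ≤ b → y r - y s = ∫ x in s..r, v x := by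
    intro s r hs hsr hr
    refine (integral_eq_of_hasDerivAt_off_countable_of_le y v hsr B.countable_toSet
      (hy.mono (Icc_subset_Icc hs hr)) (fun x hx => hd x ?_ hx.2)
      (intervalIntegrable_of_bounded_of_continuousOn_diff hv hMab hs hsr hr)).symm
    exact ⟨hs.trans_lt hx.1.1, hx.1.2.trans_le hr⟩
  have hlip : ∀ s r, a ≤ s → s ≤ r → r ≤ b → ‖y r - y s‖ ≤ M * (r - s) := by
    intro s r hs hsr hr
    rw [hftc s r hs hsr hr]
    refine (intervalIntegral.norm_integral_le_of_norm_le_const (C := M) fun x hx => ?_).trans ?_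
    · rw [uIoc_of_le hsr] at hx
      exact hMab x ⟨hs.trans hx.1.le, hx.2.trans hr⟩
    · rw [abs_of_nonneg (by linarith)]
  have hterm : ∀ k, p ≤ k → k < q →
      ‖y (max a (t (k + 1))) - y (max a (t k)) - (t (k + 1) - t k) • v (t k)‖
        ≤ ∫ x in t k..t (k + 1), φ x := by
    intro k hpk hkq
    obtain ⟨h1, h2⟩ := hstep k hpk hkq
    have hkb : t (k + 1) ≤ b := (hmono' (k + 1) hkq (by omega)).trans hqb
    have hck : t p ≤ t k := hmono k hpk hkq.le
    rcases le_or_gt a (t k) with hak | hak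
    · rw [max_eq_right hak, max_eq_right (hak.trans h1), hftc _ _ hak h1 hkb]
      have hi := intervalIntegrable_of_bounded_of_continuousOn_diff hv hMab hak h1 hkb
      have : (t (k + 1) - t k) • v (t k) = ∫ _ in t k..t (k + 1), v (t k) := by simp
      rw [this, ← intervalIntegral.integral_sub hi intervalIntegrable_const]
      refine intervalIntegral.norm_integral_le_of_norm_le h1 (Eventually.of_forall ?_) (hφi _ _)
      intro x hx
      have hxI : x ∈ Icc a b := ⟨hak.trans hx.1.le, hx.2.trans hkb⟩
      have htI : t k ∈ Icc a b := ⟨hak, h1.trans hkb⟩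
      by_cases hxW : x ∈ W
      · rw [hφW x hxW]
        calc ‖v x - v (t k)‖ ≤ ‖v x‖ + ‖v (t k)‖ := norm_sub_le _ _
          _ ≤ M + M := add_le_add (hMab x hxI) (hMab _ htI)
          _ ≤ ε₁ + 2 * M := by linarith
      · refine (hmod x hxI (fun h => hxW (Or.inl h)) _ htI ?_).trans (hφge x)
        rw [abs_of_nonpos (by linarith [hx.1])]
        linarith [hx.2, min_le_left δ₁ η]
    · -- steps starting before `a` lie inside `W`
      have hb1 : ‖y (max a (t (k + 1))) - y (max a (t k))‖ ≤ M * (t (k + 1) - t k) := by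
        refine (hlip _ _ (le_max_left _ _) (max_le_max le_rfl h1) (max_le hab hkb)).trans ?_
        refine mul_le_mul_of_nonneg_left ?_ hM0
        rw [max_eq_left hak.le]
        rcases max_cases a (t (k + 1)) with h | h <;> rw [h.1] <;> linarith
      have hb2 : ‖(t (k + 1) - t k) • v (t k)‖ ≤ M * (t (k + 1) - t k) := by
        rw [norm_smul, Real.norm_of_nonneg (by linarith), mul_comm]
        exact mul_le_mul_of_nonneg_right (hM _ ⟨hcp.trans hck, h1.trans hkb⟩) (by linarith)
      have hb3 : ∫ x in t k..t (k + 1), (2 * M : ℝ) ≤ ∫ x in t k..t (k + 1), φ x := by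
        refine intervalIntegral.integral_mono_on_of_le_Ioo h1 intervalIntegrable_const (hφi _ _) ?_
        intro x hx
        rw [hφW x (Or.inr ⟨by linarith [hx.1], by linarith [hx.2]⟩)]
        linarith
      rw [intervalIntegral.integral_const, smul_eq_mul] at hb3
      refine (norm_sub_le _ _).trans ((add_le_add hb1 hb2).trans ?_)
      linarith
  calc _ ≤ ∑ k ∈ Finset.Ico p q, ∫ x in t k..t (k + 1), φ x :=
        Finset.sum_le_sum fun k hk => hterm k (Finset.mem_Ico.mp hk).1 (Finset.mem_Ico.mp hk).2
    _ = ∫ x in t p..t q, φ x :=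
        intervalIntegral.sum_integral_adjacent_intervals_Ico hpq fun k _ => hφi _ _
    _ = (t q - t p) * ε₁ + 2 * M * ∫ x in t p..t q, W.indicator (fun _ => (1 : ℝ)) x := by
        rw [intervalIntegral.integral_add intervalIntegrable_const
          (hind.intervalIntegrable.const_mul _), intervalIntegral.integral_const,
          intervalIntegral.integral_const_mul, smul_eq_mul]
    _ ≤ (b - c) * ε₁ + 2 * M * (3 * η) := by
        have hpq' := hmono q hpq le_rfl
        gcongr
        rw [intervalIntegral.integral_of_le hpq']
        calc ∫ x in Ioc (t p) (t q), W.indicator (fun _ => (1 : ℝ)) x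
            ≤ ∫ x, W.indicator (fun _ => (1 : ℝ)) x :=
              setIntegral_le_integral hind
                (Eventually.of_forall fun x => indicator_nonneg (by simp) x)
          _ = volume.real W := by simp [integral_indicator hWm]
          _ ≤ 3 * η := ENNReal.toReal_le_of_le_ofReal (by positivity) hWvol
    _ ≤ ε / 2 + ε / 2 := by
        gcongr
        · rw [hε₁, mul_div_assoc', div_le_div_iff₀ (by positivity) (by norm_num)]
          nlinarith
        · rw [hη, mul_div_assoc', mul_div_assoc', div_le_div_iff₀ (by positivity) (by norm_num)]
          nlinarith
    _ = ε := by ring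

end

noncomputable section
open MeasureTheory

/-! ### Discrete Gronwall estimates and convergence of one-step recursions -/

/-- Discrete Gronwall estimate for a recursion that is only known to hold as long as the error
stays below `ρ`; the resulting bound, if it is at most `ρ`, keeps the recursion alive. -/
theorem discrete_gronwall_forward {e r h : ℕ → ℝ} {p q : ℕ} {L ρ : ℝ} (hL : 0 ≤ L)
    (hp : 0 ≤ e p) (hh : ∀ k, p ≤ k → k < q → 0 ≤ h k) (hr : ∀ k, p ≤ k → k < q → 0 ≤ r k)
    (hstep : ∀ k, p ≤ k → k < q → e k ≤ ρ → e (k + 1) ≤ (1 + L * h k) * e k + r k)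
    (hρ : Real.exp (L * ∑ k ∈ Finset.Ico p q, h k) * (e p + ∑ k ∈ Finset.Ico p q, r k) ≤ ρ) :
    ∀ k, p ≤ k → k ≤ q →
      e k ≤ Real.exp (L * ∑ k ∈ Finset.Ico p q, h k) * (e p + ∑ k ∈ Finset.Ico p q, r k) := by
  have hmono : ∀ k, k ≤ q →
      Real.exp (L * ∑ j ∈ Finset.Ico p k, h j) * (e p + ∑ j ∈ Finset.Ico p k, r j)
        ≤ Real.exp (L * ∑ j ∈ Finset.Ico p q, h j) * (e p + ∑ j ∈ Finset.Ico p q, r j) := by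
    intro k hk
    have hsub : Finset.Ico p k ⊆ Finset.Ico p q := Finset.Ico_subset_Ico le_rfl hk
    have h1 : ∑ j ∈ Finset.Ico p k, h j ≤ ∑ j ∈ Finset.Ico p q, h j :=
      Finset.sum_le_sum_of_subset_of_nonneg hsub fun j hj _ =>
        hh j (Finset.mem_Ico.mp hj).1 (Finset.mem_Ico.mp hj).2
    have h2 : ∑ j ∈ Finset.Ico p k, r j ≤ ∑ j ∈ Finset.Ico p q, r j :=
      Finset.sum_le_sum_of_subset_of_nonneg hsub fun j hj _ =>
        hr j (Finset.mem_Ico.mp hj).1 (Finset.mem_Ico.mp hj).2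
    have h3 : 0 ≤ ∑ j ∈ Finset.Ico p k, r j := Finset.sum_nonneg fun j hj =>
        hr j (Finset.mem_Ico.mp hj).1 ((Finset.mem_Ico.mp hj).2.trans_le hk)
    have h4 : 0 ≤ e p + ∑ j ∈ Finset.Ico p k, r j := by linarith
    gcongr
  have key : ∀ k, p ≤ k → k ≤ q →
      e k ≤ Real.exp (L * ∑ j ∈ Finset.Ico p k, h j) * (e p + ∑ j ∈ Finset.Ico p k, r j) := by
    intro k hpk
    induction k, hpk using Nat.le_induction with
    | base => intro _; simp
    | succ k hpk ih =>
      intro hkq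
      have hk := ih (by omega)
      have hh0 := hh k hpk (by omega)
      have hr0 := hr k hpk (by omega)
      have hs := hstep k hpk (by omega) (hk.trans ((hmono k (by omega)).trans hρ))
      have h3 : 0 ≤ ∑ j ∈ Finset.Ico p (k + 1), h j := Finset.sum_nonneg fun j hj =>
        hh j (Finset.mem_Ico.mp hj).1 ((Finset.mem_Ico.mp hj).2.trans_le hkq)
      refine hs.trans ?_
      have h1 : 1 + L * h k ≤ Real.exp (L * h k) := by
        linarith [Real.add_one_le_exp (L * h k)]
      have h2 : r k ≤ Real.exp (L * ∑ j ∈ Finset.Ico p (k + 1), h j) * r k :=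
        le_mul_of_one_le_left hr0 (Real.one_le_exp (by positivity))
      have h5 : (1 + L * h k) * e k ≤ Real.exp (L * h k) *
          (Real.exp (L * ∑ j ∈ Finset.Ico p k, h j) * (e p + ∑ j ∈ Finset.Ico p k, r j)) :=
        (mul_le_mul_of_nonneg_left hk (by positivity)).trans
          (mul_le_mul_of_nonneg_right h1 ((by
            have : 0 ≤ ∑ j ∈ Finset.Ico p k, r j := Finset.sum_nonneg fun j hj =>
              hr j (Finset.mem_Ico.mp hj).1 ((Finset.mem_Ico.mp hj).2.trans (by omega))
            positivity)))
      calc _ ≤ _ := add_le_add h5 h2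
        _ = _ := by
          have hE : Real.exp (L * (∑ j ∈ Finset.Ico p k, h j + h k))
              = Real.exp (L * h k) * Real.exp (L * ∑ j ∈ Finset.Ico p k, h j) := by
            rw [← Real.exp_add]; ring_nf
          rw [Finset.sum_Ico_succ_top hpk, Finset.sum_Ico_succ_top hpk, hE]
          ring
  exact fun k hpk hkq => (key k hpk hkq).trans (hmono k hkq)

/-- Discrete Gronwall estimate for a recursion running backwards. -/
theorem discrete_gronwall_backward {e r h : ℕ → ℝ} {p q : ℕ} {L : ℝ} (hL : 0 ≤ L)
    (hq : 0 ≤ e q) (hh : ∀ k, p ≤ k → k < q → 0 ≤ h k) (hr : ∀ k, p ≤ k → k < q → 0 ≤ r k)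
    (hstep : ∀ k, p ≤ k → k < q → e k ≤ (1 + L * h k) * e (k + 1) + r k) :
    ∀ k, p ≤ k → k ≤ q →
      e k ≤ Real.exp (L * ∑ k ∈ Finset.Ico p q, h k) * (e q + ∑ k ∈ Finset.Ico p q, r k) := by
  intro k hpk hkq
  have key := discrete_gronwall_forward (e := fun i => e (q - i)) (r := fun i => r (q - 1 - i))
    (h := fun i => h (q - 1 - i)) (p := 0) (q := q - p) hL (by simpa using hq)
    (fun i _ hi => hh _ (by omega) (by omega)) (fun i _ hi => hr _ (by omega) (by omega))
    (fun i _ hi _ => by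
      have := hstep (q - 1 - i) (by omega) (by omega)
      rw [show q - 1 - i + 1 = q - i by omega] at this
      rwa [show q - (i + 1) = q - 1 - i by omega])
    le_rfl (q - k) (by omega) (by omega)
  have hrefl : ∀ f : ℕ → ℝ,
      ∑ i ∈ Finset.Ico 0 (q - p), f (q - 1 - i) = ∑ i ∈ Finset.Ico p q, f i := by
    intro f
    refine Finset.sum_bij' (fun i _ => q - 1 - i) (fun i _ => q - 1 - i) ?_ ?_ ?_ ?_
      (fun _ _ => rfl) <;> intro i hi <;> simp only [Finset.mem_Ico] at hi ⊢ <;> omega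
  rw [hrefl h, hrefl r] at key
  simpa [show q - (q - k) = k by omega] using key

theorem sum_Ico_sub_eq {t : ℕ → ℝ} {p q : ℕ} (hpq : p ≤ q) :
    ∑ k ∈ Finset.Ico p q, (t (k + 1) - t k) = t q - t p := Finset.sum_Ico_sub t hpq

section Euler

variable {E : Type*} [NormedAddCommGroup E] [NormedSpace ℝ E] [CompleteSpace E]

/-- Convergence of a perturbed explicit Euler recursion, assumed only in a tube of radius `ρ`
around the solution, to a solution `y` of a differential equation with piecewise continuous
right-hand side `v`. -/
theorem exists_forward_convergence {y v : ℝ → E} {c a b M L ρ : ℝ} {B : Finset ℝ} (hca : c ≤ a)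
    (hab : a ≤ b) (hy : ContinuousOn y (Icc a b))
    (hd : ∀ t ∈ Ioo a b, t ∉ B → HasDerivAt y (v t) t)
    (hM : ∀ t ∈ Icc c b, ‖v t‖ ≤ M) (hv : ContinuousOn v (Icc a b \ B)) (hL : 0 ≤ L) (hρ : 0 < ρ)
    {ε : ℝ} (hε : 0 < ε) :
    ∃ δ > 0, ∀ (t : ℕ → ℝ) (p q : ℕ), p ≤ q →
      (∀ k, p ≤ k → k < q → t k ≤ t (k + 1) ∧ t (k + 1) ≤ t k + δ) → c ≤ t p → a - δ ≤ t p →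
      t q ≤ b → ∀ Y : ℕ → E, ‖Y p - y (max a (t p))‖ ≤ δ →
      (∀ k, p ≤ k → k < q → ‖Y k - y (max a (t k))‖ ≤ ρ →
        ‖Y (k + 1) - Y k - (t (k + 1) - t k) • v (t k)‖
          ≤ (t (k + 1) - t k) * (L * ‖Y k - y (max a (t k))‖ + δ)) →
      ∀ k, p ≤ k → k ≤ q → ‖Y k - y (max a (t k))‖ ≤ ε := by
  set G := Real.exp (L * (b - c)) with hG
  have hG0 : 0 < G := Real.exp_pos _
  have hbc : 0 ≤ b - c := by linarith
  set κ := min ε ρ / (G * (b - c + 2)) with hκ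
  have hκ0 : 0 < κ := div_pos (lt_min hε hρ) (by positivity)
  obtain ⟨δ, hδ, H⟩ := exists_sum_euler_error_le hca hab hy hd hM hv hκ0
  refine ⟨min δ κ, lt_min hδ hκ0, fun t p q hpq hst hcp hap hqb Y hYp hY => ?_⟩
  have hsum := H t p q hpq (fun k h1 h2 => ⟨(hst k h1 h2).1, (hst k h1 h2).2.trans
    (by linarith [min_le_left δ κ])⟩) hcp (by linarith [min_le_left δ κ]) hqb
  set r : ℕ → ℝ := fun k => ‖y (max a (t (k + 1))) - y (max a (t k)) - (t (k + 1) - t k) • v (t k)‖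
    + (t (k + 1) - t k) * κ with hr
  have htot : ∑ k ∈ Finset.Ico p q, (t (k + 1) - t k) ≤ b - c := by
    rw [sum_Ico_sub_eq hpq]; linarith
  have hrsum : ∑ k ∈ Finset.Ico p q, r k ≤ κ * (b - c + 1) := by
    rw [hr, Finset.sum_add_distrib, ← Finset.sum_mul]
    nlinarith
  have hbound : Real.exp (L * ∑ k ∈ Finset.Ico p q, (t (k + 1) - t k)) *
      (‖Y p - y (max a (t p))‖ + ∑ k ∈ Finset.Ico p q, r k) ≤ min ε ρ := by
    calc _ ≤ G * (κ + κ * (b - c + 1)) := by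
          have h0 : 0 ≤ ∑ k ∈ Finset.Ico p q, r k := Finset.sum_nonneg fun k hk => by
            have := (hst k (Finset.mem_Ico.mp hk).1 (Finset.mem_Ico.mp hk).2).1
            have : 0 ≤ t (k + 1) - t k := by linarith
            positivity
          have h1 : ‖Y p - y (max a (t p))‖ ≤ κ := hYp.trans (min_le_right _ _)
          rw [hG]
          gcongr
      _ = min ε ρ := by
          rw [hκ]; field_simp; ring
  intro k hpk hkq
  refine (discrete_gronwall_forward (e := fun k => ‖Y k - y (max a (t k))‖) (r := r)
    (h := fun k => t (k + 1) - t k) (ρ := ρ) hL (norm_nonneg _) ?_ ?_ ?_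
    (hbound.trans (min_le_right _ _)) k hpk hkq).trans (hbound.trans (min_le_left _ _))
  · intro k h1 h2; linarith [(hst k h1 h2).1]
  · intro k h1 h2
    have : 0 ≤ t (k + 1) - t k := by linarith [(hst k h1 h2).1]
    positivity
  · intro k h1 h2 h3
    have h4 := hY k h1 h2 h3
    have h5 : 0 ≤ t (k + 1) - t k := by linarith [(hst k h1 h2).1]
    have h6 : Y (k + 1) - y (max a (t (k + 1))) = (Y k - y (max a (t k)))
        + (Y (k + 1) - Y k - (t (k + 1) - t k) • v (t k))
        - (y (max a (t (k + 1))) - y (max a (t k)) - (t (k + 1) - t k) • v (t k)) := by abel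
    have h7 : ‖Y (k + 1) - y (max a (t (k + 1)))‖ ≤ _ :=
      h6 ▸ (norm_sub_le _ _).trans (add_le_add_left (norm_add_le _ _) _)
    have h8 : (t (k + 1) - t k) * min δ κ ≤ (t (k + 1) - t k) * κ :=
      mul_le_mul_of_nonneg_left (min_le_right _ _) h5
    simp only [hr]
    nlinarith

/-- Convergence of a perturbed Euler recursion running backwards in time. -/
theorem exists_backward_convergence {y v : ℝ → E} {c a b M L : ℝ} {B : Finset ℝ} (hca : c ≤ a)
    (hab : a ≤ b) (hy : ContinuousOn y (Icc a b))
    (hd : ∀ t ∈ Ioo a b, t ∉ B → HasDerivAt y (v t) t)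
    (hM : ∀ t ∈ Icc c b, ‖v t‖ ≤ M) (hv : ContinuousOn v (Icc a b \ B)) (hL : 0 ≤ L)
    {ε : ℝ} (hε : 0 < ε) :
    ∃ δ > 0, ∀ (t : ℕ → ℝ) (p q : ℕ), p ≤ q →
      (∀ k, p ≤ k → k < q → t k ≤ t (k + 1) ∧ t (k + 1) ≤ t k + δ) → c ≤ t p → a - δ ≤ t p →
      t q ≤ b → ∀ Y : ℕ → E, ‖Y q - y (max a (t q))‖ ≤ δ →
      (∀ k, p ≤ k → k < q → ‖Y (k + 1) - Y k - (t (k + 1) - t k) • v (t k)‖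
          ≤ (t (k + 1) - t k) * (L * ‖Y (k + 1) - y (max a (t (k + 1)))‖ + δ)) →
      ∀ k, p ≤ k → k ≤ q → ‖Y k - y (max a (t k))‖ ≤ ε := by
  set G := Real.exp (L * (b - c)) with hG
  have hG0 : 0 < G := Real.exp_pos _
  have hbc : 0 ≤ b - c := by linarith
  set κ := ε / (G * (b - c + 2)) with hκ
  have hκ0 : 0 < κ := div_pos hε (by positivity)
  obtain ⟨δ, hδ, H⟩ := exists_sum_euler_error_le hca hab hy hd hM hv hκ0
  refine ⟨min δ κ, lt_min hδ hκ0, fun t p q hpq hst hcp hap hqb Y hYp hY => ?_⟩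
  have hsum := H t p q hpq (fun k h1 h2 => ⟨(hst k h1 h2).1, (hst k h1 h2).2.trans
    (by linarith [min_le_left δ κ])⟩) hcp (by linarith [min_le_left δ κ]) hqb
  set r : ℕ → ℝ := fun k => ‖y (max a (t (k + 1))) - y (max a (t k)) - (t (k + 1) - t k) • v (t k)‖
    + (t (k + 1) - t k) * κ with hr
  have htot : ∑ k ∈ Finset.Ico p q, (t (k + 1) - t k) ≤ b - c := by
    rw [sum_Ico_sub_eq hpq]; linarith
  have hrsum : ∑ k ∈ Finset.Ico p q, r k ≤ κ * (b - c + 1) := by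
    rw [hr, Finset.sum_add_distrib, ← Finset.sum_mul]
    nlinarith
  have hbound : Real.exp (L * ∑ k ∈ Finset.Ico p q, (t (k + 1) - t k)) *
      (‖Y q - y (max a (t q))‖ + ∑ k ∈ Finset.Ico p q, r k) ≤ ε := by
    calc _ ≤ G * (κ + κ * (b - c + 1)) := by
          have h0 : 0 ≤ ∑ k ∈ Finset.Ico p q, r k := Finset.sum_nonneg fun k hk => by
            have := (hst k (Finset.mem_Ico.mp hk).1 (Finset.mem_Ico.mp hk).2).1
            have : 0 ≤ t (k + 1) - t k := by linarith
            positivity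
          have h1 : ‖Y q - y (max a (t q))‖ ≤ κ := hYp.trans (min_le_right _ _)
          rw [hG]
          gcongr
      _ = ε := by
          rw [hκ]; field_simp; ring
  intro k hpk hkq
  refine (discrete_gronwall_backward (e := fun k => ‖Y k - y (max a (t k))‖) (r := r)
    (h := fun k => t (k + 1) - t k) hL (norm_nonneg _) ?_ ?_ ?_ k hpk hkq).trans hbound
  · intro k h1 h2; linarith [(hst k h1 h2).1]
  · intro k h1 h2
    have : 0 ≤ t (k + 1) - t k := by linarith [(hst k h1 h2).1]
    positivity
  · intro k h1 h2
    have h4 := hY k h1 h2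
    have h5 : 0 ≤ t (k + 1) - t k := by linarith [(hst k h1 h2).1]
    have h6 : Y k - y (max a (t k)) = (Y (k + 1) - y (max a (t (k + 1))))
        - (Y (k + 1) - Y k - (t (k + 1) - t k) • v (t k))
        + (y (max a (t (k + 1))) - y (max a (t k)) - (t (k + 1) - t k) • v (t k)) := by abel
    have h7 : ‖Y k - y (max a (t k))‖ ≤ ‖Y (k + 1) - y (max a (t (k + 1)))‖
        + ‖Y (k + 1) - Y k - (t (k + 1) - t k) • v (t k)‖
        + ‖y (max a (t (k + 1))) - y (max a (t k)) - (t (k + 1) - t k) • v (t k)‖ := by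
      rw [h6]; exact (norm_add_le _ _).trans (add_le_add_left (norm_sub_le _ _) _)
    have h8 : (t (k + 1) - t k) * min δ κ ≤ (t (k + 1) - t k) * κ :=
      mul_le_mul_of_nonneg_left (min_le_right _ _) h5
    simp only [hr]
    nlinarith

end Euler

/-- A vector is controlled by its image under an invertible matrix, componentwise. -/
theorem Matrix.exists_abs_le_of_abs_sum_le {s : ℕ} {A : Matrix (Fin s) (Fin s) ℝ}
    (hA : IsUnit A.det) : ∃ C > 0, ∀ (c : Fin s → ℝ) (ε : ℝ),
      (∀ i, |∑ j, A i j * c j| ≤ ε) → ∀ j, |c j| ≤ C * ε := by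
  obtain ⟨A', hA'⟩ : ∃ A' : Matrix (Fin s) (Fin s) ℝ, A' * A = 1 := ⟨A⁻¹, A.nonsing_inv_mul hA⟩
  refine ⟨1 + ∑ i, ∑ j, |A' i j|, by positivity, fun c ε h j => ?_⟩
  have h1 : A'.mulVec (A.mulVec c) = c := by
    rw [Matrix.mulVec_mulVec, hA', Matrix.one_mulVec]
  have hε : 0 ≤ ε := (abs_nonneg _).trans (h j)
  have h2 : |c j| ≤ ∑ i, |A' j i| * ε := by
    have h3 : c j = ∑ i, A' j i * ∑ l, A i l * c l := (congrFun h1 j).symm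
    rw [h3]
    refine (Finset.abs_sum_le_sum_abs _ _).trans (Finset.sum_le_sum fun i _ => ?_)
    rw [abs_mul]
    exact mul_le_mul_of_nonneg_left (h i) (abs_nonneg _)
  refine h2.trans ?_
  rw [← Finset.sum_mul]
  refine mul_le_mul_of_nonneg_right ?_ hε
  have : ∑ l, |A' j l| ≤ ∑ i, ∑ l, |A' i l| :=
    Finset.single_le_sum (f := fun i => ∑ l, |A' i l|)
      (fun i _ => Finset.sum_nonneg fun l _ => abs_nonneg _) (Finset.mem_univ j)
  linarith

end

noncomputable section

/-! ### Derivatives of the problem data -/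

namespace HybridSystem

variable {d m : ℕ} {S : HybridSystem d m}

theorem inner_gxT (hS : S.Smooth) (x v : State d) :
    inner ℝ (S.gxT x) v = fderiv ℝ S.g x v := by
  have h : HasGradientAt S.g (gradient S.g x) x :=
    ((hS.g.differentiable two_ne_zero) x).hasGradientAt
  rw [h.hasFDerivAt.fderiv]
  rfl

theorem Smooth.contDiff_gxT (hS : S.Smooth) : ContDiff ℝ 1 S.gxT := by
  have h : ContDiff ℝ 1 (fderiv ℝ S.g) := hS.g.fderiv_right (by norm_num)
  exact (InnerProductSpace.toDual ℝ (State d)).symm.contDiff.comp h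

/-- The Hessian `g_xx(x)`, as a self-map of the state space. -/
def gxx (S : HybridSystem d m) (x : State d) : State d →L[ℝ] State d := fderiv ℝ S.gxT x

theorem Smooth.hasFDerivAt_gxT (hS : S.Smooth) (x : State d) :
    HasFDerivAt S.gxT (S.gxx x) x :=
  ((hS.contDiff_gxT.differentiable one_ne_zero) x).hasFDerivAt

theorem Smooth.continuous_gxT (hS : S.Smooth) : Continuous S.gxT := hS.contDiff_gxT.continuous

theorem Smooth.continuous_gxx (hS : S.Smooth) : Continuous S.gxx :=
  hS.contDiff_gxT.continuous_fderiv one_ne_zero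

theorem Smooth.continuous_g (hS : S.Smooth) : Continuous S.g := hS.g.continuous

theorem Smooth.hasFDerivAt_f1 (hS : S.Smooth) (x : State d) (u : Control m) :
    HasFDerivAt (fun y => S.f1 y u) (S.f1x x u) x := by
  have h : DifferentiableAt ℝ (fun y => S.f1 y u) x :=
    DifferentiableAt.fun_comp' (g := fun p : State d × Control m => S.f1 p.1 p.2)
      (f := fun y => (y, u)) x ((hS.f1.differentiable one_ne_zero) (x, u))
      (differentiableAt_id.prodMk (differentiableAt_const u))
  exact h.hasFDerivAt

theorem f2z_eq (S : HybridSystem d m) (x : State d) (z : ℝ) (u : Control m) :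
    S.f2z x z u = S.gxT x := by
  have h : HasDerivAt (fun ζ : ℝ => S.f2 x ζ u) (0 + (1 : ℝ) • S.gxT x) z :=
    (hasDerivAt_const z (S.fF x u)).add ((hasDerivAt_id z).smul_const (S.gxT x))
  simpa [f2z] using h.deriv

theorem Smooth.continuous_f1 (hS : S.Smooth) :
    Continuous fun p : State d × Control m => S.f1 p.1 p.2 := hS.f1.continuous

theorem Smooth.f2x_eq (hS : S.Smooth) (x : State d) (z : ℝ) (u : Control m) :
    S.f2x x z u = (fderiv ℝ (fun p : State d × Control m => S.fF p.1 p.2) (x, u)).comp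
      (ContinuousLinearMap.inl ℝ (State d) (Control m)) + z • S.gxx x := by
  have h1 : HasFDerivAt (fun y : State d => (y, u))
      (ContinuousLinearMap.inl ℝ (State d) (Control m)) x :=
    (hasFDerivAt_id x).prodMk (hasFDerivAt_const u x)
  have h2 := ((hS.fF.differentiable one_ne_zero) (x, u)).hasFDerivAt.comp x h1
  exact (h2.add ((hS.hasFDerivAt_gxT x).const_smul z)).fderiv

theorem Smooth.continuous_f2x (hS : S.Smooth) :
    Continuous fun p : State d × ℝ × Control m => S.f2x p.1 p.2.1 p.2.2 := by
  simp_rw [hS.f2x_eq]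
  have h1 : Continuous fun p : State d × ℝ × Control m =>
      fderiv ℝ (fun p : State d × Control m => S.fF p.1 p.2) (p.1, p.2.2) :=
    (hS.fF.continuous_fderiv one_ne_zero).comp (continuous_fst.prodMk continuous_snd.snd)
  exact (h1.clm_comp continuous_const).add
    (continuous_snd.fst.smul (hS.continuous_gxx.comp continuous_fst))

/-- Joint differentiability of the sliding vector field in state and algebraic variable. -/
theorem Smooth.hasFDerivAt_f2_prod (hS : S.Smooth) (p : State d × ℝ) (u : Control m) :
    HasFDerivAt (fun y : State d × ℝ => S.f2 y.1 y.2 u)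
      ((S.f2x p.1 p.2 u).comp (ContinuousLinearMap.fst ℝ (State d) ℝ)
        + (ContinuousLinearMap.snd ℝ (State d) ℝ).smulRight (S.gxT p.1)) p := by
  have h1 : HasFDerivAt (fun y : State d × ℝ => (y.1, u))
      ((ContinuousLinearMap.fst ℝ (State d) ℝ).prod 0) p :=
    hasFDerivAt_fst.prodMk (hasFDerivAt_const u p)
  have h2 := ((hS.fF.differentiable one_ne_zero) (p.1, u)).hasFDerivAt.comp p h1
  have h3 : HasFDerivAt (fun y : State d × ℝ => y.2 • S.gxT y.1) _ p :=
    (hasFDerivAt_snd (𝕜 := ℝ) (p := p)).smul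
      ((hS.hasFDerivAt_gxT p.1).comp p (hasFDerivAt_fst (𝕜 := ℝ) (p := p)))
  refine (h2.add h3).congr_fderiv ?_
  ext v <;> simp [hS.f2x_eq]

end HybridSystem

/-! ### The linear systems behind the Jacobians of the scheme -/

namespace DiscreteRun

variable {d m s : ℕ} {D : DiscreteRun d m s} {S : HybridSystem d m} {T : RKTableau s}

theorem _root_.ContinuousLinearMap.IsInvertible.apply_inverse_apply {V W : Type*}
    [NormedAddCommGroup V] [NormedSpace ℝ V] [NormedAddCommGroup W] [NormedSpace ℝ W]
    {f : V →L[ℝ] W} (hf : f.IsInvertible) (y : W) : f (f.inverse y) = y := by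
  obtain ⟨e, rfl⟩ := hf
  simp

theorem F1Xp_apply (hS : S.Smooth) (k : ℕ) (w : Aug1 d s) :
    D.F1Xp S T k w =
      (fun i => w.1 i - D.h k • ∑ j, T.A i j • S.f1x (D.xs (k + 1) j) (D.u k) (w.1 j),
        w.2 - D.h k • ∑ i, T.b i • S.f1x (D.xs (k + 1) i) (D.u k) (w.1 i)) := by
  have hst : ∀ i, HasFDerivAt (fun Y : Aug1 d s => Y.1 i)
      ((ContinuousLinearMap.proj i).comp (ContinuousLinearMap.fst ℝ (Fin s → State d) (State d)))
      (D.X1 (k + 1)) := fun i => ((ContinuousLinearMap.proj i).comp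
        (ContinuousLinearMap.fst ℝ (Fin s → State d) (State d))).hasFDerivAt
  have hf : ∀ i, HasFDerivAt (fun Y : Aug1 d s => S.f1 (Y.1 i) (D.u k)) _ (D.X1 (k + 1)) :=
    fun i => HasFDerivAt.comp (g := fun y => S.f1 y (D.u k)) (f := fun Y : Aug1 d s => Y.1 i)
      (D.X1 (k + 1)) (hS.hasFDerivAt_f1 (D.xs (k + 1) i) (D.u k)) (hst i)
  have h1 : ∀ i, HasFDerivAt (fun Y : Aug1 d s => Y.1 i - (D.X1 k).2
      - D.h k • ∑ j, T.A i j • S.f1 (Y.1 j) (D.u k)) _ (D.X1 (k + 1)) := fun i =>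
    ((hst i).sub_const _).sub
      ((HasFDerivAt.fun_sum fun j _ => (hf j).const_smul (T.A i j)).const_smul (D.h k))
  have h2 : HasFDerivAt (fun Y : Aug1 d s => Y.2 - (D.X1 k).2
      - D.h k • ∑ i, T.b i • S.f1 (Y.1 i) (D.u k)) _ (D.X1 (k + 1)) :=
    (hasFDerivAt_snd.sub_const _).sub
      ((HasFDerivAt.fun_sum fun j _ => (hf j).const_smul (T.b j)).const_smul (D.h k))
  have h := (hasFDerivAt_pi.mpr h1).prodMk h2
  rw [F1Xp, show (fun Y => F1 S T Y (D.X1 k) (D.u k) (D.h k)) = _ from rfl]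
  erw [h.fderiv]
  ext <;> simp [Finset.smul_sum]

theorem F2Xp_apply (hS : S.Smooth) (k : ℕ) (w : Aug2 d s) :
    D.F2Xp S T k w =
      (fun i => ((w.1 i).1 - D.h k • ∑ j, T.A i j •
          (S.f2x (D.xs (k + 1) j) (D.zs (k + 1) j) (D.u k) (w.1 j).1
            + (w.1 j).2 • S.gxT (D.xs (k + 1) j)),
          -inner ℝ (S.gxT (D.xs (k + 1) i)) (w.1 i).1),
        w.2 - D.h k • ∑ j, T.b j •
          (S.f2x (D.xs (k + 1) j) (D.zs (k + 1) j) (D.u k) (w.1 j).1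
            + (w.1 j).2 • S.gxT (D.xs (k + 1) j))) := by
  have hst : ∀ i, HasFDerivAt (fun Y : Aug2 d s => Y.1 i)
      ((ContinuousLinearMap.proj i).comp
        (ContinuousLinearMap.fst ℝ (Fin s → State d × ℝ) (State d)))
      (D.X2 (k + 1)) := fun i => ((ContinuousLinearMap.proj i).comp
        (ContinuousLinearMap.fst ℝ (Fin s → State d × ℝ) (State d))).hasFDerivAt
  have hst1 : ∀ i, HasFDerivAt (fun Y : Aug2 d s => (Y.1 i).1) _ (D.X2 (k + 1)) :=
    fun i => (hst i).fst
  have hf : ∀ i, HasFDerivAt (fun Y : Aug2 d s => S.f2 (Y.1 i).1 (Y.1 i).2 (D.u k)) _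
      (D.X2 (k + 1)) := fun i =>
    HasFDerivAt.comp (g := fun y : State d × ℝ => S.f2 y.1 y.2 (D.u k))
      (f := fun Y : Aug2 d s => Y.1 i) (D.X2 (k + 1))
      (hS.hasFDerivAt_f2_prod (D.xs (k + 1) i, D.zs (k + 1) i) (D.u k)) (hst i)
  have hg : ∀ i, HasFDerivAt (fun Y : Aug2 d s => S.g (Y.1 i).1) _ (D.X2 (k + 1)) := fun i =>
    ((hS.g.differentiable two_ne_zero) (D.xs (k + 1) i)).hasFDerivAt.comp (D.X2 (k + 1)) (hst1 i)
  have h1 : ∀ i, HasFDerivAt (fun Y : Aug2 d s => ((Y.1 i).1 - (D.X2 k).2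
      - D.h k • ∑ j, T.A i j • S.f2 (Y.1 j).1 (Y.1 j).2 (D.u k), -S.g (Y.1 i).1)) _
      (D.X2 (k + 1)) := fun i =>
    (((hst1 i).sub_const _).sub
      ((HasFDerivAt.fun_sum fun j _ => (hf j).const_smul (T.A i j)).const_smul (D.h k))).prodMk
      (hg i).neg
  have h2 : HasFDerivAt (fun Y : Aug2 d s => Y.2 - (D.X2 k).2
      - D.h k • ∑ i, T.b i • S.f2 (Y.1 i).1 (Y.1 i).2 (D.u k)) _ (D.X2 (k + 1)) :=
    (hasFDerivAt_snd.sub_const _).sub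
      ((HasFDerivAt.fun_sum fun j _ => (hf j).const_smul (T.b j)).const_smul (D.h k))
  have h := (hasFDerivAt_pi.mpr h1).prodMk h2
  rw [F2Xp, show (fun Y => F2 S T Y (D.X2 k) (D.u k) (D.h k)) = _ from rfl]
  erw [h.fderiv]
  ext <;> simp [Finset.smul_sum, HybridSystem.inner_gxT hS]

theorem F2X_apply (k : ℕ) (w : Aug2 d s) :
    D.F2X S T k w = (fun _ => (-w.2, 0), -w.2) := by
  have hsnd : HasFDerivAt (fun Y : Aug2 d s => Y.2)
      (ContinuousLinearMap.snd ℝ (Fin s → State d × ℝ) (State d)) (D.X2 k) := hasFDerivAt_snd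
  have h1 : ∀ i, HasFDerivAt (fun Y : Aug2 d s => ((D.xs (k + 1) i) - Y.2
      - D.h k • ∑ j, T.A i j • S.f2 (D.xs (k + 1) j) (D.zs (k + 1) j) (D.u k),
      -S.g (D.xs (k + 1) i)))
      ((-(ContinuousLinearMap.snd ℝ (Fin s → State d × ℝ) (State d))).prod 0) (D.X2 k) := fun i =>
    ((hsnd.const_sub _).sub_const _).prodMk (hasFDerivAt_const _ _)
  have h2 : HasFDerivAt (fun Y : Aug2 d s => (D.x (k + 1)) - Y.2
      - D.h k • ∑ i, T.b i • S.f2 (D.xs (k + 1) i) (D.zs (k + 1) i) (D.u k)) _ (D.X2 k) :=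
    (hsnd.const_sub _).sub_const _
  have h := (hasFDerivAt_pi.mpr h1).prodMk h2
  rw [F2X, show (fun Y => F2 S T (D.X2 (k + 1)) Y (D.u k) (D.h k)) = _ from rfl]
  erw [h.fderiv]
  ext <;> simp

theorem F1h_eq (k : ℕ) :
    D.F1h S T k = (fun i => -∑ j, T.A i j • S.f1 (D.xs (k + 1) j) (D.u k),
      -∑ i, T.b i • S.f1 (D.xs (k + 1) i) (D.u k)) := by
  have hl : ∀ c v : State d, HasDerivAt (fun η : ℝ => c - η • v) (-v) (D.h k) := fun c v => by
    simpa using ((hasDerivAt_id (D.h k)).smul_const v).const_sub c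
  exact ((hasDerivAt_pi.mpr fun i => hl _ _).prodMk (hl _ _)).deriv

theorem F2h_eq (k : ℕ) :
    D.F2h S T k =
      (fun i => (-∑ j, T.A i j • S.f2 (D.xs (k + 1) j) (D.zs (k + 1) j) (D.u k), 0),
      -∑ i, T.b i • S.f2 (D.xs (k + 1) i) (D.zs (k + 1) i) (D.u k)) := by
  have hl : ∀ c v : State d, HasDerivAt (fun η : ℝ => c - η • v) (-v) (D.h k) := fun c v => by
    simpa using ((hasDerivAt_id (D.h k)).smul_const v).const_sub c
  exact ((hasDerivAt_pi.mpr fun i => (hl _ _).prodMk (hasDerivAt_const _ _)).prodMk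
    (hl _ _)).deriv

end DiscreteRun

end

noncomputable section

/-! ### Unfolding the discrete state, adjoint and jump equations -/

namespace DiscreteRun

variable {d m s : ℕ} {D : DiscreteRun d m s} {S : HybridSystem d m} {T : RKTableau s}
  {u1 u2 : ℝ → Control m} {t0 tf : ℝ} {x0 : State d} {L : ℕ → Aug2 d s →L[ℝ] ℝ}

namespace IsSolution

theorem stage1 (hD : D.IsSolution S T u1 u2 t0 tf x0) {k : ℕ} (hk : k < D.kt) (i : Fin s) :
    D.xs (k + 1) i = D.x k + D.h k • ∑ j, T.A i j • S.f1 (D.xs (k + 1) j) (D.u k) := by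
  have h := congrFun (congrArg Prod.fst (hD.step1 k hk)) i
  simp only [F1, X1, Prod.fst_zero, Pi.zero_apply] at h
  rw [← sub_eq_zero, ← h]; abel

theorem next1 (hD : D.IsSolution S T u1 u2 t0 tf x0) {k : ℕ} (hk : k < D.kt) :
    D.x (k + 1) = D.x k + D.h k • ∑ j, T.b j • S.f1 (D.xs (k + 1) j) (D.u k) := by
  have h := congrArg Prod.snd (hD.step1 k hk)
  simp only [F1, X1, Prod.snd_zero] at h
  rw [← sub_eq_zero, ← h]; abel

theorem stage2 (hD : D.IsSolution S T u1 u2 t0 tf x0) {k : ℕ} (hk : D.kt ≤ k) (hkK : k < D.K)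
    (i : Fin s) :
    D.xs (k + 1) i = D.x k
      + D.h k • ∑ j, T.A i j • S.f2 (D.xs (k + 1) j) (D.zs (k + 1) j) (D.u k) := by
  have h := congrArg Prod.fst (congrFun (congrArg Prod.fst (hD.step2 k hk hkK)) i)
  simp only [F2, X2, Prod.fst_zero, Pi.zero_apply] at h
  rw [← sub_eq_zero, ← h]; abel

theorem stage2_alg (hD : D.IsSolution S T u1 u2 t0 tf x0) {k : ℕ} (hk : D.kt ≤ k) (hkK : k < D.K)
    (i : Fin s) : S.g (D.xs (k + 1) i) = 0 := by
  have h := congrArg Prod.snd (congrFun (congrArg Prod.fst (hD.step2 k hk hkK)) i)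
  simp only [F2, X2, Prod.fst_zero, Pi.zero_apply, Prod.snd_zero] at h
  linarith

theorem next2 (hD : D.IsSolution S T u1 u2 t0 tf x0) {k : ℕ} (hk : D.kt ≤ k) (hkK : k < D.K) :
    D.x (k + 1) = D.x k
      + D.h k • ∑ j, T.b j • S.f2 (D.xs (k + 1) j) (D.zs (k + 1) j) (D.u k) := by
  have h := congrArg Prod.snd (hD.step2 k hk hkK)
  simp only [F2, X2, Prod.snd_zero] at h
  rw [← sub_eq_zero, ← h]; abel

/-- Stiff accuracy: the new state is one of the stage values. -/
theorem next2_eq_stage (hD : D.IsSolution S T u1 u2 t0 tf x0) {r : Fin s}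
    (hr : ∀ j, T.A r j = T.b j) {k : ℕ} (hk : D.kt ≤ k) (hkK : k < D.K) :
    D.x (k + 1) = D.xs (k + 1) r := by
  rw [hD.next2 hk hkK, hD.stage2 hk hkK r]
  simp_rw [hr]

theorem g_eq_zero (hD : D.IsSolution S T u1 u2 t0 tf x0) {r : Fin s}
    (hr : ∀ j, T.A r j = T.b j) {k : ℕ} (hk : D.kt ≤ k) (hkK : k ≤ D.K) : S.g (D.x k) = 0 := by
  obtain rfl | h := hk.eq_or_lt
  · exact hD.transition
  · obtain ⟨k, rfl⟩ : ∃ l, k = l + 1 := ⟨k - 1, by omega⟩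
    rw [hD.next2_eq_stage hr (by omega) (by omega)]
    exact hD.stage2_alg (by omega) (by omega) r

end IsSolution

theorem time_succ (D : DiscreteRun d m s) (t0 : ℝ) (k : ℕ) :
    D.time t0 (k + 1) = D.time t0 k + D.h k := by
  simp [time, Finset.sum_range_succ, add_assoc]

theorem IsSolution.time_mono (hD : D.IsSolution S T u1 u2 t0 tf x0) {j k : ℕ} (hjk : j ≤ k)
    (hk : k ≤ D.K) : D.time t0 j ≤ D.time t0 k := by
  induction k, hjk using Nat.le_induction with
  | base => exact le_rfl
  | succ k hjk ih =>
    rw [time_succ]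
    linarith [ih (by omega), hD.h_pos k (by omega)]

theorem IsSolution.time_mem (hD : D.IsSolution S T u1 u2 t0 tf x0) {k : ℕ} (hk : k ≤ D.K) :
    D.time t0 k ∈ Icc t0 tf := by
  constructor
  · simpa [time] using hD.time_mono (Nat.zero_le k) hk
  · rw [← hD.final]; exact hD.time_mono hk le_rfl

theorem lamPart_row2 (l : State d) : lamPart (row2 l : Aug2 d s →L[ℝ] ℝ) = l := by
  refine ext_inner_right ℝ fun v => ?_
  simp [lamPart, row2]

theorem IsAdjoint.eq_row2 (hL : D.IsAdjoint S T L) {k : ℕ} (hk : D.kt ≤ k) (hkK : k ≤ D.K) :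
    L k = row2 (lamPart (L k)) := by
  suffices h : ∃ l, L k = row2 l by
    obtain ⟨l, h⟩ := h
    rw [h, lamPart_row2]
  obtain rfl | h := hkK.eq_or_lt
  · obtain ⟨l, ν, h, -⟩ := hL.terminal
    exact ⟨l, h⟩
  · refine ⟨lamPart (L k), ContinuousLinearMap.ext fun w => ?_⟩
    have h0 : D.F2X S T k (w.1, 0) = 0 := by rw [F2X_apply]; ext <;> simp
    have h1 : L k (w.1, 0) = 0 := by rw [hL.step k hk h]; simp [h0]
    have h2 : w = (w.1, 0) + (0, w.2) := by simp
    have h3 : L k w = L k (0, w.2) := by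
      conv_lhs => rw [h2, map_add, h1, zero_add]
    rw [h3]
    simp [row2, lamPart]

theorem IsAdjoint.terminal_tangent (hL : D.IsAdjoint S T L) :
    inner ℝ (lamPart (L D.K)) (S.gxT (D.x D.K)) = 0 ∧
      ∃ ν : ℝ, gradient S.phi (D.x D.K) + lamPart (L D.K) = ν • S.gxT (D.x D.K) := by
  obtain ⟨l, ν, h, h1, h2⟩ := hL.terminal
  rw [h, lamPart_row2]
  exact ⟨h2, ν, h1⟩

/-- One step of the discrete adjoint equation, tested with a vector `v`: the adjoint is transported
by the linearised scheme started at `v`. -/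
theorem IsAdjoint.exists_tangent_step (hS : S.Smooth) (hL : D.IsAdjoint S T L)
    (hinv : D.Invertible S T) {r : Fin s} (hr : ∀ j, T.A r j = T.b j) {k : ℕ} (hk : D.kt ≤ k)
    (hkK : k < D.K) (v : State d) :
    ∃ (ξ : Fin s → State d) (ζ : Fin s → ℝ),
      (∀ i, ξ i = v + D.h k • ∑ j, T.A i j •
          (S.f2x (D.xs (k + 1) j) (D.zs (k + 1) j) (D.u k) (ξ j)
            + ζ j • S.gxT (D.xs (k + 1) j))) ∧
      (∀ i, inner ℝ (S.gxT (D.xs (k + 1) i)) (ξ i) = 0) ∧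
      inner ℝ (lamPart (L k)) v = inner ℝ (lamPart (L (k + 1))) (ξ r) := by
  set w := (D.F2Xp S T k).inverse (fun _ => (v, 0), v) with hw
  have h := (hinv.phase2 k hk hkK).apply_inverse_apply ((fun _ => (v, 0), v) : Aug2 d s)
  rw [← hw, F2Xp_apply hS] at h
  have h1 : ∀ i, (w.1 i).1 = v + D.h k • ∑ j, T.A i j •
      (S.f2x (D.xs (k + 1) j) (D.zs (k + 1) j) (D.u k) (w.1 j).1
        + (w.1 j).2 • S.gxT (D.xs (k + 1) j)) := fun i => by
    have := congrArg Prod.fst (congrFun (congrArg Prod.fst h) i)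
    exact sub_eq_iff_eq_add.mp this
  have h2 : ∀ i, inner ℝ (S.gxT (D.xs (k + 1) i)) (w.1 i).1 = 0 := fun i => by
    have := congrArg Prod.snd (congrFun (congrArg Prod.fst h) i)
    simpa using this
  have h3 : w.2 = (w.1 r).1 := by
    rw [h1 r]
    simp_rw [hr]
    exact sub_eq_iff_eq_add.mp (congrArg Prod.snd h)
  refine ⟨fun i => (w.1 i).1, fun i => (w.1 i).2, h1, h2, ?_⟩
  have h4 : L k ((0 : Fin s → State d × ℝ), v) = inner ℝ (lamPart (L k)) v := by
    rw [hL.eq_row2 hk hkK.le, lamPart_row2]; simp [row2]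
  have h5 : L k ((0 : Fin s → State d × ℝ), v) = L (k + 1) w := by
    have hx : D.F2X S T k ((0 : Fin s → State d × ℝ), v)
        = -((fun _ => (v, 0), v) : Aug2 d s) := by
      rw [F2X_apply]; ext <;> simp
    rw [hL.step k hk hkK, neg_apply, ContinuousLinearMap.comp_apply,
      ContinuousLinearMap.comp_apply, hx, map_neg, map_neg, neg_neg]
  rw [← h4, h5, hL.eq_row2 (by omega) hkK, lamPart_row2]
  exact congrArg (inner ℝ (lamPart (L (k + 1)))) h3

/-- The derivative of the first-phase step with respect to the step size. -/
theorem exists_stepsize_derivative1 (hS : S.Smooth) (hinv : D.Invertible S T)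
    (hkt : 0 < D.kt) :
    ∃ w : Fin s → State d,
      (∀ i, w i = -∑ j, T.A i j • S.f1 (D.xs D.kt j) (D.u (D.kt - 1))
        + D.h (D.kt - 1) • ∑ j, T.A i j • S.f1x (D.xs D.kt j) (D.u (D.kt - 1)) (w j)) ∧
      D.increment1 S T = D.h (D.kt - 1) • ∑ j, T.b j • S.f1x (D.xs D.kt j) (D.u (D.kt - 1)) (w j)
        - ∑ j, T.b j • S.f1 (D.xs D.kt j) (D.u (D.kt - 1)) ∧
      ((D.F1Xp S T (D.kt - 1)).inverse (D.F1h S T (D.kt - 1))).2 = D.increment1 S T := by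
  have h := (hinv.phase1 (D.kt - 1) (by omega)).apply_inverse_apply (D.F1h S T (D.kt - 1))
  set w := (D.F1Xp S T (D.kt - 1)).inverse (D.F1h S T (D.kt - 1)) with hw
  rw [F1Xp_apply hS, F1h_eq, Nat.sub_add_cancel hkt] at h
  have h1 := fun i => sub_eq_iff_eq_add.mp (congrFun (congrArg Prod.fst h) i)
  have h2 := sub_eq_iff_eq_add.mp (congrArg Prod.snd h)
  refine ⟨w.1, h1, rfl, ?_⟩
  rw [h2]
  simp only [increment1, ← hw]
  abel

/-- The derivative of the sliding step with respect to the step size.  By stiff accuracy its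
last block is a stage value, hence tangent to the constraint at the new state. -/
theorem exists_stepsize_derivative2 (hS : S.Smooth) (hinv : D.Invertible S T)
    {r : Fin s} (hr : ∀ j, T.A r j = T.b j) (hkt : D.kt < D.K) :
    ∃ (ξ : Fin s → State d) (ζ : Fin s → ℝ),
      (∀ i, ξ i =
        -∑ j, T.A i j • S.f2 (D.xs (D.kt + 1) j) (D.zs (D.kt + 1) j) (D.u D.kt)
          + D.h D.kt • ∑ j, T.A i j •
            (S.f2x (D.xs (D.kt + 1) j) (D.zs (D.kt + 1) j) (D.u D.kt) (ξ j)
            + ζ j • S.gxT (D.xs (D.kt + 1) j))) ∧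
      (∀ i, inner ℝ (S.gxT (D.xs (D.kt + 1) i)) (ξ i) = 0) ∧
      D.increment2 S T = ξ r ∧
      ((D.F2Xp S T D.kt).inverse (D.F2h S T D.kt)).2 = D.increment2 S T := by
  have h := (hinv.phase2 D.kt le_rfl hkt).apply_inverse_apply (D.F2h S T D.kt)
  set w := (D.F2Xp S T D.kt).inverse (D.F2h S T D.kt) with hw
  rw [F2Xp_apply hS, F2h_eq] at h
  have h1 := fun i => sub_eq_iff_eq_add.mp
    (congrArg Prod.fst (congrFun (congrArg Prod.fst h) i))
  have h2 : ∀ i, inner ℝ (S.gxT (D.xs (D.kt + 1) i)) (w.1 i).1 = 0 := fun i => by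
    have := congrArg Prod.snd (congrFun (congrArg Prod.fst h) i)
    simpa using this
  have h3 := sub_eq_iff_eq_add.mp (congrArg Prod.snd h)
  have h4 : w.2 = D.increment2 S T := by
    rw [h3]
    simp only [increment2, ← hw, HybridSystem.f2z_eq, smul_add, Finset.sum_add_distrib]
    abel
  refine ⟨fun i => (w.1 i).1, fun i => (w.1 i).2, h1, h2, ?_, h4⟩
  rw [← h4, h3]
  simp only [h1 r]
  simp_rw [hr]

theorem jump_iff (hS : S.Smooth) (hD : D.IsSolution S T u1 u2 t0 tf x0)
    (hL : D.IsAdjoint S T L) (hinv : D.Invertible S T)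
    {r : Fin s} (hr : ∀ j, T.A r j = T.b j) (lm : State d) (p : ℝ) :
    D.Jump S T L lm p ↔ lm + p • S.gxT (D.x D.kt) = lamPart (L D.kt) ∧
      inner ℝ lm (D.increment1 S T) = inner ℝ (lamPart (L (D.kt + 1))) (D.increment2 S T) := by
  obtain ⟨w, -, -, h1⟩ := exists_stepsize_derivative1 (T := T) hS hinv hD.kt_pos
  obtain ⟨ξ, ζ, -, -, -, h2⟩ := exists_stepsize_derivative2 hS hinv hr hD.kt_lt
  rw [Jump, hL.eq_row2 (k := D.kt + 1) (by omega) hD.kt_lt, lamPart_row2]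
  simp [row1, row2, h1, h2]

theorem jumpDenom_eq (hS : S.Smooth) :
    D.jumpDenom S T = inner ℝ (S.gxT (D.x D.kt)) (D.increment1 S T) :=
  (HybridSystem.inner_gxT hS _ _).symm

/-- The discrete jump conditions are a linear system whose solution is the explicit formula. -/
theorem jump_iff_eq_jumpFormula (hS : S.Smooth) (hD : D.IsSolution S T u1 u2 t0 tf x0)
    (hL : D.IsAdjoint S T L) (hinv : D.Invertible S T)
    {r : Fin s} (hr : ∀ j, T.A r j = T.b j) (hne : D.jumpDenom S T ≠ 0) (lm : State d) (p : ℝ) :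
    D.Jump S T L lm p ↔ p = D.jumpFormula S T L ∧
      lm = lamPart (L D.kt) - p • S.gxT (D.x D.kt) := by
  rw [jump_iff hS hD hL hinv hr, ← eq_sub_iff_add_eq, and_comm]
  refine and_congr_left fun h => ?_
  rw [jumpFormula, eq_div_iff hne, jumpDenom_eq hS, h, inner_sub_left, inner_neg_right,
    inner_neg_right, real_inner_smul_left]
  constructor <;> intro h <;> linarith

end DiscreteRun

end

noncomputable section

/-! ### The reduced vector field of the sliding mode -/

namespace HybridSystem

variable {d m : ℕ} {S : HybridSystem d m}

/-- The value of the algebraic variable for which `f²(x, z, u)` is tangent to the level sets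
of `g`. -/
def zred (S : HybridSystem d m) (x : State d) (u : Control m) : ℝ :=
  -inner ℝ (S.gxT x) (S.fF x u) / ‖S.gxT x‖ ^ 2

/-- The reduced vector field: `f²` with the algebraic variable eliminated by tangency. -/
def fred (S : HybridSystem d m) (x : State d) (u : Control m) : State d :=
  S.f2 x (S.zred x u) u

/-- The orthogonal projection onto the tangent space of the level set of `g` through `x`. -/
def tanProj (S : HybridSystem d m) (x : State d) : State d →L[ℝ] State d :=
  ContinuousLinearMap.id ℝ (State d)
    - (‖S.gxT x‖ ^ 2)⁻¹ • (innerSL ℝ (S.gxT x)).smulRight (S.gxT x)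

/-- The transpose of the matrix `R` of the adjoint equation `λ' = -R λ`, which is left after
elimination of the multiplier `λ_g`. -/
def adjMatrixT (S : HybridSystem d m) (x : State d) (u : Control m) : State d →L[ℝ] State d :=
  (S.f2x x (S.zred x u) u).comp (S.tanProj x)
    + (‖S.gxT x‖ ^ 2)⁻¹ • (innerSL ℝ (S.gxT x)).smulRight (S.gxx x (S.fred x u))

/-- The matrix `R` of the adjoint equation `λ' = -R λ` after elimination of the
multiplier `λ_g`. -/
def adjMatrix (S : HybridSystem d m) (x : State d) (u : Control m) : State d →L[ℝ] State d :=
  ContinuousLinearMap.adjoint (S.adjMatrixT x u)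

theorem tanProj_apply (x v : State d) :
    S.tanProj x v = v - ((‖S.gxT x‖ ^ 2)⁻¹ * inner ℝ (S.gxT x) v) • S.gxT x := by
  simp [tanProj, mul_smul]

theorem adjMatrixT_apply (x : State d) (u : Control m) (v : State d) :
    S.adjMatrixT x u v = S.f2x x (S.zred x u) u (S.tanProj x v)
      + ((‖S.gxT x‖ ^ 2)⁻¹ * inner ℝ (S.gxT x) v) • S.gxx x (S.fred x u) := by
  simp [adjMatrixT, mul_smul]

theorem inner_adjMatrix (x : State d) (u : Control m) (l v : State d) :
    inner ℝ (S.adjMatrix x u l) v = inner ℝ l (S.adjMatrixT x u v) :=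
  ContinuousLinearMap.adjoint_inner_left _ _ _

theorem inner_gxT_tanProj {x : State d} (hx : S.gxT x ≠ 0) (v : State d) :
    inner ℝ (S.gxT x) (S.tanProj x v) = 0 := by
  have : ‖S.gxT x‖ ≠ 0 := norm_ne_zero_iff.mpr hx
  rw [tanProj_apply, inner_sub_right, inner_smul_right, real_inner_self_eq_norm_sq]
  field_simp
  ring

theorem inner_tanProj_left (x l v : State d) :
    inner ℝ (S.tanProj x l) v = inner ℝ l (S.tanProj x v) := by
  rw [tanProj_apply, tanProj_apply, inner_sub_right, inner_smul_right, inner_sub_left,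
    inner_smul_left, real_inner_comm l (S.gxT x)]
  simp; ring

theorem inner_tanProj_of_tangent {x l v : State d} (hv : inner ℝ (S.gxT x) v = 0) :
    inner ℝ (S.tanProj x l) v = inner ℝ l v := by
  rw [inner_tanProj_left, tanProj_apply, hv]; simp

theorem tanProj_of_tangent {x v : State d} (hv : inner ℝ (S.gxT x) v = 0) :
    S.tanProj x v = v := by
  rw [tanProj_apply, hv]; simp

theorem norm_tanProj_le (x v : State d) : ‖S.tanProj x v‖ ≤ ‖v‖ := by
  rcases eq_or_ne (S.gxT x) 0 with hx | hx
  · simp [tanProj_apply, hx]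
  · have h1 : inner ℝ (S.tanProj x v) (S.tanProj x v) = inner ℝ (S.tanProj x v) v := by
      rw [inner_tanProj_left x v (S.tanProj x v), tanProj_of_tangent (inner_gxT_tanProj hx v),
        real_inner_comm]
    have h2 := real_inner_le_norm (S.tanProj x v) v
    rw [← h1, real_inner_self_eq_norm_sq, sq] at h2
    by_contra! h
    nlinarith [norm_nonneg (S.tanProj x v), norm_nonneg v]

/-- Tangency determines the algebraic variable. -/
theorem eq_zred_of_inner_eq_zero {x : State d} (hx : S.gxT x ≠ 0) {z : ℝ} {u : Control m}
    (h : inner ℝ (S.gxT x) (S.f2 x z u) = 0) : z = S.zred x u := by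
  have : ‖S.gxT x‖ ≠ 0 := norm_ne_zero_iff.mpr hx
  rw [f2, inner_add_right, inner_smul_right, real_inner_self_eq_norm_sq] at h
  rw [zred]
  field_simp
  linarith

theorem Smooth.contDiffAt_zred (hS : S.Smooth) {p : State d × Control m} (hp : S.gxT p.1 ≠ 0) :
    ContDiffAt ℝ 1 (fun p : State d × Control m => S.zred p.1 p.2) p := by
  have hG : ContDiff ℝ 1 fun p : State d × Control m => S.gxT p.1 :=
    hS.contDiff_gxT.comp contDiff_fst
  exact ((hG.inner ℝ hS.fF).neg.contDiffAt).div (hG.norm_sq ℝ).contDiffAt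
    (pow_ne_zero _ (norm_ne_zero_iff.mpr hp))

theorem Smooth.contDiffAt_fred (hS : S.Smooth) {p : State d × Control m} (hp : S.gxT p.1 ≠ 0) :
    ContDiffAt ℝ 1 (fun p : State d × Control m => S.fred p.1 p.2) p := by
  have hG : ContDiff ℝ 1 fun p : State d × Control m => S.gxT p.1 :=
    hS.contDiff_gxT.comp contDiff_fst
  exact hS.fF.contDiffAt.add ((hS.contDiffAt_zred hp).smul hG.contDiffAt)

theorem Smooth.continuousAt_tanProj (hS : S.Smooth) {x : State d} (hx : S.gxT x ≠ 0) :
    ContinuousAt S.tanProj x := by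
  have hG : ContinuousAt S.gxT x := hS.continuous_gxT.continuousAt
  have h1 : ContinuousAt (fun x => (‖S.gxT x‖ ^ 2)⁻¹) x :=
    (hG.norm.pow 2).inv₀ (pow_ne_zero _ (norm_ne_zero_iff.mpr hx))
  have h2 : ContinuousAt (fun x => (innerSL ℝ (S.gxT x)).smulRight (S.gxT x)) x :=
    ((ContinuousLinearMap.smulRightL ℝ (State d) (State d)).continuous.continuousAt.comp
      ((innerSL ℝ).continuous.continuousAt.comp hG)).clm_apply hG
  exact continuousAt_const.sub (h1.smul h2)

theorem Smooth.continuousAt_adjMatrix (hS : S.Smooth) {p : State d × Control m}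
    (hp : S.gxT p.1 ≠ 0) :
    ContinuousAt (fun p : State d × Control m => S.adjMatrix p.1 p.2) p := by
  have hG : ContinuousAt (fun p : State d × Control m => S.gxT p.1) p :=
    (hS.continuous_gxT.comp continuous_fst).continuousAt
  have hz := (hS.contDiffAt_zred hp).continuousAt
  have hf := (hS.contDiffAt_fred hp).continuousAt
  have h1 : ContinuousAt (fun p : State d × Control m => (‖S.gxT p.1‖ ^ 2)⁻¹) p :=
    (hG.norm.pow 2).inv₀ (pow_ne_zero _ (norm_ne_zero_iff.mpr hp))
  have h3 : ContinuousAt (fun p : State d × Control m => S.gxx p.1 (S.fred p.1 p.2)) p :=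
    ((hS.continuous_gxx.comp continuous_fst).continuousAt).clm_apply hf
  have h2 : ContinuousAt (fun p : State d × Control m =>
      (innerSL ℝ (S.gxT p.1)).smulRight (S.gxx p.1 (S.fred p.1 p.2))) p :=
    ((ContinuousLinearMap.smulRightL ℝ (State d) (State d)).continuous.continuousAt.comp
      ((innerSL ℝ).continuous.continuousAt.comp hG)).clm_apply h3
  have h4 : ContinuousAt (fun p : State d × Control m => S.f2x p.1 (S.zred p.1 p.2) p.2) p :=
    ContinuousAt.comp (f := fun p : State d × Control m => (p.1, S.zred p.1 p.2, p.2))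
      (g := fun p : State d × ℝ × Control m => S.f2x p.1 p.2.1 p.2.2)
      hS.continuous_f2x.continuousAt (continuousAt_fst.prodMk (hz.prodMk continuousAt_snd))
  have h5 : ContinuousAt (fun p : State d × Control m => S.adjMatrixT p.1 p.2) p :=
    (h4.clm_comp ((hS.continuousAt_tanProj hp).comp continuousAt_fst)).add (h1.smul h2)
  exact (ContinuousLinearMap.adjoint (𝕜 := ℝ) (E := State d)
    (F := State d)).continuous.continuousAt.comp h5

end HybridSystem

/-! ### The linearised sliding step -/

/-- The solution of the linearised sliding step is controlled by the data `ρ` and by the normal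
components of the data, measured relative to the step size.  The right-hand sides
`J ξ + ζ G` stay bounded because invertibility of the Runge--Kutta matrix turns the constraints on
the stages into constraints on the slopes, which determine `ζ`. -/
theorem exists_linear_stage_bound {E : Type*} [NormedAddCommGroup E] [InnerProductSpace ℝ E]
    {s : ℕ} {A : Matrix (Fin s) (Fin s) ℝ} {C : ℝ} (hC : 1 ≤ C)
    (hA : ∀ i (v : Fin s → E) (β : ℝ), (∀ j, ‖v j‖ ≤ β) → ‖∑ j, A i j • v j‖ ≤ C * β)
    (hA' : ∀ (c : Fin s → ℝ) (ε : ℝ), (∀ i, |∑ j, A i j * c j| ≤ ε) → ∀ j, |c j| ≤ C * ε) :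
    ∃ C' > 0, ∃ δ > 0, ∀ (h κ β : ℝ) (G₀ : E) (G ξ ρ : Fin s → E) (ζ : Fin s → ℝ)
      (J : Fin s → E →L[ℝ] E), 0 < h → h ≤ δ → 0 ≤ κ → 0 ≤ β → ‖G₀‖ ≤ C → 1 ≤ C * ‖G₀‖ →
      (∀ i, ‖G i - G₀‖ ≤ δ) → (∀ i, ‖J i‖ ≤ C) →
      (∀ i, ξ i = ρ i + h • ∑ j, A i j • (J j (ξ j) + ζ j • G j)) →
      (∀ i, inner ℝ (G i) (ξ i) = 0) → (∀ i, |inner ℝ (G i) (ρ i)| ≤ h * κ) →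
      (∀ i, ‖ρ i‖ ≤ β) →
      ∀ j, ‖J j (ξ j) + ζ j • G j‖ ≤ C' * (κ + β) ∧ |ζ j| ≤ C' * (κ + β) ∧
        ‖ξ j‖ ≤ C' * (κ + β) ∧ ‖ξ j - ρ j‖ ≤ h * (C' * (κ + β)) := by
  have hC0 : 0 < C := by linarith
  refine ⟨12 * C ^ 7, by positivity, 1 / (20 * C ^ 6), by positivity, ?_⟩
  intro h κ β G₀ G ξ ρ ζ J hh hhδ hκ hβ hG0 hG0' hG hJ hξ hξ0 hρ hρβ
  have hC6 : 1 ≤ C ^ 6 := one_le_pow₀ hC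
  set η := 1 / (20 * C ^ 6) with hη
  have hη0 : 0 < η := by positivity
  have hηC : η * C ^ 6 = 1 / 20 := by rw [hη]; field_simp
  have hle : ∀ k ≤ 6, η * C ^ k ≤ 1 / 20 := fun k hk => by
    rw [← hηC]; exact mul_le_mul_of_nonneg_left (pow_le_pow_right₀ hC hk) hη0.le
  set q : Fin s → E := fun j => J j (ξ j) + ζ j • G j with hq
  set Q := ‖q‖ with hQ
  have hQ0 : 0 ≤ Q := norm_nonneg _
  have hqQ : ∀ j, ‖q j‖ ≤ Q := fun j => norm_le_pi_norm q j
  have hsum : ∀ i, ‖∑ j, A i j • q j‖ ≤ C * Q := fun i => hA i q Q hqQ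
  have hξ1 : ∀ j, ‖ξ j - ρ j‖ ≤ h * (C * Q) := fun j => by
    rw [hξ j, add_sub_cancel_left, norm_smul, Real.norm_of_nonneg hh.le]
    exact mul_le_mul_of_nonneg_left (hsum j) hh.le
  have hξ2 : ∀ j, ‖ξ j‖ ≤ β + h * (C * Q) := fun j => by
    have := norm_add_le (ρ j) (ξ j - ρ j)
    rw [add_sub_cancel] at this
    linarith [hξ1 j, hρβ j]
  have hGi : ∀ i, |inner ℝ G₀ (∑ j, A i j • q j)| ≤ κ + η * (C * Q) := fun i => by
    have h1 : inner ℝ (G i) (ρ i) + h * inner ℝ (G i) (∑ j, A i j • q j) = 0 := by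
      have := hξ0 i
      rw [hξ i, inner_add_right, inner_smul_right] at this
      exact this
    have h2 : |inner ℝ (G i) (∑ j, A i j • q j)| ≤ κ := by
      have h3 : h * |inner ℝ (G i) (∑ j, A i j • q j)| ≤ h * κ := by
        rw [← abs_of_pos hh, ← abs_mul, abs_of_pos hh]
        rw [show h * inner ℝ (G i) (∑ j, A i j • q j) = -inner ℝ (G i) (ρ i) by linarith, abs_neg]
        exact hρ i
      exact le_of_mul_le_mul_left h3 hh
    have h4 : inner ℝ G₀ (∑ j, A i j • q j)
        = inner ℝ (G i) (∑ j, A i j • q j) - inner ℝ (G i - G₀) (∑ j, A i j • q j) := by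
      rw [inner_sub_left]; ring
    rw [h4]
    refine (abs_sub _ _).trans (add_le_add h2 ?_)
    exact (abs_real_inner_le_norm _ _).trans
      (mul_le_mul (hG i) (hsum i) (norm_nonneg _) hη0.le)
  have hGq : ∀ j, |inner ℝ G₀ (q j)| ≤ C * (κ + η * (C * Q)) := by
    refine hA' _ _ fun i => ?_
    have := hGi i
    simpa only [inner_sum, inner_smul_right] using this
  have hζ : ∀ j, |ζ j| ≤ 2 * C ^ 2 * (C * (κ + η * (C * Q)) + C * (C * (β + h * (C * Q)))) := by
    intro j
    have h1 : ζ j * inner ℝ G₀ (G j) = inner ℝ G₀ (q j) - inner ℝ G₀ (J j (ξ j)) := by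
      simp only [hq, inner_add_right, inner_smul_right]; ring
    have h2 : |inner ℝ G₀ (J j (ξ j))| ≤ C * (C * (β + h * (C * Q))) := by
      refine (abs_real_inner_le_norm _ _).trans (mul_le_mul hG0 ?_ (norm_nonneg _) hC0.le)
      exact ((J j).le_opNorm _).trans (mul_le_mul (hJ j) (hξ2 j) (norm_nonneg _) hC0.le)
    have h3 : 1 / (2 * C ^ 2) ≤ inner ℝ G₀ (G j) := by
      have h4 : inner ℝ G₀ (G j) = ‖G₀‖ ^ 2 + inner ℝ G₀ (G j - G₀) := by
        rw [inner_sub_right, real_inner_self_eq_norm_sq]; ring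
      have h5 : |inner ℝ G₀ (G j - G₀)| ≤ C * η :=
        (abs_real_inner_le_norm _ _).trans (mul_le_mul hG0 (hG j) (norm_nonneg _) hC0.le)
      have h6 : 1 / C ≤ ‖G₀‖ := by rw [div_le_iff₀ hC0]; linarith
      have h7 : (1 / C) ^ 2 ≤ ‖G₀‖ ^ 2 := pow_le_pow_left₀ (by positivity) h6 2
      have h8 : C * η ≤ 1 / (2 * C ^ 2) := by
        rw [le_div_iff₀ (by positivity)]
        have := hle 3 (by norm_num)
        nlinarith
      have h9 : (1 / C) ^ 2 = 1 / (2 * C ^ 2) + 1 / (2 * C ^ 2) := by field_simp; norm_num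
      linarith [neg_abs_le (inner ℝ G₀ (G j - G₀))]
    have h4 : |ζ j| * (1 / (2 * C ^ 2)) ≤ |ζ j * inner ℝ G₀ (G j)| := by
      rw [abs_mul]
      exact mul_le_mul_of_nonneg_left (h3.trans (le_abs_self _)) (abs_nonneg _)
    rw [h1] at h4
    have h5 := h4.trans ((abs_sub _ _).trans (add_le_add (hGq j) h2))
    rw [mul_one_div, div_le_iff₀ (by positivity)] at h5
    linarith
  have hhη : h ≤ η := hhδ
  have hζ' : ∀ j, |ζ j| ≤ 2 * C ^ 4 * (κ + β) + C ^ 4 * (C * (4 * η)) * Q := by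
    intro j
    refine (hζ j).trans ?_
    have e1 : C ^ 3 * κ ≤ C ^ 4 * κ :=
      mul_le_mul_of_nonneg_right (pow_le_pow_right₀ hC (by norm_num)) hκ
    have e2 : C ^ 4 * (η * Q) ≤ C ^ 5 * (η * Q) :=
      mul_le_mul_of_nonneg_right (pow_le_pow_right₀ hC (by norm_num)) (by positivity)
    have e3 : C ^ 5 * (h * Q) ≤ C ^ 5 * (η * Q) := by gcongr
    nlinarith
  have hqj : ∀ j, ‖q j‖ ≤ 5 * C ^ 6 * (κ + β) + Q / 2 := by
    intro j
    have h1 : ‖q j‖ ≤ C * (β + h * (C * Q)) + |ζ j| * (C + η) := by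
      refine (norm_add_le _ _).trans (add_le_add ?_ ?_)
      · exact ((J j).le_opNorm _).trans (mul_le_mul (hJ j) (hξ2 j) (norm_nonneg _) hC0.le)
      · rw [norm_smul, Real.norm_eq_abs]
        refine mul_le_mul_of_nonneg_left ?_ (abs_nonneg _)
        have := norm_add_le G₀ (G j - G₀)
        rw [add_sub_cancel] at this
        linarith [hG j]
    have h2 : C + η ≤ 2 * C := by
      have := hle 0 (by norm_num); simp at this; linarith
    have h3 : |ζ j| * (C + η) ≤ (2 * C ^ 4 * (κ + β) + C ^ 4 * (C * (4 * η)) * Q) * (2 * C) :=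
      mul_le_mul (hζ' j) h2 (by positivity) (by positivity)
    have e1 : C * β ≤ C ^ 6 * β :=
      mul_le_mul_of_nonneg_right (by simpa using pow_le_pow_right₀ hC (show 1 ≤ 6 by norm_num)) hβ
    have e2 : C ^ 5 * (κ + β) ≤ C ^ 6 * (κ + β) :=
      mul_le_mul_of_nonneg_right (pow_le_pow_right₀ hC (by norm_num)) (by positivity)
    have e3 : C ^ 2 * (h * Q) ≤ 1 / 20 * Q := by
      have : C ^ 2 * (h * Q) ≤ η * C ^ 2 * Q := by
        have : h * (C ^ 2 * Q) ≤ η * (C ^ 2 * Q) := by gcongr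
        linarith
      exact this.trans (mul_le_mul_of_nonneg_right (hle 2 (by norm_num)) hQ0)
    have e4 : η * C ^ 6 * Q = 1 / 20 * Q := by rw [hηC]
    have e5 : 0 ≤ C ^ 6 * κ := by positivity
    nlinarith
  have hQb : Q ≤ 10 * C ^ 6 * (κ + β) := by
    have : Q ≤ 5 * C ^ 6 * (κ + β) + Q / 2 :=
      (pi_norm_le_iff_of_nonneg (by positivity)).mpr hqj
    linarith
  have hκβ : 0 ≤ κ + β := by positivity
  have hhC : h * C ≤ 1 / 20 := by
    have := hle 1 (by norm_num)
    rw [pow_one] at this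
    exact (mul_le_mul_of_nonneg_right hhη hC0.le).trans this
  intro j
  have e0 : 0 ≤ C ^ 6 * (κ + β) := by positivity
  have e0' : C ^ 6 * (κ + β) ≤ C ^ 7 * (κ + β) :=
    mul_le_mul_of_nonneg_right (pow_le_pow_right₀ hC (by norm_num)) hκβ
  refine ⟨(hqQ j).trans (by linarith), ?_, ?_, ?_⟩
  · refine (hζ' j).trans ?_
    have e1 : C ^ 4 * (κ + β) ≤ C ^ 6 * (κ + β) :=
      mul_le_mul_of_nonneg_right (pow_le_pow_right₀ hC (by norm_num)) hκβ
    have e2 : C ^ 4 * (C * (4 * η)) * Q ≤ 1 / 5 * Q := by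
      refine mul_le_mul_of_nonneg_right ?_ hQ0
      have := hle 5 (by norm_num)
      nlinarith
    linarith
  · refine (hξ2 j).trans ?_
    have e1 : 1 * β ≤ C ^ 6 * β := mul_le_mul_of_nonneg_right hC6 hβ
    have e2 : h * (C * Q) ≤ 1 / 20 * Q := by
      rw [← mul_assoc]; exact mul_le_mul_of_nonneg_right hhC hQ0
    have e3 : 0 ≤ C ^ 6 * κ := by positivity
    nlinarith
  · exact hξ1 j |>.trans (mul_le_mul_of_nonneg_left (by
      have : C * Q ≤ C * (10 * C ^ 6 * (κ + β)) := mul_le_mul_of_nonneg_left hQb hC0.le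
      have e1 : 0 ≤ C ^ 7 * (κ + β) := by positivity
      linarith [show C * (10 * C ^ 6 * (κ + β)) = 10 * (C ^ 7 * (κ + β)) by ring]) hh.le)

end

noncomputable section

/-! ### Estimates for one step in the sliding mode -/

theorem RKTableau.StifflyAccurate.exists_bounds {s : ℕ} {T : RKTableau s}
    (hT : T.StifflyAccurate) (E : Type*) [NormedAddCommGroup E] [NormedSpace ℝ E] :
    ∃ C, 1 ≤ C ∧
      (∀ i (v : Fin s → E) (β : ℝ), (∀ j, ‖v j‖ ≤ β) → ‖∑ j, T.A i j • v j‖ ≤ C * β) ∧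
      (∀ (c : Fin s → ℝ) (ε : ℝ), (∀ i, |∑ j, T.A i j * c j| ≤ ε) → ∀ j, |c j| ≤ C * ε) := by
  obtain ⟨C', hC', h⟩ := Matrix.exists_abs_le_of_abs_sum_le hT.invertible
  set C₁ := ∑ i, ∑ j, |T.A i j| with hC₁
  have hC₁0 : 0 ≤ C₁ := by positivity
  refine ⟨1 + C' + C₁, by linarith, fun i v β hv => ?_, fun c ε hc j => ?_⟩
  · have hβ : 0 ≤ β := (norm_nonneg _).trans (hv i)
    calc ‖∑ j, T.A i j • v j‖ ≤ ∑ j, ‖T.A i j • v j‖ := norm_sum_le _ _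
      _ ≤ ∑ j, |T.A i j| * β := Finset.sum_le_sum fun j _ => by
          rw [norm_smul, Real.norm_eq_abs]
          exact mul_le_mul_of_nonneg_left (hv j) (abs_nonneg _)
      _ = (∑ j, |T.A i j|) * β := by rw [Finset.sum_mul]
      _ ≤ _ := by
          refine mul_le_mul_of_nonneg_right ?_ hβ
          have : ∑ j, |T.A i j| ≤ C₁ := Finset.single_le_sum (f := fun i => ∑ l, |T.A i l|)
            (fun i _ => Finset.sum_nonneg fun l _ => abs_nonneg _) (Finset.mem_univ i)
          linarith
  · have hε : 0 ≤ ε := (abs_nonneg _).trans (hc j)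
    exact (h c ε hc j).trans (mul_le_mul_of_nonneg_right (by linarith) hε)

variable {d m s : ℕ}

theorem HybridSystem.Smooth.abs_taylor_g_le {S : HybridSystem d m} (hS : S.Smooth)
    {N : Set (State d)} (hN : Convex ℝ N) {C : ℝ}
    (hC : ∀ x ∈ N, ∀ y ∈ N, ‖S.gxT x - S.gxT y‖ ≤ C * ‖x - y‖) (hC0 : 0 ≤ C) {x y : State d}
    (hx : x ∈ N) (hy : y ∈ N) :
    |S.g y - S.g x - inner ℝ (S.gxT x) (y - x)| ≤ C * ‖y - x‖ ^ 2 := by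
  have h := Convex.norm_image_sub_le_of_norm_hasFDerivWithin_le' (f := S.g)
    (f' := fderiv ℝ S.g) (s := segment ℝ x y) (φ := innerSL ℝ (S.gxT x)) (C := C * ‖y - x‖)
    (fun z _ => ((hS.g.differentiable two_ne_zero) z).hasFDerivAt.hasFDerivWithinAt)
    (fun z hz => by
      have h1 : fderiv ℝ S.g z - innerSL ℝ (S.gxT x) = innerSL ℝ (S.gxT z - S.gxT x) := by
        ext v; simp [S.inner_gxT hS]
      rw [h1, innerSL_apply_norm]
      refine (hC z (hN.segment_subset hx hy hz) x hx).trans (mul_le_mul_of_nonneg_left ?_ hC0)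
      exact norm_sub_le_of_mem_segment (by simpa [segment_symm] using hz))
    (convex_segment x y) (left_mem_segment ℝ x y) (right_mem_segment ℝ x y)
  simpa [sq, mul_assoc] using h

/-- The state equations of one step of the scheme in the sliding mode, started at a point `x`
of the switching surface. -/
structure IsSlidingStep (S : HybridSystem d m) (T : RKTableau s) (M : ℝ) (x : State d)
    (u : Control m) (h : ℝ) (X : Fin s → State d) (Z : Fin s → ℝ) : Prop where
  h_pos : 0 < h
  start : S.g x = 0
  stage : ∀ i, X i = x + h • ∑ j, T.A i j • S.f2 (X j) (Z j) u
  alg : ∀ i, S.g (X i) = 0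
  bound : ∀ i, ‖S.f2 (X i) (Z i) u‖ ≤ M

/-- Uniform first-order estimates for sliding steps of size at most `δ` that start in `K` and use
controls of norm at most `V`. For brevity a single constant `C` also bounds the problem data on `K`
and the matrix `A` with its inverse. -/
structure SlidingBounds (S : HybridSystem d m) (T : RKTableau s) (K : Set (State d))
    (V M C δ : ℝ) : Prop where
  one_le : 1 ≤ C
  pos : 0 < δ
  A_sum : ∀ i (v : Fin s → State d) (β : ℝ), (∀ j, ‖v j‖ ≤ β) → ‖∑ j, T.A i j • v j‖ ≤ C * β
  A_inv : ∀ (c : Fin s → ℝ) (ε : ℝ), (∀ i, |∑ j, T.A i j * c j| ≤ ε) → ∀ j, |c j| ≤ C * ε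
  gxT_le : ∀ x ∈ K, ‖S.gxT x‖ ≤ C
  gxT_ge : ∀ x ∈ K, 1 ≤ C * ‖S.gxT x‖
  zred_le : ∀ x ∈ K, ∀ u, ‖u‖ ≤ V → |S.zred x u| ≤ C
  fred_le : ∀ x ∈ K, ∀ u, ‖u‖ ≤ V → ‖S.fred x u‖ ≤ C
  gxx_le : ∀ x ∈ K, ‖S.gxx x‖ ≤ C
  f2x_le : ∀ x ∈ K, ∀ u, ‖u‖ ≤ V → ‖S.f2x x (S.zred x u) u‖ ≤ C
  step : ∀ x ∈ K, ∀ u, ‖u‖ ≤ V → ∀ h ≤ δ, ∀ (X : Fin s → State d) (Z : Fin s → ℝ),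
    IsSlidingStep S T M x u h X Z → ∀ i, ‖X i - x‖ ≤ C * h ∧ |Z i - S.zred x u| ≤ C * h ∧
      ‖S.f2 (X i) (Z i) u - S.fred x u‖ ≤ C * h ∧ ‖S.gxT (X i) - S.gxT x‖ ≤ C * h ∧
      ‖S.f2x (X i) (Z i) u‖ ≤ C ∧ |inner ℝ (S.gxT (X i)) (X i - x)| ≤ C * h ^ 2

theorem IsCompact.exists_norm_le_of_continuousOn {X E : Type*} [TopologicalSpace X]
    [NormedAddCommGroup E] {K : Set X} (hK : IsCompact K) {f : X → E} (hf : ContinuousOn f K) :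
    ∃ C, 0 ≤ C ∧ ∀ x ∈ K, ‖f x‖ ≤ C := by
  obtain ⟨C, hC⟩ := hK.exists_bound_of_continuousOn hf
  exact ⟨max C 0, le_max_right _ _, fun x hx => (hC x hx).trans (le_max_left _ _)⟩

set_option maxHeartbeats 1000000 in
/-- In the sliding mode the stages stay close to the initial point, and the algebraic variables
close to the value determined by tangency. Only the slopes, not the algebraic variables, are assumed
to be bounded. -/
theorem exists_slidingBounds {S : HybridSystem d m} (hS : S.Smooth) {T : RKTableau s}
    (hT : T.StifflyAccurate) {K : Set (State d)} (hK : IsCompact K)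
    (hK0 : ∀ x ∈ K, S.gxT x ≠ 0) (V : ℝ) {M : ℝ} (hM : 0 ≤ M) :
    ∃ C δ, SlidingBounds S T K V M C δ := by
  obtain ⟨CT, hCT, hA, hA'⟩ := hT.exists_bounds (State d)
  obtain ⟨R, hR⟩ := hK.isBounded.subset_closedBall (0 : State d)
  set N : Set (State d) := Metric.closedBall 0 (R + 1) with hN
  have hNc : IsCompact N := isCompact_closedBall _ _
  set W : Set (Control m) := Metric.closedBall 0 V with hW
  have hWc : IsCompact W := isCompact_closedBall _ _
  have hmemW : ∀ u : Control m, ‖u‖ ≤ V → u ∈ W := fun u hu => by simpa [hW] using hu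
  have hKN : ∀ x ∈ K, ∀ y : State d, ‖y - x‖ ≤ 1 → y ∈ N := fun x hx y hy => by
    have h1 : ‖x‖ ≤ R := by simpa using hR hx
    have h2 := norm_add_le x (y - x)
    rw [add_sub_cancel] at h2
    simp only [hN, mem_closedBall_zero_iff]; linarith
  have hKN' : ∀ x ∈ K, x ∈ N := fun x hx => hKN x hx x (by simp)
  obtain ⟨LG, hLG⟩ := hS.contDiff_gxT.contDiffOn.exists_lipschitzOnWith one_ne_zero
    (convex_closedBall (0 : State d) (R + 1)) hNc
  obtain ⟨LF, hLF⟩ := hS.fF.contDiffOn.exists_lipschitzOnWith one_ne_zero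
    ((convex_closedBall (0 : State d) (R + 1)).prod (convex_closedBall (0 : Control m) V))
    (hNc.prod hWc)
  obtain ⟨CG, hCG0, hCG⟩ := hNc.exists_norm_le_of_continuousOn hS.continuous_gxT.continuousOn
  obtain ⟨CF, hCF0, hCF⟩ := (hNc.prod hWc).exists_norm_le_of_continuousOn
    hS.fF.continuous.continuousOn
  obtain ⟨Cg, hCg0, hCg⟩ := hK.exists_norm_le_of_continuousOn (f := fun x => ‖S.gxT x‖⁻¹)
    (hS.continuous_gxT.continuousOn.norm.inv₀ fun x hx => norm_ne_zero_iff.mpr (hK0 x hx))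
  obtain ⟨Cz, hCz0, hCz⟩ := (hK.prod hWc).exists_norm_le_of_continuousOn
    (f := fun p : State d × Control m => S.zred p.1 p.2)
    fun p hp => (hS.contDiffAt_zred (hK0 _ hp.1)).continuousAt.continuousWithinAt
  obtain ⟨Cf, hCf0, hCf⟩ := (hK.prod hWc).exists_norm_le_of_continuousOn
    (f := fun p : State d × Control m => S.fred p.1 p.2)
    fun p hp => (hS.contDiffAt_fred (hK0 _ hp.1)).continuousAt.continuousWithinAt
  obtain ⟨Cx, hCx0, hCx⟩ := hK.exists_norm_le_of_continuousOn hS.continuous_gxx.continuousOn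
  -- `C₀` collects the bounds that do not involve the scheme
  obtain ⟨C₀, hC₀⟩ : ∃ c : ℝ, c = CT + LG + LF + CG + CF + Cg := ⟨_, rfl⟩
  have hLG0 : (0 : ℝ) ≤ LG := LG.2
  have hLF0 : (0 : ℝ) ≤ LF := LF.2
  have hC1 : 1 ≤ C₀ := by linarith
  have hC00 : 0 < C₀ := by linarith
  have hGlip : ∀ x ∈ N, ∀ y ∈ N, ‖S.gxT x - S.gxT y‖ ≤ C₀ * ‖x - y‖ := fun x hx y hy =>
    (hLG.norm_sub_le hx hy).trans (mul_le_mul_of_nonneg_right (by linarith) (norm_nonneg _))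
  have hFlip : ∀ x ∈ N, ∀ y ∈ N, ∀ u ∈ W, ‖S.fF x u - S.fF y u‖ ≤ C₀ * ‖x - y‖ := by
    intro x hx y hy u hu
    have := hLF.norm_sub_le (x := (x, u)) (y := (y, u)) ⟨hx, hu⟩ ⟨hy, hu⟩
    simp only [Prod.mk_sub_mk, sub_self, Prod.norm_mk, norm_zero] at this
    rw [max_eq_left (norm_nonneg _)] at this
    exact this.trans (mul_le_mul_of_nonneg_right (by linarith) (norm_nonneg _))
  have hGle : ∀ x ∈ N, ‖S.gxT x‖ ≤ C₀ := fun x hx => (hCG x hx).trans (by linarith)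
  have hFle : ∀ x ∈ N, ∀ u ∈ W, ‖S.fF x u‖ ≤ C₀ := fun x hx u hu =>
    (hCF (x, u) ⟨hx, hu⟩).trans (by linarith)
  have hGge : ∀ x ∈ K, 1 ≤ C₀ * ‖S.gxT x‖ := fun x hx => by
    have h1 := hCg x hx
    have h2 : 0 < ‖S.gxT x‖ := norm_pos_iff.mpr (hK0 x hx)
    rw [norm_inv, norm_norm, inv_le_iff_one_le_mul₀ h2] at h1
    nlinarith
  have hA₀ : ∀ i (v : Fin s → State d) (β : ℝ), (∀ j, ‖v j‖ ≤ β) →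
      ‖∑ j, T.A i j • v j‖ ≤ C₀ * β := fun i v β hv => (hA i v β hv).trans
    (mul_le_mul_of_nonneg_right (by linarith) ((norm_nonneg _).trans (hv i)))
  have hA₀' : ∀ (c : Fin s → ℝ) (ε : ℝ), (∀ i, |∑ j, T.A i j * c j| ≤ ε) → ∀ j, |c j| ≤ C₀ * ε :=
    fun c ε hc j => (hA' c ε hc j).trans
    (mul_le_mul_of_nonneg_right (by linarith) ((abs_nonneg _).trans (hc j)))
  obtain ⟨a₁, ha₁⟩ : ∃ c : ℝ, c = C₀ * M := ⟨_, rfl⟩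
  obtain ⟨a₂, ha₂⟩ : ∃ c : ℝ, c = C₀ * a₁ := ⟨_, rfl⟩
  obtain ⟨a₃, ha₃⟩ : ∃ c : ℝ, c = C₀ * (C₀ * a₁ ^ 2) := ⟨_, rfl⟩
  obtain ⟨Zm, hZm⟩ : ∃ c : ℝ, c = 2 * C₀ * (M + C₀) := ⟨_, rfl⟩
  obtain ⟨a₄, ha₄⟩ : ∃ c : ℝ, c = C₀ ^ 2 * (a₃ + C₀ * (C₀ * a₁) + Zm * (C₀ * a₂)) := ⟨_, rfl⟩
  obtain ⟨a₅, ha₅⟩ : ∃ c : ℝ, c = C₀ * a₁ + Zm * a₂ + a₄ * C₀ := ⟨_, rfl⟩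
  obtain ⟨a₆, ha₆⟩ : ∃ c : ℝ, c = C₀ * a₁ ^ 2 := ⟨_, rfl⟩
  obtain ⟨CJ, hCJ0, hCJ⟩ := (hNc.prod ((isCompact_Icc (a := -(Zm + Cz)) (b := Zm + Cz)).prod
    hWc)).exists_norm_le_of_continuousOn hS.continuous_f2x.continuousOn
  have ha₁0 : 0 ≤ a₁ := by rw [ha₁]; positivity
  have ha₂0 : 0 ≤ a₂ := by rw [ha₂]; positivity
  have ha₃0 : 0 ≤ a₃ := by rw [ha₃]; positivity
  have hZm0 : 0 ≤ Zm := by rw [hZm]; positivity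
  have ha₄0 : 0 ≤ a₄ := by rw [ha₄]; positivity
  have ha₅0 : 0 ≤ a₅ := by rw [ha₅]; positivity
  have ha₆0 : 0 ≤ a₆ := by rw [ha₆]; positivity
  obtain ⟨C, hC⟩ : ∃ c : ℝ, c = C₀ + M + a₁ + a₂ + a₄ + a₅ + a₆ + CJ + Cz + Cf + Cx := ⟨_, rfl⟩
  have hCC : ∀ b : ℝ, 0 ≤ b → C₀ * b ≤ C * b := fun b hb =>
    mul_le_mul_of_nonneg_right (by linarith) hb
  refine ⟨C, 1 / (2 * C₀ * (a₁ + a₂ + 1)), by linarith, by positivity,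
    fun i v β hv => (hA₀ i v β hv).trans (hCC _ ((norm_nonneg _).trans (hv i))),
    fun c ε hc j => (hA₀' c ε hc j).trans (hCC _ ((abs_nonneg _).trans (hc j))),
    fun x hx => (hGle x (hKN' x hx)).trans (by linarith),
    fun x hx => (hGge x hx).trans (hCC _ (norm_nonneg _)),
    fun x hx u hu => (hCz (x, u) ⟨hx, hmemW u hu⟩).trans (by linarith),
    fun x hx u hu => (hCf (x, u) ⟨hx, hmemW u hu⟩).trans (by linarith),
    fun x hx => (hCx x hx).trans (by linarith), ?_, ?_⟩
  · intro x hx u hu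
    refine (hCJ (x, S.zred x u, u) ⟨hKN' x hx, ?_, hmemW u hu⟩).trans (by linarith)
    have := abs_le.mp (hCz (x, u) ⟨hx, hmemW u hu⟩)
    exact ⟨by linarith [this.1], by linarith [this.2]⟩
  intro x hx u hu h hδ X Z hst
  have hh := hst.h_pos
  have huW := hmemW u hu
  rw [le_div_iff₀ (by positivity)] at hδ
  have hha₁ : a₁ * h ≤ 1 := by
    have : 0 ≤ h * (a₁ + a₂ + 1) := by positivity
    have h2 : h * (a₁ + a₂ + 1) ≤ 1 := by nlinarith
    nlinarith [mul_nonneg hh.le ha₂0]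
  have hha₂ : a₂ * h ≤ 1 / (2 * C₀) := by
    rw [le_div_iff₀ (by positivity)]
    nlinarith [mul_nonneg (mul_nonneg hC00.le hh.le) ha₁0, mul_pos hC00 hh]
  have b1 : ∀ i, ‖X i - x‖ ≤ a₁ * h := fun i => by
    rw [hst.stage i, add_sub_cancel_left, norm_smul, Real.norm_of_nonneg hh.le]
    have := mul_le_mul_of_nonneg_left (hA₀ i _ M hst.bound) hh.le
    rw [ha₁]; linarith
  have hXN : ∀ i, X i ∈ N := fun i => hKN x hx _ ((b1 i).trans hha₁)
  have hxN := hKN' x hx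
  have b2 : ∀ i, ‖S.gxT (X i) - S.gxT x‖ ≤ a₂ * h := fun i => by
    refine (hGlip _ (hXN i) _ hxN).trans ?_
    have := mul_le_mul_of_nonneg_left (b1 i) hC00.le
    rw [ha₂]; linarith
  -- `g` vanishes at `x` and at the stages, so `h ∑ aᵢⱼ ⟪g_xᵀ, f²ⱼ⟫ = O(h²)`; invert `A`
  have b3 : ∀ j, |inner ℝ (S.gxT x) (S.f2 (X j) (Z j) u)| ≤ a₃ * h := by
    have h1 := hA₀' (fun j => inner ℝ (S.gxT x) (S.f2 (X j) (Z j) u)) (C₀ * a₁ ^ 2 * h) ?_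
    · intro j; refine (h1 j).trans (by rw [ha₃]; linarith)
    · intro i
      have h2 : h * ∑ j, T.A i j * inner ℝ (S.gxT x) (S.f2 (X j) (Z j) u)
          = inner ℝ (S.gxT x) (X i - x) := by
        rw [hst.stage i, add_sub_cancel_left, inner_smul_right, inner_sum]
        simp only [inner_smul_right]
      have h3 := hS.abs_taylor_g_le (convex_closedBall _ _) hGlip hC00.le hxN (hXN i)
      rw [hst.alg i, hst.start, sub_self, zero_sub, abs_neg, ← h2, abs_mul, abs_of_pos hh] at h3
      have h4 : C₀ * ‖X i - x‖ ^ 2 ≤ C₀ * (a₁ * h) ^ 2 := by gcongr; exact b1 i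
      have h5 := h3.trans h4
      refine le_of_mul_le_mul_left (h5.trans (le_of_eq ?_)) hh
      ring
  -- the algebraic variables are bounded because the slopes and `f_F` are
  have b4 : ∀ i, |Z i| ≤ Zm := fun i => by
    have h1 : Z i • S.gxT (X i) = S.f2 (X i) (Z i) u - S.fF (X i) u := by
      simp [HybridSystem.f2]
    have h2 : |Z i| * ‖S.gxT (X i)‖ ≤ M + C₀ := by
      rw [← Real.norm_eq_abs, ← norm_smul, h1]
      exact (norm_sub_le _ _).trans (add_le_add (hst.bound i) (hFle _ (hXN i) u huW))
    have h3 : 1 / (2 * C₀) ≤ ‖S.gxT (X i)‖ := by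
      have h4 : 1 / C₀ ≤ ‖S.gxT x‖ := by rw [div_le_iff₀ hC00]; linarith [hGge x hx]
      have h5 := norm_sub_norm_le (S.gxT x) (S.gxT (X i))
      rw [norm_sub_rev] at h5
      have h6 : 1 / C₀ = 1 / (2 * C₀) + 1 / (2 * C₀) := by field_simp; norm_num
      linarith [b2 i]
    have h4 : |Z i| * (1 / (2 * C₀)) ≤ M + C₀ :=
      (mul_le_mul_of_nonneg_left h3 (abs_nonneg _)).trans h2
    rw [mul_one_div, div_le_iff₀ (by positivity)] at h4
    rw [hZm]; linarith
  -- compare the almost tangent slope with `f_red`, which is tangent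
  have b5 : ∀ i, |Z i - S.zred x u| ≤ a₄ * h := fun i => by
    have hn : 0 < ‖S.gxT x‖ := norm_pos_iff.mpr (hK0 x hx)
    have h1 : ‖S.gxT x‖ ^ 2 * (Z i - S.zred x u) = inner ℝ (S.gxT x) (S.f2 (X i) (Z i) u)
        - inner ℝ (S.gxT x) (S.fF (X i) u - S.fF x u)
        - Z i * inner ℝ (S.gxT x) (S.gxT (X i) - S.gxT x) := by
      rw [HybridSystem.f2, HybridSystem.zred, inner_add_right, inner_smul_right, inner_sub_right,
        inner_sub_right, real_inner_self_eq_norm_sq]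
      field_simp
      ring
    have h2 : |inner ℝ (S.gxT x) (S.fF (X i) u - S.fF x u)| ≤ C₀ * (C₀ * (a₁ * h)) :=
      (abs_real_inner_le_norm _ _).trans (mul_le_mul (hGle x hxN)
        ((hFlip _ (hXN i) _ hxN u huW).trans (mul_le_mul_of_nonneg_left (b1 i) hC00.le))
        (norm_nonneg _) hC00.le)
    have h3 : |Z i * inner ℝ (S.gxT x) (S.gxT (X i) - S.gxT x)| ≤ Zm * (C₀ * (a₂ * h)) := by
      rw [abs_mul]
      exact mul_le_mul (b4 i) ((abs_real_inner_le_norm _ _).trans (mul_le_mul (hGle x hxN)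
        (b2 i) (norm_nonneg _) hC00.le)) (abs_nonneg _) hZm0
    have h4 : ‖S.gxT x‖ ^ 2 * |Z i - S.zred x u|
        ≤ a₃ * h + C₀ * (C₀ * (a₁ * h)) + Zm * (C₀ * (a₂ * h)) := by
      rw [← abs_of_nonneg (sq_nonneg ‖S.gxT x‖), ← abs_mul, h1]
      exact (abs_sub _ _).trans (add_le_add ((abs_sub _ _).trans (add_le_add (b3 i) h2)) h3)
    have h5 : 1 ≤ C₀ ^ 2 * ‖S.gxT x‖ ^ 2 := by
      rw [← mul_pow]; exact one_le_pow₀ (hGge x hx)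
    calc |Z i - S.zred x u| ≤ C₀ ^ 2 * ‖S.gxT x‖ ^ 2 * |Z i - S.zred x u| :=
          le_mul_of_one_le_left (abs_nonneg _) h5
      _ = C₀ ^ 2 * (‖S.gxT x‖ ^ 2 * |Z i - S.zred x u|) := by ring
      _ ≤ C₀ ^ 2 * (a₃ * h + C₀ * (C₀ * (a₁ * h)) + Zm * (C₀ * (a₂ * h))) := by gcongr
      _ = a₄ * h := by rw [ha₄]; ring
  have b6 : ∀ i, ‖S.f2 (X i) (Z i) u - S.fred x u‖ ≤ a₅ * h := fun i => by
    have h1 : S.f2 (X i) (Z i) u - S.fred x u = (S.fF (X i) u - S.fF x u)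
        + Z i • (S.gxT (X i) - S.gxT x) + (Z i - S.zred x u) • S.gxT x := by
      simp only [HybridSystem.fred, HybridSystem.f2, smul_sub, sub_smul]; abel
    rw [h1]
    have h2 := (hFlip _ (hXN i) _ hxN u huW).trans (mul_le_mul_of_nonneg_left (b1 i) hC00.le)
    have h3 : ‖Z i • (S.gxT (X i) - S.gxT x)‖ ≤ Zm * (a₂ * h) := by
      rw [norm_smul]; exact mul_le_mul (b4 i) (b2 i) (norm_nonneg _) hZm0
    have h4 : ‖(Z i - S.zred x u) • S.gxT x‖ ≤ a₄ * h * C₀ := by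
      rw [norm_smul]
      exact mul_le_mul (b5 i) (hGle x hxN) (norm_nonneg _) (by positivity)
    refine (norm_add₃_le).trans ?_
    rw [ha₅]; linarith
  have hCh : ∀ a : ℝ, a ≤ C → a * h ≤ C * h := fun a ha => mul_le_mul_of_nonneg_right ha hh.le
  intro i
  refine ⟨(b1 i).trans (hCh _ (by linarith)), (b5 i).trans (hCh _ (by linarith)),
    (b6 i).trans (hCh _ (by linarith)), (b2 i).trans (hCh _ (by linarith)), ?_, ?_⟩
  · refine (hCJ (X i, Z i, u) ⟨hXN i, ?_, huW⟩).trans (by linarith)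
    have := abs_le.mp (b4 i)
    exact ⟨by linarith [this.1], by linarith [this.2]⟩
  · have h3 := hS.abs_taylor_g_le (convex_closedBall _ _) hGlip hC00.le (hXN i) hxN
    rw [hst.alg i, hst.start, sub_self, zero_sub, abs_neg, ← neg_sub (X i) x, inner_neg_right,
      abs_neg, norm_neg] at h3
    have h4 : C₀ * ‖X i - x‖ ^ 2 ≤ C₀ * (a₁ * h) ^ 2 := by gcongr; exact b1 i
    refine (h3.trans h4).trans ?_
    have : a₆ * h ^ 2 ≤ C * h ^ 2 := mul_le_mul_of_nonneg_right (by linarith) (sq_nonneg h)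
    rw [ha₆] at this
    linarith

end

noncomputable section

variable {d m s : ℕ}

/-- A map that is continuous at the points of a compact set is uniformly continuous there, even
when one of the two points is not in the set. -/
theorem IsCompact.exists_forall_dist_le {X Y : Type*} [PseudoMetricSpace X] [PseudoMetricSpace Y]
    {K : Set X} (hK : IsCompact K) {f : X → Y} (hf : ∀ x ∈ K, ContinuousAt f x) {ε : ℝ}
    (hε : 0 < ε) : ∃ δ > 0, ∀ x ∈ K, ∀ y, dist x y < δ → dist (f x) (f y) ≤ ε := by
  obtain ⟨δ, hδ, h⟩ := Metric.mem_uniformity_dist.mp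
    (hK.uniformContinuousAt_of_continuousAt f hf (Metric.dist_mem_uniformity hε))
  exact ⟨δ, hδ, fun x hx y hxy => (h hxy hx).le⟩

/-- Small steps move `f²_x` little, and `g_xᵀ` is given by its linearisation up to `o(h)`; as the
data are only `C¹`, no rate is available here. -/
theorem SlidingBounds.exists_modulus {S : HybridSystem d m} (hS : S.Smooth) {T : RKTableau s}
    {K : Set (State d)} (hK : IsCompact K) {V M C δ : ℝ} (hb : SlidingBounds S T K V M C δ)
    {ε : ℝ} (hε : 0 < ε) :
    ∃ δ' > 0, δ' ≤ δ ∧ ∀ x ∈ K, ∀ u, ‖u‖ ≤ V → ∀ h ≤ δ', ∀ (X : Fin s → State d)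
      (Z : Fin s → ℝ), IsSlidingStep S T M x u h X Z → ∀ i,
        ‖S.f2x (X i) (Z i) u - S.f2x x (S.zred x u) u‖ ≤ ε ∧
        ‖S.gxT (X i) - S.gxT x - S.gxx x (X i - x)‖ ≤ ε * (C * h) := by
  have hC : 0 < C := by linarith [hb.one_le]
  obtain ⟨δ₁, hδ₁, h₁⟩ := (hK.prod ((isCompact_Icc (a := -C) (b := C)).prod
    (isCompact_closedBall (0 : Control m) V))).exists_forall_dist_le
    (fun p _ => hS.continuous_f2x.continuousAt) hε
  obtain ⟨δ₂, hδ₂, h₂⟩ := hK.exists_forall_dist_le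
    (fun p _ => hS.continuous_gxx.continuousAt) hε
  refine ⟨min δ (min (δ₁ / (2 * C)) (δ₂ / (2 * C))), lt_min hb.pos (by positivity),
    min_le_left _ _, fun x hx u hu h hh X Z hst i => ?_⟩
  obtain ⟨b1, b2, -⟩ := hb.step x hx u hu h (hh.trans (min_le_left _ _)) X Z hst i
  have hhp := hst.h_pos
  have e1 : C * h < δ₁ := by
    have : h ≤ δ₁ / (2 * C) := hh.trans ((min_le_right _ _).trans (min_le_left _ _))
    rw [le_div_iff₀ (by positivity)] at this
    nlinarith
  have e2 : C * h < δ₂ := by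
    have : h ≤ δ₂ / (2 * C) := hh.trans ((min_le_right _ _).trans (min_le_right _ _))
    rw [le_div_iff₀ (by positivity)] at this
    nlinarith
  constructor
  · have := h₁ (x, S.zred x u, u) ⟨hx, abs_le.mp (hb.zred_le x hx u hu), by simpa using hu⟩
      (X i, Z i, u) (by
        simp only [Prod.dist_eq, dist_self, max_lt_iff]
        refine ⟨?_, ?_, hδ₁⟩
        · rw [dist_comm, dist_eq_norm]; linarith
        · rw [dist_comm, Real.dist_eq]; linarith)
    rwa [dist_comm, dist_eq_norm] at this
  · have := Convex.norm_image_sub_le_of_norm_hasFDerivWithin_le' (f := S.gxT)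
      (f' := S.gxx) (s := segment ℝ x (X i)) (φ := S.gxx x) (C := ε)
      (fun z _ => (hS.hasFDerivAt_gxT z).hasFDerivWithinAt)
      (fun z hz => by
        have h3 : ‖z - x‖ ≤ ‖X i - x‖ :=
          norm_sub_le_of_mem_segment (by simpa [segment_symm] using hz)
        have h4 := h₂ x hx z (by rw [dist_comm, dist_eq_norm]; linarith)
        rwa [dist_comm, dist_eq_norm] at h4)
      (convex_segment _ _) (left_mem_segment _ _ _) (right_mem_segment _ _ _)
    exact this.trans (mul_le_mul_of_nonneg_left b1 hε.le)

theorem SlidingBounds.exists_gxT_ne_zero {S : HybridSystem d m} {T : RKTableau s}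
    {K : Set (State d)} {V M C δ : ℝ} (hb : SlidingBounds S T K V M C δ) :
    ∃ δ' > 0, δ' ≤ δ ∧ ∀ x ∈ K, ∀ u, ‖u‖ ≤ V → ∀ h ≤ δ', ∀ (X : Fin s → State d)
      (Z : Fin s → ℝ), IsSlidingStep S T M x u h X Z → ∀ i, S.gxT (X i) ≠ 0 := by
  have hC : 0 < C := by linarith [hb.one_le]
  refine ⟨min δ (1 / (2 * C ^ 2)), lt_min hb.pos (by positivity), min_le_left _ _,
    fun x hx u hu h hh X Z hst i h0 => ?_⟩
  obtain ⟨-, -, -, b, -⟩ := hb.step x hx u hu h (hh.trans (min_le_left _ _)) X Z hst i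
  rw [h0, zero_sub, norm_neg] at b
  have h1 := hb.gxT_ge x hx
  have h2 : h ≤ 1 / (2 * C ^ 2) := hh.trans (min_le_right _ _)
  rw [le_div_iff₀ (by positivity)] at h2
  have h3 : C * ‖S.gxT x‖ ≤ C * (C * h) := mul_le_mul_of_nonneg_left b hC.le
  nlinarith

/-- The conclusion of `exists_linear_stage_bound` for the Jacobians along a sliding step. -/
theorem SlidingBounds.exists_linear_bound {S : HybridSystem d m} {T : RKTableau s}
    {K : Set (State d)} {V M C δ : ℝ} (hb : SlidingBounds S T K V M C δ) :
    ∃ C' > 0, ∃ δ' > 0, δ' ≤ δ ∧ ∀ x ∈ K, ∀ u, ‖u‖ ≤ V → ∀ h ≤ δ', ∀ (X : Fin s → State d)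
      (Z : Fin s → ℝ), IsSlidingStep S T M x u h X Z →
      ∀ (κ β : ℝ) (ξ ρ : Fin s → State d) (ζ : Fin s → ℝ), 0 ≤ κ → 0 ≤ β →
      (∀ i, ξ i = ρ i + h • ∑ j, T.A i j • (S.f2x (X j) (Z j) u (ξ j) + ζ j • S.gxT (X j))) →
      (∀ i, inner ℝ (S.gxT (X i)) (ξ i) = 0) → (∀ i, |inner ℝ (S.gxT (X i)) (ρ i)| ≤ h * κ) →
      (∀ i, ‖ρ i‖ ≤ β) →
      ∀ j, ‖S.f2x (X j) (Z j) u (ξ j) + ζ j • S.gxT (X j)‖ ≤ C' * (κ + β) ∧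
        |ζ j| ≤ C' * (κ + β) ∧ ‖ξ j‖ ≤ C' * (κ + β) ∧ ‖ξ j - ρ j‖ ≤ h * (C' * (κ + β)) := by
  have hC : 0 < C := by linarith [hb.one_le]
  obtain ⟨C', hC', δ₁, hδ₁, H⟩ := exists_linear_stage_bound hb.one_le hb.A_sum hb.A_inv
  refine ⟨C', hC', min δ (min δ₁ (δ₁ / C)), lt_min hb.pos (lt_min hδ₁ (by positivity)),
    min_le_left _ _, ?_⟩
  intro x hx u hu h hh X Z hst κ β ξ ρ ζ hκ hβ h1 h2 h3 h4
  have hs := hb.step x hx u hu h (hh.trans (min_le_left _ _)) X Z hst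
  refine H h κ β (S.gxT x) (fun i => S.gxT (X i)) ξ ρ ζ (fun j => S.f2x (X j) (Z j) u) hst.h_pos
    (hh.trans ((min_le_right _ _).trans (min_le_left _ _))) hκ hβ (hb.gxT_le x hx)
    (hb.gxT_ge x hx) (fun i => (hs i).2.2.2.1.trans ?_) (fun i => (hs i).2.2.2.2.1) h1 h2 h3 h4
  have : h ≤ δ₁ / C := hh.trans ((min_le_right _ _).trans (min_le_right _ _))
  rw [le_div_iff₀ hC] at this
  linarith

/-- The derivative of the sliding step with respect to the step size is close to the negative of
the reduced vector field. -/
theorem SlidingBounds.exists_stepsize_derivative_bound {S : HybridSystem d m} {T : RKTableau s}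
    (hT : T.StifflyAccurate) {K : Set (State d)} {V M C δ : ℝ} (hM : 0 ≤ M)
    (hb : SlidingBounds S T K V M C δ) {r : Fin s} (hr : ∀ j, T.A r j = T.b j) :
    ∃ C' > 0, ∃ δ' > 0, ∀ x ∈ K, ∀ u, ‖u‖ ≤ V → ∀ h ≤ δ', ∀ (X : Fin s → State d)
      (Z : Fin s → ℝ), IsSlidingStep S T M x u h X Z →
      ∀ (ξ : Fin s → State d) (ζ : Fin s → ℝ),
      (∀ i, ξ i = -∑ j, T.A i j • S.f2 (X j) (Z j) u
        + h • ∑ j, T.A i j • (S.f2x (X j) (Z j) u (ξ j) + ζ j • S.gxT (X j))) →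
      (∀ i, inner ℝ (S.gxT (X i)) (ξ i) = 0) → ‖ξ r + S.fred x u‖ ≤ C' * h := by
  have hC : 0 < C := by linarith [hb.one_le]
  obtain ⟨C', hC', δ', hδ', hδδ, H⟩ := hb.exists_linear_bound
  refine ⟨C' * (C + C * M) + C * C, by positivity, δ', hδ', ?_⟩
  intro x hx u hu h hh X Z hst ξ ζ h1 h2
  have hhp := hst.h_pos
  have hs := hb.step x hx u hu h (hh.trans hδδ) X Z hst
  obtain ⟨-, -, -, h3⟩ := H x hx u hu h hh X Z hst C (C * M) ξ
    (fun i => -∑ j, T.A i j • S.f2 (X j) (Z j) u) ζ hC.le (by positivity) h1 h2 (fun i => by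
      have e := (hs i).2.2.2.2.2
      rw [hst.stage i, add_sub_cancel_left, inner_smul_right, abs_mul, abs_of_pos hhp,
        ← hst.stage i] at e
      rw [inner_neg_right, abs_neg]
      refine le_of_mul_le_mul_left (e.trans (le_of_eq ?_)) hhp
      ring) (fun i => by rw [norm_neg]; exact hb.A_sum i _ M hst.bound) r
  have h4 : ‖∑ j, T.A r j • (S.f2 (X j) (Z j) u - S.fred x u)‖ ≤ C * (C * h) :=
    hb.A_sum r _ _ fun j => (hs j).2.2.1
  have h5 : ∑ j, T.A r j • (S.f2 (X j) (Z j) u - S.fred x u)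
      = ∑ j, T.A r j • S.f2 (X j) (Z j) u - S.fred x u := by
    simp only [smul_sub, Finset.sum_sub_distrib, ← Finset.sum_smul]
    simp_rw [hr]
    rw [hT.sum_b, one_smul]
  rw [h5] at h4
  have h6 : ξ r + S.fred x u = (ξ r - -∑ j, T.A r j • S.f2 (X j) (Z j) u)
      - (∑ j, T.A r j • S.f2 (X j) (Z j) u - S.fred x u) := by abel
  rw [h6]
  refine (norm_sub_le _ _).trans ((add_le_add h3 h4).trans (le_of_eq ?_))
  ring

/-- One step of the discrete adjoint equation in the sliding mode, in variational form: `l` is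
obtained from `l'` through the linearised scheme. -/
def IsAdjointStep (S : HybridSystem d m) (T : RKTableau s) (r : Fin s) (u : Control m) (h : ℝ)
    (X : Fin s → State d) (Z : Fin s → ℝ) (l l' : State d) : Prop :=
  ∀ v, ∃ (ξ : Fin s → State d) (ζ : Fin s → ℝ),
    (∀ i, ξ i = v + h • ∑ j, T.A i j • (S.f2x (X j) (Z j) u (ξ j) + ζ j • S.gxT (X j))) ∧
    (∀ i, inner ℝ (S.gxT (X i)) (ξ i) = 0) ∧ inner ℝ l v = inner ℝ l' (ξ r)

/-- The normal component of the discrete adjoint is of the order of the step size: for a normal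
initial value, the linearised scheme, whose algebraic variables are of size `1 / h`, returns
to zero after one step. -/
theorem SlidingBounds.exists_adjoint_normal_bound {S : HybridSystem d m} {T : RKTableau s}
    (hT : T.StifflyAccurate) {K : Set (State d)} {V M C δ : ℝ}
    (hb : SlidingBounds S T K V M C δ) {r : Fin s} :
    ∃ C' > 0, ∃ δ' > 0, ∀ x ∈ K, ∀ u, ‖u‖ ≤ V → ∀ h ≤ δ', ∀ (X : Fin s → State d)
      (Z : Fin s → ℝ), IsSlidingStep S T M x u h X Z → ∀ l l' : State d,
      IsAdjointStep S T r u h X Z l l' →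
      |inner ℝ l (S.gxT x)| ≤ C' * h * ‖S.tanProj (X r) l'‖ := by
  have hC : 0 < C := by linarith [hb.one_le]
  obtain ⟨C', hC', δ', hδ', hδδ, H⟩ := hb.exists_linear_bound
  -- `α = A⁻¹ 1`
  obtain ⟨α, hα⟩ : ∃ α : Fin s → ℝ, ∀ i, ∑ j, T.A i j * α j = 1 := by
    refine ⟨T.A⁻¹.mulVec 1, fun i => ?_⟩
    have := congrFun (Matrix.mulVec_mulVec (1 : Fin s → ℝ) T.A T.A⁻¹) i
    rw [Matrix.mul_nonsing_inv _ hT.invertible, Matrix.one_mulVec] at this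
    exact this
  have hα' : ∀ j, |α j| ≤ C := fun j => by
    have := hb.A_inv α 1 (fun i => by rw [hα i]; simp) j
    linarith
  set b₁ := C * (C * C) with hb₁
  set δ'' := min δ' 1 with hδ''
  refine ⟨b₁ + C' * (2 * C * b₁ + b₁), by positivity, δ'', lt_min hδ' one_pos, ?_⟩
  intro x hx u hu h hh X Z hst l l' hl
  have hhp := hst.h_pos
  have hh1 : h ≤ 1 := hh.trans (min_le_right _ _)
  have hs := hb.step x hx u hu h ((hh.trans (min_le_left _ _)).trans hδδ) X Z hst
  obtain ⟨ξ, ζ, h1, h2, h3⟩ := hl (S.gxT x)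
  set ρ : Fin s → State d := fun i => ∑ j, T.A i j • (α j • (S.gxT x - S.gxT (X j))) with hρ
  have hρ1 : ∀ i, ‖ρ i‖ ≤ b₁ * h := fun i => by
    refine (hb.A_sum i _ (C * (C * h)) fun j => ?_).trans (le_of_eq (by rw [hb₁]; ring))
    rw [norm_smul, norm_sub_rev]
    exact mul_le_mul (hα' j) (hs j).2.2.2.1 (norm_nonneg _) hC.le
  have hG2 : ∀ i, ‖S.gxT (X i)‖ ≤ 2 * C := fun i => by
    have e1 := norm_add_le (S.gxT x) (S.gxT (X i) - S.gxT x)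
    rw [add_sub_cancel] at e1
    have e2 := (hs i).2.2.2.1
    have e3 := hb.gxT_le x hx
    nlinarith
  have hξ : ∀ i, ξ i = ρ i + h • ∑ j, T.A i j •
      (S.f2x (X j) (Z j) u (ξ j) + (ζ j + α j / h) • S.gxT (X j)) := by
    intro i
    have e1 : ρ i = S.gxT x - ∑ j, (T.A i j * α j) • S.gxT (X j) := by
      simp only [hρ, smul_sub, Finset.sum_sub_distrib, smul_smul, ← Finset.sum_smul, hα i,
        one_smul]
    have e2 : h • ∑ j, T.A i j •
        (S.f2x (X j) (Z j) u (ξ j) + (ζ j + α j / h) • S.gxT (X j))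
        = h • ∑ j, T.A i j • (S.f2x (X j) (Z j) u (ξ j) + ζ j • S.gxT (X j))
          + ∑ j, (T.A i j * α j) • S.gxT (X j) := by
      rw [Finset.smul_sum, Finset.smul_sum, ← Finset.sum_add_distrib]
      refine Finset.sum_congr rfl fun j _ => ?_
      have : T.A i j * α j = h * (T.A i j * (α j / h)) := by field_simp
      rw [this]
      module
    rw [e1, e2]
    conv_lhs => rw [h1 i]
    abel
  obtain ⟨-, -, -, h4⟩ := H x hx u hu h (hh.trans (min_le_left _ _)) X Z hst (2 * C * b₁) b₁ ξ ρ
    (fun j => ζ j + α j / h) (by positivity) (by positivity) hξ h2 (fun i => by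
      refine (abs_real_inner_le_norm _ _).trans ?_
      have := mul_le_mul (hG2 i) (hρ1 i) (norm_nonneg _) (by positivity)
      linarith) (fun i => (hρ1 i).trans (by
        have : 0 ≤ b₁ := by positivity
        nlinarith)) r
  have h5 : ‖ξ r‖ ≤ (b₁ + C' * (2 * C * b₁ + b₁)) * h := by
    have e1 := norm_add_le (ρ r) (ξ r - ρ r)
    rw [add_sub_cancel] at e1
    linarith [hρ1 r]
  rw [h3, ← HybridSystem.inner_tanProj_of_tangent (h2 r)]
  refine (abs_real_inner_le_norm _ _).trans ?_
  rw [mul_comm]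
  exact mul_le_mul_of_nonneg_right h5 (norm_nonneg _)

set_option maxHeartbeats 1000000 in
/-- The tangential part of the discrete adjoint satisfies a perturbed Euler recursion for the
reduced adjoint equation. -/
theorem SlidingBounds.exists_adjoint_tangent_bound {S : HybridSystem d m} (hS : S.Smooth)
    {T : RKTableau s} (hT : T.StifflyAccurate) {K : Set (State d)} (hK : IsCompact K)
    (hK0 : ∀ x ∈ K, S.gxT x ≠ 0) {V M C δ : ℝ}
    (hb : SlidingBounds S T K V M C δ) {r : Fin s} (hr : ∀ j, T.A r j = T.b j) {ε : ℝ}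
    (hε : 0 < ε) :
    ∃ δ' > 0, ∀ x ∈ K, ∀ u, ‖u‖ ≤ V → ∀ h ≤ δ', ∀ (X : Fin s → State d)
      (Z : Fin s → ℝ), IsSlidingStep S T M x u h X Z → ∀ l l' : State d,
      IsAdjointStep S T r u h X Z l l' →
      ‖S.tanProj (X r) l' - S.tanProj x l + h • S.adjMatrix x u (S.tanProj (X r) l')‖
        ≤ h * (ε * ‖S.tanProj (X r) l'‖) := by
  have hC1 := hb.one_le
  have hC : 0 < C := by linarith
  obtain ⟨C', hC', δ₁, hδ₁, hδδ, H⟩ := hb.exists_linear_bound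
  obtain ⟨δ₃, hδ₃, hδδ₃, hne⟩ := hb.exists_gxT_ne_zero
  set D := C' * (C * C + 1) with hD
  have hD0 : 0 < D := by positivity
  -- the constant multiplying `η + h` in the final bound
  set Q := C * (D + C * D + D * (2 * C)) + C ^ 2 * (C * C * C + C) with hQ
  have hQ0 : 0 < Q := by positivity
  set η := ε / (2 * Q) with hη
  have hη0 : 0 < η := by positivity
  obtain ⟨δ₂, hδ₂, hδδ₂, hmod⟩ := hb.exists_modulus hS hK hη0
  refine ⟨min (min δ₁ δ₂) (min δ₃ η), lt_min (lt_min hδ₁ hδ₂) (lt_min hδ₃ hη0), ?_⟩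
  intro x hx u hu h hh X Z hst l l' hl
  have hh₁ : h ≤ δ₁ := hh.trans ((min_le_left _ _).trans (min_le_left _ _))
  have hh₂ : h ≤ δ₂ := hh.trans ((min_le_left _ _).trans (min_le_right _ _))
  have hh₃ : h ≤ δ₃ := hh.trans ((min_le_right _ _).trans (min_le_left _ _))
  have hhη : h ≤ η := hh.trans ((min_le_right _ _).trans (min_le_right _ _))
  have hhp := hst.h_pos
  have hs := hb.step x hx u hu h (hh₁.trans hδδ) X Z hst
  have hmod' := hmod x hx u hu h hh₂ X Z hst
  have hGr := hne x hx u hu h hh₃ X Z hst r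
  set p := S.tanProj (X r) l' with hp
  have hpG : inner ℝ p (S.gxT (X r)) = 0 := by
    rw [real_inner_comm]; exact HybridSystem.inner_gxT_tanProj hGr l'
  have hG0 := hK0 x hx
  have hGn : 0 < ‖S.gxT x‖ := norm_pos_iff.mpr hG0
  set J₀ := S.f2x x (S.zred x u) u with hJ₀
  have hbsum : ∀ w : State d, ∑ j, T.A r j • w = w := fun w => by
    rw [← Finset.sum_smul]; simp_rw [hr]; rw [hT.sum_b, one_smul]
  -- the defect of the tangency of `p` at the old point
  have hpx : |inner ℝ p (S.gxT x) + h * inner ℝ p (S.gxx x (S.fred x u))|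
      ≤ h * ((C * C * C * h + C * η) * ‖p‖) := by
    have e1 : inner ℝ p (S.gxT x) + h * inner ℝ p (S.gxx x (S.fred x u))
        = -inner ℝ p (S.gxT (X r) - S.gxT x - S.gxx x (X r - x))
          - h * inner ℝ p (S.gxx x (∑ j, T.A r j • (S.f2 (X j) (Z j) u - S.fred x u))) := by
      have e2 : S.gxx x (X r - x) = h • (S.gxx x (S.fred x u)
          + S.gxx x (∑ j, T.A r j • (S.f2 (X j) (Z j) u - S.fred x u))) := by
        rw [← map_add, ← map_smul]
        congr 1
        rw [hst.stage r, add_sub_cancel_left]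
        simp only [smul_sub, Finset.sum_sub_distrib, hbsum]
        congr 1
        abel
      rw [e2, inner_sub_right, inner_sub_right, inner_smul_right, inner_add_right, hpG]
      ring
    rw [e1]
    refine (abs_sub _ _).trans ?_
    rw [abs_neg, abs_mul, abs_of_pos hhp]
    have e3 := (abs_real_inner_le_norm p (S.gxT (X r) - S.gxT x - S.gxx x (X r - x))).trans
      (mul_le_mul_of_nonneg_left (hmod' r).2 (norm_nonneg _))
    have e4 : ‖∑ j, T.A r j • (S.f2 (X j) (Z j) u - S.fred x u)‖ ≤ C * (C * h) :=
      hb.A_sum r _ _ fun j => (hs j).2.2.1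
    have e5 := (abs_real_inner_le_norm p (S.gxx x
      (∑ j, T.A r j • (S.f2 (X j) (Z j) u - S.fred x u)))).trans
      (mul_le_mul_of_nonneg_left (((S.gxx x).le_opNorm _).trans
        (mul_le_mul (hb.gxx_le x hx) e4 (norm_nonneg _) hC.le)) (norm_nonneg p))
    have e6 := mul_le_mul_of_nonneg_left e5 hhp.le
    linarith
  -- the estimate tested with a vector `v`
  have key : ∀ v, |inner ℝ (p - S.tanProj x l + h • S.adjMatrix x u p) v|
      ≤ h * (ε * ‖p‖) * ‖v‖ := by
    intro v
    set τ := S.tanProj x v with hτ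
    have hτv : ‖τ‖ ≤ ‖v‖ := HybridSystem.norm_tanProj_le x v
    have hGτ : inner ℝ (S.gxT x) τ = 0 := HybridSystem.inner_gxT_tanProj hG0 v
    obtain ⟨ξ, ζ, h1, h2, h3⟩ := hl τ
    have hlin := H x hx u hu h hh₁ X Z hst (C * ‖τ‖) ‖τ‖ ξ (fun _ => τ) ζ (by positivity)
      (norm_nonneg _) h1 h2 (fun i => by
        have : inner ℝ (S.gxT (X i)) τ = inner ℝ (S.gxT (X i) - S.gxT x) τ := by
          rw [inner_sub_left, hGτ, sub_zero]
        rw [this]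
        refine (abs_real_inner_le_norm _ _).trans ?_
        have := mul_le_mul_of_nonneg_right (hs i).2.2.2.1 (norm_nonneg τ)
        linarith) (fun _ => le_rfl)
    have hCD : C' * (C * ‖τ‖ + ‖τ‖) ≤ D * ‖τ‖ := by
      have : C' * (C * ‖τ‖) ≤ C' * (C * C * ‖τ‖) := by
        gcongr; nlinarith
      rw [hD]; linarith
    have hζ : ∀ j, |ζ j| ≤ D * ‖τ‖ := fun j => (hlin j).2.1.trans hCD
    have hξ : ∀ j, ‖ξ j‖ ≤ D * ‖τ‖ := fun j => (hlin j).2.2.1.trans hCD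
    have hξτ : ∀ j, ‖ξ j - τ‖ ≤ h * (D * ‖τ‖) := fun j =>
      (hlin j).2.2.2.trans (mul_le_mul_of_nonneg_left hCD hhp.le)
    have hterm : ∀ j, ‖S.f2x (X j) (Z j) u (ξ j) - J₀ τ‖ ≤ (η * D + C * (h * D)) * ‖τ‖ := by
      intro j
      have e1 : S.f2x (X j) (Z j) u (ξ j) - J₀ τ
          = (S.f2x (X j) (Z j) u - J₀) (ξ j) + J₀ (ξ j - τ) := by
        rw [sub_apply, map_sub]; abel
      rw [e1]
      have e2 := (S.f2x (X j) (Z j) u - J₀).le_opNorm (ξ j)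
      have e3 := J₀.le_opNorm (ξ j - τ)
      have e4 := mul_le_mul (hmod' j).1 (hξ j) (norm_nonneg _) hη0.le
      have e5 := mul_le_mul (hb.f2x_le x hx u hu) (hξτ j) (norm_nonneg _) hC.le
      refine (norm_add_le _ _).trans ((add_le_add (e2.trans e4) (e3.trans e5)).trans ?_)
      linarith
    have hstep : inner ℝ (S.tanProj x l) v
        = inner ℝ p τ + h * (inner ℝ p (J₀ τ)
          + (inner ℝ p (∑ j, T.A r j • (S.f2x (X j) (Z j) u (ξ j) - J₀ τ))
          + ∑ j, T.A r j * (ζ j * inner ℝ p (S.gxT (X j))))) := by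
      rw [HybridSystem.inner_tanProj_left, ← hτ, h3,
        ← HybridSystem.inner_tanProj_of_tangent (h2 r), ← hp]
      conv_lhs => rw [h1 r]
      simp only [smul_sub, smul_add, Finset.sum_sub_distrib, Finset.sum_add_distrib, hbsum,
        inner_add_right, inner_sub_right, inner_smul_right, inner_sum]
      ring
    have hadj : inner ℝ (S.adjMatrix x u p) v = inner ℝ p (J₀ τ)
        + (‖S.gxT x‖ ^ 2)⁻¹ * inner ℝ (S.gxT x) v * inner ℝ p (S.gxx x (S.fred x u)) := by
      rw [HybridSystem.inner_adjMatrix, HybridSystem.adjMatrixT_apply, inner_add_right,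
        inner_smul_right]
    have hpτ : inner ℝ p τ = inner ℝ p v
        - (‖S.gxT x‖ ^ 2)⁻¹ * inner ℝ (S.gxT x) v * inner ℝ p (S.gxT x) := by
      rw [hτ, HybridSystem.tanProj_apply, inner_sub_right, inner_smul_right]
    have hexp : inner ℝ (p - S.tanProj x l + h • S.adjMatrix x u p) v
        = (‖S.gxT x‖ ^ 2)⁻¹ * inner ℝ (S.gxT x) v *
            (inner ℝ p (S.gxT x) + h * inner ℝ p (S.gxx x (S.fred x u)))
          - h * (inner ℝ p (∑ j, T.A r j • (S.f2x (X j) (Z j) u (ξ j) - J₀ τ))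
          + ∑ j, T.A r j * (ζ j * inner ℝ p (S.gxT (X j)))) := by
      rw [inner_add_left, inner_sub_left, real_inner_smul_left, hadj, hstep, hpτ]
      ring
    have c1 : |(‖S.gxT x‖ ^ 2)⁻¹ * inner ℝ (S.gxT x) v| ≤ C * ‖v‖ := by
      have e1 := abs_real_inner_le_norm (S.gxT x) v
      rw [abs_mul, abs_of_nonneg (by positivity)]
      calc (‖S.gxT x‖ ^ 2)⁻¹ * |inner ℝ (S.gxT x) v|
          ≤ (‖S.gxT x‖ ^ 2)⁻¹ * (‖S.gxT x‖ * ‖v‖) := by gcongr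
        _ = ‖S.gxT x‖⁻¹ * ‖v‖ := by field_simp
        _ ≤ C * ‖v‖ := by
          refine mul_le_mul_of_nonneg_right ?_ (norm_nonneg _)
          rw [inv_le_iff_one_le_mul₀ hGn]
          exact hb.gxT_ge x hx
    have c2 : |inner ℝ p (∑ j, T.A r j • (S.f2x (X j) (Z j) u (ξ j) - J₀ τ))|
        ≤ ‖p‖ * (C * ((η * D + C * (h * D)) * ‖τ‖)) :=
      (abs_real_inner_le_norm _ _).trans
        (mul_le_mul_of_nonneg_left (hb.A_sum r _ _ hterm) (norm_nonneg _))
    have c3 : |∑ j, T.A r j * (ζ j * inner ℝ p (S.gxT (X j)))|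
        ≤ C * (D * ‖τ‖ * (2 * C * h)) * ‖p‖ := by
      have e1 : ∑ j, T.A r j * (ζ j * inner ℝ p (S.gxT (X j)))
          = inner ℝ p (∑ j, T.A r j • (ζ j • (S.gxT (X j) - S.gxT (X r)))) := by
        simp only [inner_sum, inner_smul_right, inner_sub_right, hpG, sub_zero]
      rw [e1]
      refine (abs_real_inner_le_norm _ _).trans ?_
      rw [mul_comm]
      refine mul_le_mul_of_nonneg_right (hb.A_sum r _ _ fun j => ?_) (norm_nonneg _)
      rw [norm_smul]
      refine mul_le_mul (hζ j) ?_ (norm_nonneg _) (by positivity)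
      have e2 := (norm_sub_le (S.gxT (X j) - S.gxT x) (S.gxT (X r) - S.gxT x)).trans
        (add_le_add (hs j).2.2.2.1 (hs r).2.2.2.1)
      rw [sub_sub_sub_cancel_right] at e2
      linarith
    rw [hexp]
    refine (abs_sub _ _).trans ?_
    rw [abs_mul _ (inner ℝ p (S.gxT x) + _), abs_mul h, abs_of_pos hhp]
    have d1 := mul_le_mul c1 hpx (abs_nonneg _) (by positivity)
    have d2 := mul_le_mul_of_nonneg_left ((abs_add_le _ _).trans (add_le_add c2 c3)) hhp.le
    refine (add_le_add d1 d2).trans ?_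
    have d3 : C * ‖v‖ * (h * ((C * C * C * h + C * η) * ‖p‖)) +
        h * (‖p‖ * (C * ((η * D + C * (h * D)) * ‖τ‖)) + C * (D * ‖τ‖ * (2 * C * h)) * ‖p‖)
        = h * ‖p‖ * (C * (C * C * C * h + C * η) * ‖v‖
          + (C * (η * D + C * (h * D)) + C * (D * (2 * C * h))) * ‖τ‖) := by ring
    have d4 : C * (C * C * C * h + C * η) * ‖v‖
          + (C * (η * D + C * (h * D)) + C * (D * (2 * C * h))) * ‖τ‖
        ≤ C * (C * C * C * η + C * η) * ‖v‖
          + (C * (η * D + C * (η * D)) + C * (D * (2 * C * η))) * ‖v‖ := by gcongr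
    have d5 : C * (C * C * C * η + C * η) * ‖v‖
          + (C * (η * D + C * (η * D)) + C * (D * (2 * C * η))) * ‖v‖ ≤ ε * ‖v‖ := by
      rw [← add_mul]
      refine mul_le_mul_of_nonneg_right ?_ (norm_nonneg _)
      have e1 : Q * η = ε / 2 := by rw [hη]; field_simp
      have e2 : C * (C * C * C * η + C * η) ≤ C ^ 2 * (C * C * C + C) * η := by
        have : C * (C * C * C + C) * η ≤ C ^ 2 * (C * C * C + C) * η := by
          gcongr; nlinarith
        linarith
      have e3 : Q * η = C * (D + C * D + D * (2 * C)) * η + C ^ 2 * (C * C * C + C) * η := by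
        rw [hQ]; ring
      linarith
    rw [d3]
    have := mul_le_mul_of_nonneg_left (d4.trans d5) (show 0 ≤ h * ‖p‖ by positivity)
    linarith
  set w := p - S.tanProj x l + h • S.adjMatrix x u p with hw
  have hk := key w
  rw [real_inner_self_eq_norm_sq, abs_of_nonneg (sq_nonneg _), sq] at hk
  rcases (norm_nonneg w).eq_or_lt with h0 | h0
  · rw [← h0]; positivity
  · exact le_of_mul_le_mul_right hk h0

end

noncomputable section

variable {d m s : ℕ}

/-! ### Convergence before the transition, and of the transition time -/

/-- A discrete trajectory with step sizes at most `δ` whose slopes are bounded by `M`. -/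
structure IsFineRun (S : HybridSystem d m) (T : RKTableau s) (u1 u2 : ℝ → Control m)
    (t0 tf : ℝ) (x0 : State d) (M δ : ℝ) (D : DiscreteRun d m s) : Prop where
  sol : D.IsSolution S T u1 u2 t0 tf x0
  h_le : ∀ k < D.K, D.h k ≤ δ
  bound1 : ∀ k < D.kt, ∀ i, ‖S.f1 (D.xs (k + 1) i) (D.u k)‖ ≤ M
  bound1x : ∀ k < D.kt, ∀ i, ‖S.f1x (D.xs (k + 1) i) (D.u k)‖ ≤ M
  bound2 : ∀ k, D.kt ≤ k → k < D.K → ∀ i, ‖S.f2 (D.xs (k + 1) i) (D.zs (k + 1) i) (D.u k)‖ ≤ M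

theorem PiecewiseControl.exists_bound {u : ℝ → Control m} {a b : ℝ} {B : Finset ℝ}
    (hu : PiecewiseControl u a b B) : ∃ V, 0 ≤ V ∧ ∀ t ∈ Icc a b, ‖u t‖ ≤ V := by
  obtain ⟨V, hV⟩ := hu.bounded.exists_norm_le
  exact ⟨max V 0, le_max_right _ _, fun t ht => (hV _ (mem_image_of_mem u ht)).trans
    (le_max_left _ _)⟩

theorem PiecewiseControl.exists_norm_sub_le {u : ℝ → Control m} {a b t : ℝ} {B : Finset ℝ}
    (hu : PiecewiseControl u a b B) (ht : t ∈ Ioo a b) (htB : t ∉ B) {ε : ℝ} (hε : 0 < ε) :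
    ∃ η > 0, ∀ r, |r - t| ≤ η → ‖u r - u t‖ ≤ ε := by
  have h1 : Icc a b \ (B : Set ℝ) ∈ 𝓝 t :=
    inter_mem (Icc_mem_nhds ht.1 ht.2) (B.finite_toSet.isClosed.isOpen_compl.mem_nhds htB)
  have h2 : ContinuousAt u t := hu.cont.continuousAt h1
  obtain ⟨η, hη, h⟩ := Metric.continuousAt_iff.mp h2 ε hε
  refine ⟨η / 2, by positivity, fun r hr => ?_⟩
  have := h (x := r) (by rw [Real.dist_eq]; linarith)
  rw [dist_eq_norm] at this
  exact this.le

namespace IsFineRun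

variable {S : HybridSystem d m} {T : RKTableau s} {u1 u2 : ℝ → Control m}
    {t0 tf : ℝ} {x0 : State d} {M δ : ℝ} {D : DiscreteRun d m s}

theorem mono (hD : IsFineRun S T u1 u2 t0 tf x0 M δ D) {δ' : ℝ} (h : δ ≤ δ') :
    IsFineRun S T u1 u2 t0 tf x0 M δ' D :=
  ⟨hD.sol, fun k hk => (hD.h_le k hk).trans h, hD.bound1, hD.bound1x, hD.bound2⟩

theorem time_step (hD : IsFineRun S T u1 u2 t0 tf x0 M δ D) {k : ℕ} (hk : k < D.K) :
    D.time t0 k ≤ D.time t0 (k + 1) ∧ D.time t0 (k + 1) ≤ D.time t0 k + δ := by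
  rw [DiscreteRun.time_succ]
  exact ⟨by linarith [hD.sol.h_pos k hk], by linarith [hD.h_le k hk]⟩

variable {C : ℝ}

theorem norm_stage_sub_le (hD : IsFineRun S T u1 u2 t0 tf x0 M δ D)
    (hA : ∀ i (v : Fin s → State d) (β : ℝ), (∀ j, ‖v j‖ ≤ β) → ‖∑ j, T.A i j • v j‖ ≤ C * β)
    {k : ℕ} (hk : k < D.K) (i : Fin s) : ‖D.xs (k + 1) i - D.x k‖ ≤ C * M * D.h k := by
  have hh := hD.sol.h_pos k hk
  rcases lt_or_ge k D.kt with h | h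
  · rw [hD.sol.stage1 h i, add_sub_cancel_left, norm_smul, Real.norm_of_nonneg hh.le, mul_comm]
    exact mul_le_mul_of_nonneg_right (hA i _ M (hD.bound1 k h)) hh.le
  · rw [hD.sol.stage2 h hk i, add_sub_cancel_left, norm_smul, Real.norm_of_nonneg hh.le, mul_comm]
    exact mul_le_mul_of_nonneg_right (hA i _ M (hD.bound2 k h hk)) hh.le

theorem norm_step_le (hD : IsFineRun S T u1 u2 t0 tf x0 M δ D)
    (hA : ∀ i (v : Fin s → State d) (β : ℝ), (∀ j, ‖v j‖ ≤ β) → ‖∑ j, T.A i j • v j‖ ≤ C * β)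
    {r : Fin s} (hr : ∀ j, T.A r j = T.b j)
    {k : ℕ} (hk : k < D.K) : ‖D.x (k + 1) - D.x k‖ ≤ C * M * D.h k := by
  have h1 : D.x (k + 1) = D.xs (k + 1) r := by
    rcases lt_or_ge k D.kt with h | h
    · rw [hD.sol.next1 h, hD.sol.stage1 h r]; simp_rw [hr]
    · exact hD.sol.next2_eq_stage hr h hk
  rw [h1]
  exact hD.norm_stage_sub_le hA hk r

theorem norm_sub_le (hD : IsFineRun S T u1 u2 t0 tf x0 M δ D)
    (hA : ∀ i (v : Fin s → State d) (β : ℝ), (∀ j, ‖v j‖ ≤ β) → ‖∑ j, T.A i j • v j‖ ≤ C * β)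
    {r : Fin s} (hr : ∀ j, T.A r j = T.b j)
    {j k : ℕ} (hjk : j ≤ k) (hk : k ≤ D.K) :
    ‖D.x k - D.x j‖ ≤ C * M * (D.time t0 k - D.time t0 j) := by
  induction k, hjk using Nat.le_induction with
  | base => simp
  | succ k hjk ih =>
    have h1 := ih (by omega)
    have h2 := hD.norm_step_le hA hr (k := k) (by omega)
    have h3 := norm_add_le (D.x (k + 1) - D.x k) (D.x k - D.x j)
    rw [sub_add_sub_cancel] at h3
    rw [DiscreteRun.time_succ]
    linarith

end IsFineRun

section Phase1

variable {S : HybridSystem d m} {T : RKTableau s} {u1 u2 : ℝ → Control m} {B : Finset ℝ}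
  {t0 tt tf : ℝ} {x : ℝ → State d} {z : ℝ → ℝ}

theorem IsHybridTrajectory.cont_left (hx : IsHybridTrajectory S u1 u2 B t0 tt tf x z) :
    ContinuousOn x (Icc t0 tt) := hx.cont.mono (Icc_subset_Icc le_rfl hx.lt_final.le)

theorem IsHybridTrajectory.cont_right (hx : IsHybridTrajectory S u1 u2 B t0 tt tf x z) :
    ContinuousOn x (Icc tt tf) := hx.cont.mono (Icc_subset_Icc hx.start_lt.le le_rfl)

/-- The discrete states converge uniformly to the trajectory as long as neither has entered
the sliding mode. -/
theorem exists_phase1_convergence (hS : S.Smooth) (hT : T.StifflyAccurate)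
    (hu1 : PiecewiseControl u1 t0 tf B)
    (hx : IsHybridTrajectory S u1 u2 B t0 tt tf x z) {M : ℝ} (hM : 0 ≤ M)
    {ε : ℝ} (hε : 0 < ε) :
    ∃ δ > 0, ∀ D : DiscreteRun d m s, IsFineRun S T u1 u2 t0 tf (x t0) M δ D →
      ∀ k ≤ D.kt, D.time t0 k ≤ tt → ‖D.x k - x (D.time t0 k)‖ ≤ ε := by
  obtain ⟨C, hC, hA, -⟩ := hT.exists_bounds (State d)
  obtain ⟨r, hr⟩ := hT.row
  have hC0 : 0 < C := by linarith
  obtain ⟨V, hV0, hV⟩ := hu1.exists_bound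
  obtain ⟨R, hR0, hR⟩ := isCompact_Icc.exists_norm_le_of_continuousOn hx.cont_left
  set N : Set (State d) := Metric.closedBall 0 (R + 2) with hN
  set W : Set (Control m) := Metric.closedBall 0 V with hW
  have hNW : IsCompact (N ×ˢ W) := (isCompact_closedBall _ _).prod (isCompact_closedBall _ _)
  obtain ⟨L, hL⟩ := hS.f1.contDiffOn.exists_lipschitzOnWith one_ne_zero
    ((convex_closedBall (0 : State d) (R + 2)).prod (convex_closedBall (0 : Control m) V)) hNW
  obtain ⟨Cv, hCv0, hCv⟩ := hNW.exists_norm_le_of_continuousOn hS.continuous_f1.continuousOn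
  have hL0 : (0 : ℝ) ≤ L := L.2
  have hu1' : ∀ t ∈ Icc t0 tt, u1 t ∈ W := fun t ht => by
    simpa [hW] using hV t ⟨ht.1, ht.2.trans hx.lt_final.le⟩
  obtain ⟨δ, hδ, H⟩ := exists_forward_convergence (y := x) (v := fun t => S.f1 (x t) (u1 t))
    (c := t0) (a := t0) (b := tt) (M := Cv) (L := C * L) (ρ := 1) (B := B) le_rfl hx.start_lt.le
    hx.cont_left
    (fun t ht htB => (hx.ode t (Ioo_subset_Icc_self ht) htB).hasDerivAt
      (Icc_mem_nhds ht.1 ht.2))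
    (fun t ht => hCv (x t, u1 t) ⟨by simp only [hN, mem_closedBall_zero_iff]; linarith [hR t ht],
      hu1' t ht⟩)
    (hS.continuous_f1.comp_continuousOn ((hx.cont_left.mono sdiff_subset).prodMk
      (hu1.cont.mono (sdiff_subset_sdiff_left (Icc_subset_Icc le_rfl hx.lt_final.le)))))
    (by positivity) one_pos hε
  set δ' := min δ (min (1 / (C * M + 1)) (δ / (C * L * (C * M) + 1))) with hδ'
  have hδ'0 : 0 < δ' := lt_min hδ (lt_min (by positivity) (by positivity))
  refine ⟨δ', hδ'0, fun D hD k hk hkt => ?_⟩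
  have hkK : k ≤ D.K := hk.trans hD.sol.kt_lt.le
  have htime0 : D.time t0 0 = t0 := by simp [DiscreteRun.time]
  have hmem : ∀ j ≤ k, D.time t0 j ∈ Icc t0 tt := fun j hj =>
    ⟨(hD.sol.time_mem (hj.trans hkK)).1, (hD.sol.time_mono hj hkK).trans hkt⟩
  have hmax : ∀ j ≤ k, max t0 (D.time t0 j) = D.time t0 j := fun j hj =>
    max_eq_right (hmem j hj).1
  have := H (D.time t0) 0 k (Nat.zero_le k) (fun j _ hj => ?_) (by rw [htime0])
    (by rw [htime0]; linarith) hkt D.x (by rw [htime0, max_self, hD.sol.init]; simpa using hδ.le)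
    (fun j _ hj hjρ => ?_) k (Nat.zero_le k) le_rfl
  · rwa [hmax k le_rfl] at this
  · obtain ⟨e1, e2⟩ := hD.time_step (k := j) (by omega)
    exact ⟨e1, e2.trans (by linarith [min_le_left δ (min (1 / (C * M + 1))
      (δ / (C * L * (C * M) + 1)))])⟩
  · rw [hmax j hj.le] at hjρ ⊢
    have hjt : j < D.kt := by omega
    have hh := hD.sol.h_pos j (by omega)
    have hhδ := hD.h_le j (by omega)
    have hh1 : C * M * D.h j ≤ 1 := by
      have : D.h j ≤ 1 / (C * M + 1) := hhδ.trans ((min_le_right _ _).trans (min_le_left _ _))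
      rw [le_div_iff₀ (by positivity)] at this
      nlinarith
    have hh2 : C * L * (C * M * D.h j) ≤ δ := by
      have : D.h j ≤ δ / (C * L * (C * M) + 1) :=
        hhδ.trans ((min_le_right _ _).trans (min_le_right _ _))
      rw [le_div_iff₀ (by positivity)] at this
      nlinarith
    have huj : D.u j = u1 (D.time t0 j) := hD.sol.control1 j hjt
    have hxt := hR _ (hmem j hj.le)
    have hst := hD.norm_stage_sub_le hA (k := j) (by omega)
    rw [DiscreteRun.time_succ, add_sub_cancel_left, hD.sol.next1 hjt, add_sub_cancel_left,
      ← smul_sub, norm_smul, Real.norm_of_nonneg hh.le]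
    refine mul_le_mul_of_nonneg_left ?_ hh.le
    have e1 : ∑ i, T.b i • S.f1 (D.xs (j + 1) i) (D.u j) - S.f1 (x (D.time t0 j))
        (u1 (D.time t0 j)) = ∑ i, T.A r i • (S.f1 (D.xs (j + 1) i) (D.u j)
          - S.f1 (x (D.time t0 j)) (u1 (D.time t0 j))) := by
      simp only [smul_sub, Finset.sum_sub_distrib, ← Finset.sum_smul]
      simp_rw [hr]
      rw [hT.sum_b, one_smul]
    rw [e1]
    refine (hA r _ (L * (C * M * D.h j + ‖D.x j - x (D.time t0 j)‖)) fun i => ?_).trans ?_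
    · rw [huj]
      have e3 := norm_add_le (D.xs (j + 1) i - D.x j) (D.x j - x (D.time t0 j))
      rw [sub_add_sub_cancel] at e3
      have e4 := norm_add_le (D.xs (j + 1) i - x (D.time t0 j)) (x (D.time t0 j))
      rw [sub_add_cancel] at e4
      have e5 := hL.norm_sub_le (x := (D.xs (j + 1) i, u1 (D.time t0 j)))
        (y := (x (D.time t0 j), u1 (D.time t0 j)))
        ⟨by simp only [mem_closedBall_zero_iff]; linarith [hst i], hu1' _ (hmem j hj.le)⟩
        ⟨by simp only [mem_closedBall_zero_iff]; linarith, hu1' _ (hmem j hj.le)⟩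
      simp only [Prod.mk_sub_mk, sub_self, Prod.norm_mk, norm_zero] at e5
      rw [max_eq_left (norm_nonneg _)] at e5
      exact e5.trans (mul_le_mul_of_nonneg_left (e3.trans (by linarith [hst i])) hL0)
    · linarith

theorem ContinuousOn.exists_norm_sub_le_of_Icc {E : Type*} [NormedAddCommGroup E] {y : ℝ → E}
    {a b t : ℝ}
    (hy : ContinuousOn y (Icc a b)) (ht : t ∈ Icc a b) {ε : ℝ} (hε : 0 < ε) :
    ∃ η > 0, ∀ r ∈ Icc a b, |r - t| ≤ η → ‖y r - y t‖ ≤ ε := by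
  obtain ⟨η, hη, h⟩ := Metric.continuousWithinAt_iff.mp (hy t ht) ε hε
  refine ⟨η / 2, by positivity, fun r hr hrt => ?_⟩
  have := h hr (by rw [Real.dist_eq]; linarith)
  rw [dist_eq_norm] at this
  exact this.le

/-- Before the sliding phase, discrete states at times close to the transition time are close to
the transition state, even at times after the transition time. -/
theorem exists_near_transition (hS : S.Smooth) (hT : T.StifflyAccurate)
    (hu1 : PiecewiseControl u1 t0 tf B)
    (hx : IsHybridTrajectory S u1 u2 B t0 tt tf x z) {M : ℝ} (hM : 0 ≤ M)
    {ε : ℝ} (hε : 0 < ε) :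
    ∃ η > 0, ∀ D : DiscreteRun d m s, IsFineRun S T u1 u2 t0 tf (x t0) M η D →
      ∀ k ≤ D.kt, |D.time t0 k - tt| ≤ η → ‖D.x k - x tt‖ ≤ ε := by
  obtain ⟨C, hC, hA, -⟩ := hT.exists_bounds (State d)
  obtain ⟨r, hr⟩ := hT.row
  have hC0 : 0 < C := by linarith
  obtain ⟨δ₁, hδ₁, h1⟩ := exists_phase1_convergence (u2 := u2) hS hT hu1 hx hM
    (show 0 < ε / 3 by positivity)
  obtain ⟨η₁, hη₁, h2⟩ := hx.cont_left.exists_norm_sub_le_of_Icc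
    (right_mem_Icc.mpr hx.start_lt.le) (show 0 < ε / 3 by positivity)
  refine ⟨min (min δ₁ η₁) (ε / (6 * (C * M + 1))), lt_min (lt_min hδ₁ hη₁) (by positivity),
    fun D hD k hk hkt => ?_⟩
  set η := min (min δ₁ η₁) (ε / (6 * (C * M + 1))) with hη
  have hηδ : η ≤ δ₁ := (min_le_left _ _).trans (min_le_left _ _)
  have hηη : η ≤ η₁ := (min_le_left _ _).trans (min_le_right _ _)
  have hηε : C * M * (2 * η) ≤ ε / 3 := by
    have : η ≤ ε / (6 * (C * M + 1)) := min_le_right _ _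
    rw [le_div_iff₀ (by positivity)] at this
    have h0 : 0 ≤ C * M := by positivity
    have h0' : 0 ≤ η := (abs_nonneg _).trans hkt
    nlinarith
  have hkK : k ≤ D.K := hk.trans hD.sol.kt_lt.le
  have htime0 : D.time t0 0 = t0 := by simp [DiscreteRun.time]
  -- `j` is the last step up to `k` that is not after the transition time
  set j := Nat.findGreatest (fun j => D.time t0 j ≤ tt) k with hj
  have hjk : j ≤ k := Nat.findGreatest_le k
  have hjt : D.time t0 j ≤ tt :=
    Nat.findGreatest_spec (P := fun j => D.time t0 j ≤ tt) (Nat.zero_le k)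
      (by rw [htime0]; exact hx.start_lt.le)
  have hj1 : tt - η ≤ D.time t0 j := by
    rcases hjk.eq_or_lt with h | h
    · rw [h]; linarith [(abs_le.mp hkt).1]
    · have e1 : ¬ D.time t0 (j + 1) ≤ tt :=
        Nat.findGreatest_is_greatest (P := fun j => D.time t0 j ≤ tt) (Nat.lt_succ_self j) h
      linarith [(hD.time_step (k := j) (by omega)).2]
  have a1 := (hD.mono hηδ) |> fun h => h1 D h j (hjk.trans hk) hjt
  have a2 := h2 (D.time t0 j) ⟨(hD.sol.time_mem (hjk.trans hkK)).1, hjt⟩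
    (by rw [abs_of_nonpos (by linarith)]; linarith)
  have a3 := hD.norm_sub_le hA hr hjk hkK
  have a4 : C * M * (D.time t0 k - D.time t0 j) ≤ C * M * (2 * η) :=
    mul_le_mul_of_nonneg_left (by linarith [(abs_le.mp hkt).2]) (by positivity)
  have e : D.x k - x tt = (D.x k - D.x j) + (D.x j - x (D.time t0 j))
      + (x (D.time t0 j) - x tt) := by abel
  rw [e]
  refine norm_add₃_le.trans ?_
  linarith

end Phase1

end

noncomputable section

variable {d m s : ℕ}

section Transition

variable {S : HybridSystem d m} {T : RKTableau s} {u1 u2 : ℝ → Control m} {B : Finset ℝ}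
  {t0 tt tf : ℝ} {x : ℝ → State d} {z : ℝ → ℝ}

/-- The discrete transition is not early, because `g` is bounded away from zero on the
trajectory before the transition. -/
theorem exists_transition_lower (hS : S.Smooth) (hT : T.StifflyAccurate)
    (hu1 : PiecewiseControl u1 t0 tf B)
    (hx : IsHybridTrajectory S u1 u2 B t0 tt tf x z) {M : ℝ} (hM : 0 ≤ M)
    {η : ℝ} (hη : 0 < η) :
    ∃ δ > 0, ∀ D : DiscreteRun d m s, IsFineRun S T u1 u2 t0 tf (x t0) M δ D →
      tt - η ≤ D.time t0 D.kt := by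
  rcases lt_or_ge (tt - η) t0 with h0 | h0
  · exact ⟨1, one_pos, fun D hD => h0.le.trans (hD.sol.time_mem hD.sol.kt_lt.le).1⟩
  have hc : ContinuousOn x (Icc t0 (tt - η)) :=
    hx.cont_left.mono (Icc_subset_Icc le_rfl (by linarith))
  obtain ⟨c, hc0, hcg⟩ := isCompact_Icc.exists_norm_le_of_continuousOn
    (f := fun t => (S.g (x t))⁻¹) ((hS.continuous_g.comp_continuousOn hc).inv₀
      fun t ht => hx.before t ⟨ht.1, ht.2.trans_lt (by linarith)⟩)
  obtain ⟨ε, hε, hg⟩ := (isCompact_Icc.image_of_continuousOn hc).exists_forall_dist_le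
    (f := S.g) (fun _ _ => hS.continuous_g.continuousAt) (show 0 < 1 / (2 * (c + 1)) by positivity)
  obtain ⟨δ, hδ, h1⟩ := exists_phase1_convergence (u2 := u2) hS hT hu1 hx hM
    (show 0 < ε / 2 by positivity)
  refine ⟨δ, hδ, fun D hD => ?_⟩
  by_contra! hlt
  have hmem : D.time t0 D.kt ∈ Icc t0 (tt - η) :=
    ⟨(hD.sol.time_mem hD.sol.kt_lt.le).1, hlt.le⟩
  have a1 := h1 D hD D.kt le_rfl (by linarith)
  have a2 := hg _ (mem_image_of_mem x hmem) (D.x D.kt)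
    (by rw [dist_comm, dist_eq_norm]; linarith)
  rw [hD.sol.transition, dist_zero_right, Real.norm_eq_abs] at a2
  have a3 := hcg _ hmem
  have a4 : 0 < |S.g (x (D.time t0 D.kt))| :=
    abs_pos.mpr (hx.before _ ⟨hmem.1, hlt.trans (by linarith)⟩)
  rw [norm_inv, Real.norm_eq_abs, inv_le_iff_one_le_mul₀ a4] at a3
  have a5 : c * |S.g (x (D.time t0 D.kt))| ≤ c * (1 / (2 * (c + 1))) :=
    mul_le_mul_of_nonneg_left a2 hc0
  have a6 : c * (1 / (2 * (c + 1))) < 1 := by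
    rw [mul_one_div, div_lt_one (by positivity)]; linarith
  linarith

/-- At the transition the trajectory crosses the switching surface transversally, in the direction
opposite to the initial sign of `g`. -/
theorem IsHybridTrajectory.crossing_neg (hS : S.Smooth)
    (hx : IsHybridTrajectory S u1 u2 B t0 tt tf x z) (httB : tt ∉ B)
    (hreg : fderiv ℝ S.g (x tt) (S.f1 (x tt) (u1 tt)) ≠ 0) :
    S.g (x t0) * inner ℝ (S.gxT (x tt)) (S.f1 (x tt) (u1 tt)) < 0 := by
  rw [S.inner_gxT hS]
  have hpos : ∀ t ∈ Ico t0 tt, 0 < S.g (x t0) * S.g (x t) := by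
    intro t ht
    have hne0 : S.g (x t0) ≠ 0 := hx.before t0 ⟨le_rfl, hx.start_lt⟩
    by_contra! hneg
    have hcont : ContinuousOn (fun r => S.g (x t0) * S.g (x r)) (Icc t0 t) :=
      continuousOn_const.mul (hS.continuous_g.comp_continuousOn
        (hx.cont_left.mono (Icc_subset_Icc le_rfl ht.2.le)))
    have h0 : (0 : ℝ) ∈ Icc (S.g (x t0) * S.g (x t)) (S.g (x t0) * S.g (x t0)) :=
      ⟨hneg, mul_self_nonneg _⟩
    obtain ⟨r, hr, hr0⟩ := intermediate_value_Icc' ht.1 hcont h0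
    exact (mul_ne_zero hne0 (hx.before r ⟨hr.1, hr.2.trans_lt ht.2⟩)) hr0
  have hder : HasDerivWithinAt (fun t => S.g (x t0) * S.g (x t))
      (S.g (x t0) * fderiv ℝ S.g (x tt) (S.f1 (x tt) (u1 tt))) (Icc t0 tt) tt :=
    (((hS.g.differentiable two_ne_zero) (x tt)).hasFDerivAt.comp_hasDerivWithinAt tt
      (hx.ode tt (right_mem_Icc.mpr hx.start_lt.le) httB)).const_mul _
  have h0 : S.g (x tt) = 0 := hx.dae_alg tt (left_mem_Icc.mpr hx.lt_final.le)
  refine lt_of_le_of_ne ?_ (mul_ne_zero (hx.before t0 ⟨le_rfl, hx.start_lt⟩) hreg)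
  have hs := hasDerivWithinAt_iff_tendsto_slope.mp hder
  have hset : Icc t0 tt \ {tt} = Ico t0 tt := Icc_sdiff_right
  rw [hset] at hs
  have : (𝓝[Ico t0 tt] tt).NeBot := by
    rw [← mem_closure_iff_nhdsWithin_neBot, closure_Ico hx.start_lt.ne]
    exact right_mem_Icc.mpr hx.start_lt.le
  refine le_of_tendsto hs ?_
  filter_upwards [self_mem_nhdsWithin] with t ht
  rw [slope_def_field, h0, mul_zero]
  exact div_nonpos_of_nonneg_of_nonpos (by linarith [hpos t ht]) (by linarith [ht.2])

/-- Close to the transition, the increments of `g` along a step of the first phase have the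
direction of the crossing. -/
theorem exists_g_step_le (hS : S.Smooth) (hT : T.StifflyAccurate)
    (hu1 : PiecewiseControl u1 t0 tf B)
    (hx : IsHybridTrajectory S u1 u2 B t0 tt tf x z) (httB : tt ∉ B)
    {M : ℝ} (hM : 0 ≤ M) {σ : ℝ}
    (hσ : σ * inner ℝ (S.gxT (x tt)) (S.f1 (x tt) (u1 tt)) < 0) :
    ∃ c > 0, ∃ η > 0, ∀ D : DiscreteRun d m s, IsFineRun S T u1 u2 t0 tf (x t0) M η D →
      ∀ k < D.kt, |D.time t0 k - tt| ≤ η →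
        σ * (S.g (D.x (k + 1)) - S.g (D.x k)) ≤ -c * D.h k := by
  obtain ⟨C, hC, hA, -⟩ := hT.exists_bounds (State d)
  obtain ⟨r, hr⟩ := hT.row
  have hC0 : 0 < C := by linarith
  set G := S.gxT (x tt) with hG
  set F := S.f1 (x tt) (u1 tt) with hF
  set c := -(σ * inner ℝ G F) / 3 with hc
  have hc0 : 0 < c := by rw [hc]; linarith
  have hσ0 : 0 < |σ| := abs_pos.mpr fun h => by simp [h] at hσ
  -- strict differentiability of `g` at the transition state
  have hstrict := (hS.g.contDiffAt (x := x tt)).hasStrictFDerivAt two_ne_zero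
  set ε₁ := c / (|σ| * (C * M + 1)) with hε₁
  have hε₁0 : 0 < ε₁ := by positivity
  obtain ⟨ρ₁, hρ₁, hg⟩ := Metric.eventually_nhds_iff.mp (hstrict.isLittleO.def hε₁0)
  set ε₂ := c / (|σ| * (C * (‖G‖ + 1))) with hε₂
  have hε₂0 : 0 < ε₂ := by positivity
  obtain ⟨ρ₂, hρ₂, hf⟩ := Metric.continuousAt_iff.mp
    (hS.continuous_f1.continuousAt (x := (x tt, u1 tt))) ε₂ hε₂0
  obtain ⟨η₁, hη₁, h1⟩ := exists_near_transition (u2 := u2) hS hT hu1 hx hM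
    (show 0 < min ρ₁ ρ₂ / 3 by positivity)
  obtain ⟨η₂, hη₂, h2⟩ := hu1.exists_norm_sub_le (ε := ρ₂ / 2) ⟨hx.start_lt, hx.lt_final⟩ httB
    (by positivity)
  set η := min (min η₁ η₂) (min ρ₁ ρ₂ / (3 * (C * M + 1))) with hη
  refine ⟨c, hc0, η, lt_min (lt_min hη₁ hη₂) (by positivity), fun D hD k hk hkt => ?_⟩
  have hkK : k < D.K := hk.trans hD.sol.kt_lt
  have hh := hD.sol.h_pos k hkK
  have hhC : C * M * D.h k ≤ min ρ₁ ρ₂ / 3 := by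
    have : D.h k ≤ min ρ₁ ρ₂ / (3 * (C * M + 1)) := (hD.h_le k hkK).trans (min_le_right _ _)
    rw [le_div_iff₀ (by positivity)] at this
    have h0 : 0 ≤ C * M := by positivity
    nlinarith
  have hηη₁ : η ≤ η₁ := (min_le_left _ _).trans (min_le_left _ _)
  have hηη₂ : η ≤ η₂ := (min_le_left _ _).trans (min_le_right _ _)
  have a1 := h1 D (hD.mono hηη₁) k hk.le (hkt.trans hηη₁)
  have a2 := h2 _ (hkt.trans hηη₂)
  have hm1 : min ρ₁ ρ₂ ≤ ρ₁ := min_le_left _ _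
  have hm2 : min ρ₁ ρ₂ ≤ ρ₂ := min_le_right _ _
  have hm0 : 0 < min ρ₁ ρ₂ := lt_min hρ₁ hρ₂
  have hnext := hD.norm_step_le hA hr hkK
  have hd1 : ‖D.x (k + 1) - x tt‖ < ρ₁ := by
    have := norm_add_le (D.x (k + 1) - D.x k) (D.x k - x tt)
    rw [sub_add_sub_cancel] at this
    linarith
  have hd2 : ∀ i, ‖D.xs (k + 1) i - x tt‖ < ρ₂ := fun i => by
    have := norm_add_le (D.xs (k + 1) i - D.x k) (D.x k - x tt)
    rw [sub_add_sub_cancel] at this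
    linarith [hD.norm_stage_sub_le hA hkK i]
  have b1 := hg (y := (D.x (k + 1), D.x k)) (by
    rw [Prod.dist_eq, max_lt_iff, dist_eq_norm, dist_eq_norm]
    exact ⟨hd1, by linarith⟩)
  have b2 : ‖∑ i, T.A r i • (S.f1 (D.xs (k + 1) i) (D.u k) - F)‖ ≤ C * ε₂ := by
    refine hA r _ _ fun i => ?_
    have := hf (x := (D.xs (k + 1) i, D.u k)) (by
      rw [Prod.dist_eq, max_lt_iff, dist_eq_norm, dist_eq_norm]
      refine ⟨hd2 i, ?_⟩
      rw [hD.sol.control1 k hk]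
      exact a2.trans_lt (by linarith))
    rw [dist_eq_norm] at this
    exact this.le
  have b3 : D.x (k + 1) - D.x k
      = D.h k • (F + ∑ i, T.A r i • (S.f1 (D.xs (k + 1) i) (D.u k) - F)) := by
    rw [hD.sol.next1 hk, add_sub_cancel_left]
    congr 1
    simp only [smul_sub, Finset.sum_sub_distrib, ← Finset.sum_smul]
    simp_rw [hr]
    rw [hT.sum_b, one_smul]
    abel
  have b4 : fderiv ℝ S.g (x tt) (D.x (k + 1) - D.x k) = D.h k * (inner ℝ G F
      + inner ℝ G (∑ i, T.A r i • (S.f1 (D.xs (k + 1) i) (D.u k) - F))) := by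
    rw [← S.inner_gxT hS, b3, inner_smul_right, inner_add_right]
  have b5 : |inner ℝ G (∑ i, T.A r i • (S.f1 (D.xs (k + 1) i) (D.u k) - F))| ≤ c / |σ| := by
    refine (abs_real_inner_le_norm _ _).trans
      ((mul_le_mul_of_nonneg_left b2 (norm_nonneg _)).trans ?_)
    rw [hε₂, le_div_iff₀ hσ0]
    have : ‖G‖ * (C * (c / (|σ| * (C * (‖G‖ + 1))))) * |σ| = c * (‖G‖ / (‖G‖ + 1)) := by
      field_simp
    rw [this]
    have : ‖G‖ / (‖G‖ + 1) ≤ 1 := by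
      rw [div_le_one (by positivity)]; linarith
    nlinarith
  have b6 : |S.g (D.x (k + 1)) - S.g (D.x k) - fderiv ℝ S.g (x tt) (D.x (k + 1) - D.x k)|
      ≤ c / |σ| * D.h k := by
    refine (b1.trans (mul_le_mul_of_nonneg_left hnext hε₁0.le)).trans ?_
    have e1 : ε₁ * (C * M * D.h k) = c / |σ| * D.h k * (C * M / (C * M + 1)) := by
      rw [hε₁]; field_simp
    rw [e1]
    refine mul_le_of_le_one_right (by positivity) ?_
    rw [div_le_one (by positivity)]; linarith
  have b7 : σ * (S.g (D.x (k + 1)) - S.g (D.x k)) = D.h k * (σ * inner ℝ G F)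
      + D.h k * (σ * inner ℝ G (∑ i, T.A r i • (S.f1 (D.xs (k + 1) i) (D.u k) - F)))
      + σ * (S.g (D.x (k + 1)) - S.g (D.x k) - fderiv ℝ S.g (x tt) (D.x (k + 1) - D.x k)) := by
    rw [b4]; ring
  have b8 : σ * inner ℝ G (∑ i, T.A r i • (S.f1 (D.xs (k + 1) i) (D.u k) - F)) ≤ c := by
    refine (le_abs_self _).trans ?_
    rw [abs_mul]
    refine (mul_le_mul_of_nonneg_left b5 hσ0.le).trans (le_of_eq ?_)
    field_simp
  have b9 : σ * (S.g (D.x (k + 1)) - S.g (D.x k) - fderiv ℝ S.g (x tt) (D.x (k + 1) - D.x k))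
      ≤ c * D.h k := by
    refine (le_abs_self _).trans ?_
    rw [abs_mul]
    refine (mul_le_mul_of_nonneg_left b6 hσ0.le).trans (le_of_eq ?_)
    field_simp
  rw [b7]
  have b10 := mul_le_mul_of_nonneg_left b8 hh.le
  have b11 : σ * inner ℝ G F = -(3 * c) := by rw [hc]; ring
  rw [b11]
  linarith

/-- The discrete transition is not late, because `g` would change its sign along the discrete
states. -/
theorem exists_transition_upper (hS : S.Smooth) (hT : T.StifflyAccurate)
    (hu1 : PiecewiseControl u1 t0 tf B)
    (hx : IsHybridTrajectory S u1 u2 B t0 tt tf x z) (httB : tt ∉ B)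
    (hreg : fderiv ℝ S.g (x tt) (S.f1 (x tt) (u1 tt)) ≠ 0) {M : ℝ} (hM : 0 ≤ M)
    {η : ℝ} (hη : 0 < η) :
    ∃ δ > 0, ∀ D : DiscreteRun d m s, IsFineRun S T u1 u2 t0 tf (x t0) M δ D →
      D.time t0 D.kt ≤ tt + η := by
  obtain ⟨c, hc, η₁, hη₁, hstep⟩ := exists_g_step_le (u2 := u2) hS hT hu1 hx httB hM
    (hx.crossing_neg hS httB hreg)
  set σ := S.g (x t0) with hσ
  set η₂ := min η η₁ with hη₂
  have hη₂0 : 0 < η₂ := lt_min hη hη₁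
  have h0 : S.g (x tt) = 0 := hx.dae_alg tt (left_mem_Icc.mpr hx.lt_final.le)
  obtain ⟨ρ, hρ, hg⟩ := Metric.continuousAt_iff.mp
    (hS.continuous_g.continuousAt (x := x tt)) (c * η₂ / (4 * (|σ| + 1))) (by positivity)
  obtain ⟨η₃, hη₃, hnear⟩ := exists_near_transition (u2 := u2) hS hT hu1 hx hM
    (show 0 < ρ / 2 by positivity)
  refine ⟨min η₂ (min (η₂ / 4) η₃), lt_min hη₂0 (by positivity), fun D hD => ?_⟩
  set δ := min η₂ (min (η₂ / 4) η₃) with hδ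
  have hδ1 : δ ≤ η₁ := (min_le_left _ _).trans (min_le_right _ _)
  have hδ2 : δ ≤ η₂ / 4 := (min_le_right _ _).trans (min_le_left _ _)
  have hδ3 : δ ≤ η₃ := (min_le_right _ _).trans (min_le_right _ _)
  by_contra! hlt
  have htime0 : D.time t0 0 = t0 := by simp [DiscreteRun.time]
  -- `p` is the first step not before `tt`, `q` is the last step not after `tt + η₂`
  have hex : ∃ k, tt ≤ D.time t0 k := ⟨D.kt, by linarith⟩
  obtain ⟨p, hp⟩ : ∃ p, p = Nat.find hex := ⟨_, rfl⟩
  have hp1 : tt ≤ D.time t0 p := hp ▸ Nat.find_spec hex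
  have hpkt : p ≤ D.kt := hp ▸ Nat.find_min' hex (by linarith)
  have hp2 : D.time t0 p ≤ tt + δ := by
    have hp0 : p ≠ 0 := fun h => by rw [h, htime0] at hp1; linarith [hx.start_lt]
    obtain ⟨j, hj⟩ := Nat.exists_eq_succ_of_ne_zero hp0
    have e1 : ¬ tt ≤ D.time t0 j := Nat.find_min hex (by omega)
    have e2 := (hD.time_step (k := j) (by have := hD.sol.kt_lt; omega)).2
    rw [hj]; simp only [Nat.succ_eq_add_one]; linarith
  obtain ⟨q, hq⟩ : ∃ q, q = Nat.findGreatest (fun k => D.time t0 k ≤ tt + η₂) D.kt := ⟨_, rfl⟩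
  have hqle : D.time t0 q ≤ tt + η₂ := by
    rw [hq]
    exact Nat.findGreatest_spec (P := fun k => D.time t0 k ≤ tt + η₂) (Nat.zero_le _)
      (by rw [htime0]; linarith [hx.start_lt])
  have hpq : p ≤ q := hq ▸ Nat.le_findGreatest hpkt (by linarith)
  have hqkt : q < D.kt := by
    refine lt_of_le_of_ne (hq ▸ Nat.findGreatest_le _) fun h => ?_
    rw [h] at hqle
    linarith [min_le_left η η₁]
  have hq2 : tt + η₂ - δ ≤ D.time t0 q := by
    have e1 : ¬ D.time t0 (q + 1) ≤ tt + η₂ :=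
      Nat.findGreatest_is_greatest (P := fun k => D.time t0 k ≤ tt + η₂)
        (by omega) (Nat.succ_le_of_lt hqkt)
    linarith [(hD.time_step (k := q) (by have := hD.sol.kt_lt; omega)).2]
  have hqK : q ≤ D.K := hqkt.le.trans hD.sol.kt_lt.le
  have hdec : ∀ k, p ≤ k → k ≤ q →
      σ * S.g (D.x k) ≤ σ * S.g (D.x p) - c * (D.time t0 k - D.time t0 p) := by
    intro k hk
    induction k, hk using Nat.le_induction with
    | base => intro _; simp
    | succ k hk ih =>
      intro hkq
      have e1 := ih (by omega)
      have e2 := hD.sol.time_mono (t0 := t0) hk (by omega)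
      have e3 := hD.sol.time_mono (t0 := t0) (show k ≤ q by omega) hqK
      have e4 := hstep D (hD.mono hδ1) k (by omega)
        (by rw [abs_of_nonneg (by linarith)]; linarith [min_le_right η η₁])
      rw [DiscreteRun.time_succ]
      linarith
  have a1 := hnear D (hD.mono hδ3) p hpkt (by rw [abs_of_nonneg (by linarith)]; linarith)
  have a2 := hg (x := D.x p) (by rw [dist_eq_norm]; linarith)
  rw [h0, dist_zero_right, Real.norm_eq_abs] at a2
  have a3 : σ * S.g (D.x p) ≤ c * η₂ / 4 := by
    refine (le_abs_self _).trans ?_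
    rw [abs_mul]
    have e1 : |σ| * |S.g (D.x p)| ≤ |σ| * (c * η₂ / (4 * (|σ| + 1))) :=
      mul_le_mul_of_nonneg_left a2.le (abs_nonneg _)
    have e2 : |σ| * (c * η₂ / (4 * (|σ| + 1))) = c * η₂ / 4 * (|σ| / (|σ| + 1)) := by field_simp
    have e3 : |σ| / (|σ| + 1) ≤ 1 := by rw [div_le_one (by positivity)]; linarith
    have e4 : 0 ≤ c * η₂ / 4 := by positivity
    nlinarith
  have a4 := hdec q hpq le_rfl
  have a5 := hD.sol.no_sign_change q hqkt
  have a6 : c * (η₂ / 2) ≤ c * (D.time t0 q - D.time t0 p) :=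
    mul_le_mul_of_nonneg_left (by linarith) hc.le
  have a7 : 0 < c * η₂ := by positivity
  linarith

/-- Convergence of the discrete transition time. -/
theorem exists_transition_time (hS : S.Smooth) (hT : T.StifflyAccurate)
    (hu1 : PiecewiseControl u1 t0 tf B)
    (hx : IsHybridTrajectory S u1 u2 B t0 tt tf x z) (httB : tt ∉ B)
    (hreg : fderiv ℝ S.g (x tt) (S.f1 (x tt) (u1 tt)) ≠ 0) {M : ℝ} (hM : 0 ≤ M)
    {η : ℝ} (hη : 0 < η) :
    ∃ δ > 0, ∀ D : DiscreteRun d m s, IsFineRun S T u1 u2 t0 tf (x t0) M δ D →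
      |D.time t0 D.kt - tt| ≤ η := by
  obtain ⟨δ₁, hδ₁, h1⟩ := exists_transition_lower (u2 := u2) hS hT hu1 hx hM hη
  obtain ⟨δ₂, hδ₂, h2⟩ := exists_transition_upper (u2 := u2) hS hT hu1 hx httB hreg hM hη
  refine ⟨min δ₁ δ₂, lt_min hδ₁ hδ₂, fun D hD => abs_le.mpr ⟨?_, ?_⟩⟩
  · linarith [h1 D (hD.mono (min_le_left _ _))]
  · linarith [h2 D (hD.mono (min_le_right _ _))]

/-- Convergence of the discrete transition state. -/
theorem exists_transition_state (hS : S.Smooth) (hT : T.StifflyAccurate)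
    (hu1 : PiecewiseControl u1 t0 tf B)
    (hx : IsHybridTrajectory S u1 u2 B t0 tt tf x z) (httB : tt ∉ B)
    (hreg : fderiv ℝ S.g (x tt) (S.f1 (x tt) (u1 tt)) ≠ 0) {M : ℝ} (hM : 0 ≤ M)
    {ε : ℝ} (hε : 0 < ε) :
    ∃ δ > 0, ∀ D : DiscreteRun d m s, IsFineRun S T u1 u2 t0 tf (x t0) M δ D →
      ‖D.x D.kt - x tt‖ ≤ ε := by
  obtain ⟨η, hη, h1⟩ := exists_near_transition (u2 := u2) hS hT hu1 hx hM hε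
  obtain ⟨δ, hδ, h2⟩ := exists_transition_time (u2 := u2) hS hT hu1 hx httB hreg hM hη
  exact ⟨min δ η, lt_min hδ hη, fun D hD => h1 D (hD.mono (min_le_right _ _)) _ le_rfl
    (h2 D (hD.mono (min_le_left _ _)))⟩

/-- The vector `increment1` tends to the negative of the vector field before the transition. -/
theorem exists_increment1_limit (hS : S.Smooth) (hT : T.StifflyAccurate)
    (hu1 : PiecewiseControl u1 t0 tf B)
    (hx : IsHybridTrajectory S u1 u2 B t0 tt tf x z) (httB : tt ∉ B)
    (hreg : fderiv ℝ S.g (x tt) (S.f1 (x tt) (u1 tt)) ≠ 0) {M : ℝ} (hM : 0 ≤ M)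
    {ε : ℝ} (hε : 0 < ε) :
    ∃ δ > 0, ∀ D : DiscreteRun d m s, IsFineRun S T u1 u2 t0 tf (x t0) M δ D →
      D.Invertible S T → ‖D.increment1 S T + S.f1 (x tt) (u1 tt)‖ ≤ ε := by
  obtain ⟨C, hC, hA, -⟩ := hT.exists_bounds (State d)
  obtain ⟨r, hr⟩ := hT.row
  have hC0 : 0 < C := by linarith
  obtain ⟨ρ, hρ, hf⟩ := Metric.continuousAt_iff.mp
    (hS.continuous_f1.continuousAt (x := (x tt, u1 tt))) (ε / (2 * C)) (by positivity)
  obtain ⟨η, hη, h1⟩ := exists_near_transition (u2 := u2) hS hT hu1 hx hM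
    (show 0 < ρ / 3 by positivity)
  obtain ⟨η₂, hη₂, h2⟩ := hu1.exists_norm_sub_le (ε := ρ / 2) ⟨hx.start_lt, hx.lt_final⟩ httB
    (by positivity)
  obtain ⟨δ₁, hδ₁, h3⟩ := exists_transition_time (u2 := u2) hS hT hu1 hx httB hreg hM
    (show 0 < min η η₂ / 2 by positivity)
  -- bounds on the last step size before the transition
  set a := C * M + 1 with ha
  have ha1 : 1 ≤ a := by rw [ha]; nlinarith
  set δ := min (min δ₁ (min η η₂ / 2)) (min (ρ / (3 * a)) (min (1 / (2 * a)) (ε / (4 * a * a))))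
    with hδ
  refine ⟨δ, by positivity, fun D hD hinv => ?_⟩
  have hkt := hD.sol.kt_pos
  obtain ⟨k, hk⟩ : ∃ k, D.kt = k + 1 := ⟨D.kt - 1, by omega⟩
  have hk1 : D.kt - 1 = k := by omega
  have hkK : k < D.K := by have := hD.sol.kt_lt; omega
  have hkt' : k < D.kt := by omega
  have hh := hD.sol.h_pos k hkK
  have hhδ := hD.h_le k hkK
  have d1 : δ ≤ δ₁ := (min_le_left _ _).trans (min_le_left _ _)
  have d2 : δ ≤ min η η₂ / 2 := (min_le_left _ _).trans (min_le_right _ _)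
  have d3 : δ ≤ ρ / (3 * a) := (min_le_right _ _).trans (min_le_left _ _)
  have d4 : δ ≤ 1 / (2 * a) := (min_le_right _ _).trans ((min_le_right _ _).trans (min_le_left _ _))
  have d5 : δ ≤ ε / (4 * a * a) :=
    (min_le_right _ _).trans ((min_le_right _ _).trans (min_le_right _ _))
  have hη0 : 0 < min η η₂ := lt_min hη hη₂
  have a1 := h3 D (hD.mono d1)
  have a2 : |D.time t0 k - tt| ≤ min η η₂ := by
    rw [hk, DiscreteRun.time_succ] at a1
    have := abs_le.mp a1
    exact abs_le.mpr ⟨by linarith, by linarith⟩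
  have a3 := h1 D (hD.mono (d2.trans (by linarith [min_le_left η η₂]))) k hkt'.le
    (a2.trans (min_le_left _ _))
  have a4 := h2 _ (a2.trans (min_le_right _ _))
  have hha : D.h k * a ≤ ρ / 3 := by
    have := hhδ.trans d3
    rw [le_div_iff₀ (by positivity)] at this
    linarith
  have hha2 : D.h k * a ≤ 1 / 2 := by
    have := hhδ.trans d4
    rw [le_div_iff₀ (by positivity)] at this
    linarith
  have hha3 : D.h k * (a * (2 * a)) ≤ ε / 2 := by
    have := hhδ.trans d5
    rw [le_div_iff₀ (by positivity)] at this
    linarith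
  obtain ⟨w, hw, hI, -⟩ := DiscreteRun.exists_stepsize_derivative1 (T := T) hS hinv hkt
  rw [hk1, hk] at hw hI
  have hCM : C * M ≤ a := by linarith
  have hf1 : ∀ i, ‖∑ j, T.A i j • S.f1 (D.xs (k + 1) j) (D.u k)‖ ≤ a := fun i =>
    (hA i _ M (hD.bound1 k hkt')).trans hCM
  have hx1 : ∀ i, ‖∑ j, T.A i j • S.f1x (D.xs (k + 1) j) (D.u k) (w j)‖ ≤ a * ‖w‖ := fun i => by
    refine (hA i _ (M * ‖w‖) fun j => ?_).trans ?_
    · exact ((S.f1x _ _).le_opNorm _).trans (mul_le_mul (hD.bound1x k hkt' j)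
        (norm_le_pi_norm w j) (norm_nonneg _) hM)
    · rw [← mul_assoc]; exact mul_le_mul_of_nonneg_right hCM (norm_nonneg _)
  have hwn : ‖w‖ ≤ 2 * a := by
    have : ‖w‖ ≤ a + D.h k * (a * ‖w‖) := by
      refine (pi_norm_le_iff_of_nonneg (by positivity)).mpr fun i => ?_
      rw [hw i]
      refine (norm_add_le _ _).trans (add_le_add (by rw [norm_neg]; exact hf1 i) ?_)
      rw [norm_smul, Real.norm_of_nonneg hh.le]
      exact mul_le_mul_of_nonneg_left (hx1 i) hh.le
    have h0 := mul_le_mul_of_nonneg_right hha2 (norm_nonneg w)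
    linarith
  have e1 : D.increment1 S T + S.f1 (x tt) (u1 tt)
      = D.h k • ∑ j, T.A r j • S.f1x (D.xs (k + 1) j) (D.u k) (w j)
        - ∑ j, T.A r j • (S.f1 (D.xs (k + 1) j) (D.u k) - S.f1 (x tt) (u1 tt)) := by
    rw [hI]
    simp only [smul_sub, Finset.sum_sub_distrib, ← Finset.sum_smul]
    simp_rw [hr]
    rw [hT.sum_b, one_smul]
    abel
  have e2 : ‖∑ j, T.A r j • (S.f1 (D.xs (k + 1) j) (D.u k) - S.f1 (x tt) (u1 tt))‖
      ≤ C * (ε / (2 * C)) := by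
    refine hA r _ _ fun i => ?_
    have := hf (x := (D.xs (k + 1) i, D.u k)) (by
      rw [Prod.dist_eq, max_lt_iff, dist_eq_norm, dist_eq_norm]
      constructor
      · have e3 := norm_add_le (D.xs (k + 1) i - D.x k) (D.x k - x tt)
        rw [sub_add_sub_cancel] at e3
        have e4 := hD.norm_stage_sub_le hA hkK i
        have e5 : C * M * D.h k ≤ a * D.h k := mul_le_mul_of_nonneg_right hCM hh.le
        linarith
      · rw [hD.sol.control1 k hkt']
        exact a4.trans_lt (by linarith))
    rw [dist_eq_norm] at this
    exact this.le
  have e3 : C * (ε / (2 * C)) = ε / 2 := by field_simp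
  rw [e1]
  refine (norm_sub_le _ _).trans ?_
  rw [norm_smul, Real.norm_of_nonneg hh.le]
  have e4 : D.h k * ‖∑ j, T.A r j • S.f1x (D.xs (k + 1) j) (D.u k) (w j)‖
      ≤ D.h k * (a * (2 * a)) :=
    mul_le_mul_of_nonneg_left ((hx1 r).trans (mul_le_mul_of_nonneg_left hwn (by linarith))) hh.le
  linarith

end Transition

end

noncomputable section

variable {d m s : ℕ}

/-! ### Convergence in the sliding mode -/

theorem IsFineRun.isSlidingStep {S : HybridSystem d m} {T : RKTableau s}
    {u1 u2 : ℝ → Control m} {t0 tf : ℝ} {x0 : State d} {M δ : ℝ} {D : DiscreteRun d m s}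
    (hD : IsFineRun S T u1 u2 t0 tf x0 M δ D) {r : Fin s} (hr : ∀ j, T.A r j = T.b j) {k : ℕ}
    (hk : D.kt ≤ k) (hkK : k < D.K) :
    IsSlidingStep S T M (D.x k) (D.u k) (D.h k) (D.xs (k + 1)) (D.zs (k + 1)) :=
  ⟨hD.sol.h_pos k hkK, hD.sol.g_eq_zero hr hk hkK.le, hD.sol.stage2 hk hkK,
    hD.sol.stage2_alg hk hkK, hD.bound2 k hk hkK⟩

section Sliding

variable {S : HybridSystem d m} {T : RKTableau s} {u1 u2 : ℝ → Control m} {B : Finset ℝ}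
  {t0 tt tf : ℝ} {x : ℝ → State d} {z : ℝ → ℝ} {lf : ℝ → State d} {lg : ℝ → ℝ}

theorem gxT_ne_zero_of_index (hindex : ∀ t ∈ Icc tt tf, fderiv ℝ S.g (x t) (S.gxT (x t)) ≠ 0)
    {t : ℝ} (ht : t ∈ Icc tt tf) : S.gxT (x t) ≠ 0 := fun h => hindex t ht (by rw [h, map_zero])

/-- The sliding trajectory solves the reduced differential equation. -/
theorem IsHybridTrajectory.hasDerivAt_reduced (hS : S.Smooth)
    (hx : IsHybridTrajectory S u1 u2 B t0 tt tf x z)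
    (hindex : ∀ t ∈ Icc tt tf, fderiv ℝ S.g (x t) (S.gxT (x t)) ≠ 0) {t : ℝ}
    (ht : t ∈ Ioo tt tf) (htB : t ∉ B) :
    z t = S.zred (x t) (u2 t) ∧ HasDerivAt x (S.fred (x t) (u2 t)) t := by
  have hI : Icc tt tf ∈ 𝓝 t := Icc_mem_nhds ht.1 ht.2
  have h1 : HasDerivAt x (S.f2 (x t) (z t) (u2 t)) t :=
    (hx.dae_diff t (Ioo_subset_Icc_self ht) htB).hasDerivAt hI
  have h2 : HasDerivAt (fun r => S.g (x r)) (fderiv ℝ S.g (x t) (S.f2 (x t) (z t) (u2 t))) t :=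
    ((hS.g.differentiable two_ne_zero) (x t)).hasFDerivAt.comp_hasDerivAt t h1
  have h3 : HasDerivAt (fun r => S.g (x r)) 0 t := by
    refine (hasDerivAt_const t (0 : ℝ)).congr_of_eventuallyEq ?_
    filter_upwards [hI] with r hr
    exact hx.dae_alg r hr
  have h4 := h2.unique h3
  rw [← S.inner_gxT hS] at h4
  have h5 := HybridSystem.eq_zred_of_inner_eq_zero
    (gxT_ne_zero_of_index hindex (Ioo_subset_Icc_self ht)) h4
  exact ⟨h5, by rw [HybridSystem.fred, ← h5]; exact h1⟩

/-- Eliminating the multiplier `λ_g` by tangency, the adjoint solves a linear differential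
equation. -/
theorem IsSlidingAdjoint.hasDerivAt_reduced (hS : S.Smooth)
    (hx : IsHybridTrajectory S u1 u2 B t0 tt tf x z)
    (hindex : ∀ t ∈ Icc tt tf, fderiv ℝ S.g (x t) (S.gxT (x t)) ≠ 0)
    (hlf : IsSlidingAdjoint S u2 B tt tf x z lf lg) {t : ℝ}
    (ht : t ∈ Ioo tt tf) (htB : t ∉ B) :
    HasDerivAt lf (-S.adjMatrix (x t) (u2 t) (lf t)) t := by
  have hI : Icc tt tf ∈ 𝓝 t := Icc_mem_nhds ht.1 ht.2
  have htI := Ioo_subset_Icc_self ht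
  obtain ⟨hz, hxd⟩ := hx.hasDerivAt_reduced hS hindex ht htB
  have h1 := (hlf.diff t htI htB).hasDerivAt hI
  have hG := gxT_ne_zero_of_index hindex htI
  have h2 : HasDerivAt (fun r => S.gxT (x r)) (S.gxx (x t) (S.fred (x t) (u2 t))) t :=
    (hS.hasFDerivAt_gxT (x t)).comp_hasDerivAt t hxd
  have h3 := h1.inner ℝ h2
  have h4 : HasDerivAt (fun r => inner ℝ (lf r) (S.gxT (x r))) (0 : ℝ) t := by
    refine (hasDerivAt_const t (0 : ℝ)).congr_of_eventuallyEq ?_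
    filter_upwards [hI] with r hr
    exact hlf.alg r hr
  have h5 := h3.unique h4
  rw [inner_add_left, inner_neg_left, ContinuousLinearMap.adjoint_inner_left,
    real_inner_smul_left, real_inner_self_eq_norm_sq] at h5
  have hn : ‖S.gxT (x t)‖ ^ 2 ≠ 0 := pow_ne_zero _ (norm_ne_zero_iff.mpr hG)
  have h6 : lg t = (‖S.gxT (x t)‖ ^ 2)⁻¹ * (inner ℝ (lf t) (S.f2x (x t) (z t) (u2 t)
      (S.gxT (x t))) - inner ℝ (lf t) (S.gxx (x t) (S.fred (x t) (u2 t)))) := by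
    field_simp
    linarith
  have heq : -S.adjMatrix (x t) (u2 t) (lf t) =
      -(ContinuousLinearMap.adjoint (S.f2x (x t) (z t) (u2 t)) (lf t)) + lg t • S.gxT (x t) := by
    refine ext_inner_right ℝ fun v => ?_
    rw [inner_neg_left, HybridSystem.inner_adjMatrix, HybridSystem.adjMatrixT_apply,
      HybridSystem.tanProj_apply, ← hz, inner_add_left, inner_neg_left,
      ContinuousLinearMap.adjoint_inner_left, real_inner_smul_left, h6, map_sub, map_smul,
      inner_add_right, inner_sub_right, inner_smul_right, inner_smul_right]
    ring
  rw [heq]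
  exact h1

/-- A compact tube around the sliding trajectory on which the index condition persists. -/
theorem exists_sliding_tube (hS : S.Smooth)
    (hx : IsHybridTrajectory S u1 u2 B t0 tt tf x z)
    (hindex : ∀ t ∈ Icc tt tf, fderiv ℝ S.g (x t) (S.gxT (x t)) ≠ 0) :
    ∃ ρ > 0, ∃ K : Set (State d), IsCompact K ∧ (∀ y ∈ K, S.gxT y ≠ 0) ∧
      ∀ t ∈ Icc tt tf, ∀ y, ‖y - x t‖ ≤ ρ → y ∈ K := by
  have hΓ : IsCompact (x '' Icc tt tf) := isCompact_Icc.image_of_continuousOn hx.cont_right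
  have hO : IsOpen {y : State d | S.gxT y ≠ 0} :=
    isOpen_ne_fun hS.continuous_gxT continuous_const
  obtain ⟨ρ, hρ, h⟩ := hΓ.exists_cthickening_subset_open hO (by
    rintro _ ⟨t, ht, rfl⟩
    exact gxT_ne_zero_of_index hindex ht)
  refine ⟨ρ, hρ, Metric.cthickening ρ (x '' Icc tt tf), hΓ.cthickening, fun y hy => h hy,
    fun t ht y hy => ?_⟩
  exact Metric.mem_cthickening_of_dist_le y (x t) ρ _ (mem_image_of_mem x ht)
    (by rwa [dist_eq_norm])

theorem HybridSystem.Smooth.exists_fred_lipschitz (hS : S.Smooth) {K : Set (State d)}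
    (hK : IsCompact K) (hK0 : ∀ y ∈ K, S.gxT y ≠ 0) (V : ℝ) :
    ∃ L, 0 ≤ L ∧ ∀ y ∈ K, ∀ y' ∈ K, ∀ u, ‖u‖ ≤ V →
      ‖S.fred y u - S.fred y' u‖ ≤ L * ‖y - y'‖ := by
  have h : LocallyLipschitzOn (K ×ˢ Metric.closedBall (0 : Control m) V)
      (fun p : State d × Control m => S.fred p.1 p.2) := fun p hp => by
    obtain ⟨L, t, ht, hL⟩ := (hS.contDiffAt_fred (hK0 _ hp.1)).exists_lipschitzOnWith
    exact ⟨L, t, mem_nhdsWithin_of_mem_nhds ht, hL⟩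
  obtain ⟨L, hL⟩ := h.exists_lipschitzOnWith_of_compact
    (hK.prod (isCompact_closedBall (0 : Control m) V))
  refine ⟨L, L.2, fun y hy y' hy' u hu => ?_⟩
  have := hL.norm_sub_le (x := (y, u)) (y := (y', u)) ⟨hy, by simpa using hu⟩
    ⟨hy', by simpa using hu⟩
  simpa only [Prod.mk_sub_mk, sub_self, Prod.norm_mk, norm_zero, max_eq_left (norm_nonneg _)]
    using this

/-- The discrete states of the sliding phase converge uniformly to the trajectory, where times
before `tt` are replaced by `tt`. -/
theorem exists_phase2_convergence (hS : S.Smooth) (hT : T.StifflyAccurate)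
    (hu1 : PiecewiseControl u1 t0 tf B) (hu2 : PiecewiseControl u2 t0 tf B)
    (hx : IsHybridTrajectory S u1 u2 B t0 tt tf x z) (httB : tt ∉ B)
    (hreg : fderiv ℝ S.g (x tt) (S.f1 (x tt) (u1 tt)) ≠ 0)
    (hindex : ∀ t ∈ Icc tt tf, fderiv ℝ S.g (x t) (S.gxT (x t)) ≠ 0) {M : ℝ} (hM : 0 ≤ M)
    {ε : ℝ} (hε : 0 < ε) :
    ∃ δ > 0, ∀ D : DiscreteRun d m s, IsFineRun S T u1 u2 t0 tf (x t0) M δ D →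
      ∀ k, D.kt ≤ k → k ≤ D.K → ‖D.x k - x (max tt (D.time t0 k))‖ ≤ ε := by
  obtain ⟨r, hr⟩ := hT.row
  obtain ⟨ρ, hρ, K, hK, hK0, htube⟩ := exists_sliding_tube hS hx hindex
  obtain ⟨V, hV0, hV⟩ := hu2.exists_bound
  obtain ⟨C, δ₀, hb⟩ := exists_slidingBounds hS hT hK hK0 V hM
  obtain ⟨L, hL0, hL⟩ := hS.exists_fred_lipschitz hK hK0 V
  have hC : 0 < C := by linarith [hb.one_le]
  have hxK : ∀ t ∈ Icc tt tf, x t ∈ K := fun t ht => htube t ht _ (by simpa using hρ.le)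
  have hmax : ∀ t ∈ Icc t0 tf, max tt t ∈ Icc tt tf := fun t ht =>
    ⟨le_max_left _ _, max_le hx.lt_final.le ht.2⟩
  have hmaxeq : ∀ t ∈ Icc tt tf, max tt t = t := fun t ht => max_eq_right ht.1
  have hsub : Icc tt tf \ (B : Set ℝ) ⊆ Icc t0 tf \ B :=
    sdiff_subset_sdiff_left (Icc_subset_Icc hx.start_lt.le le_rfl)
  obtain ⟨δ, hδ, H⟩ := exists_forward_convergence (y := x)
    (v := fun t => S.fred (x (max tt t)) (u2 t)) (c := t0) (a := tt) (b := tf) (M := C) (L := L)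
    (B := B) hx.start_lt.le hx.lt_final.le hx.cont_right
    (fun t ht htB => by
      simp only [hmaxeq t (Ioo_subset_Icc_self ht)]
      exact (hx.hasDerivAt_reduced hS hindex ht htB).2)
    (fun t ht => hb.fred_le _ (hxK _ (hmax t ht)) _ (hV t ht))
    (by
      have h1 : ContinuousOn (fun t => S.fred (x t) (u2 t)) (Icc tt tf \ B) := fun t ht => by
        have h2 : ContinuousAt (fun p : State d × Control m => S.fred p.1 p.2) (x t, u2 t) :=
          (hS.contDiffAt_fred (gxT_ne_zero_of_index hindex ht.1)).continuousAt
        exact h2.comp_continuousWithinAt (f := fun t => (x t, u2 t))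
          (((hx.cont_right t ht.1).mono sdiff_subset).prodMk ((hu2.cont t (hsub ht)).mono hsub))
      exact h1.congr fun t ht => by simp only [hmaxeq t ht.1]) hL0 hρ hε
  obtain ⟨δ₁, hδ₁, h1⟩ := exists_transition_time (u2 := u2) hS hT hu1 hx httB hreg hM hδ
  obtain ⟨δ₂, hδ₂, h2⟩ := exists_transition_state (u2 := u2) hS hT hu1 hx httB hreg hM
    (show 0 < δ / 2 by positivity)
  obtain ⟨η, hη, hcont⟩ := hx.cont_right.exists_norm_sub_le_of_Icc
    (left_mem_Icc.mpr hx.lt_final.le) (show 0 < δ / 2 by positivity)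
  obtain ⟨δ₃, hδ₃, h3⟩ := exists_transition_time (u2 := u2) hS hT hu1 hx httB hreg hM hη
  refine ⟨min (min (min δ₁ δ₂) (min δ₃ δ)) (min δ₀ (δ / (C * C))), lt_min (lt_min
    (lt_min hδ₁ hδ₂) (lt_min hδ₃ hδ)) (lt_min hb.pos (by positivity)), fun D hD k hk hkK => ?_⟩
  have a1 := h1 D (hD.mono ((min_le_left _ _).trans ((min_le_left _ _).trans (min_le_left _ _))))
  have a2 := h2 D (hD.mono ((min_le_left _ _).trans ((min_le_left _ _).trans (min_le_right _ _))))
  have a3 := h3 D (hD.mono ((min_le_left _ _).trans ((min_le_right _ _).trans (min_le_left _ _))))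
  have a4 := hD.mono ((min_le_left _ _).trans ((min_le_right _ _).trans (min_le_right δ₃ δ)))
  have a5 := hD.mono ((min_le_right _ _).trans (min_le_left δ₀ (δ / (C * C))))
  have a6 := hD.mono ((min_le_right _ _).trans (min_le_right δ₀ (δ / (C * C))))
  have htkt := hD.sol.time_mem hD.sol.kt_lt.le
  refine H (D.time t0) D.kt D.K hD.sol.kt_lt.le (fun j _ hj => a4.time_step hj) htkt.1
    (by linarith [(abs_le.mp a1).1]) hD.sol.final.le D.x ?_ ?_ k hk hkK
  · have e1 := hcont _ (hmax _ htkt) (by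
      rcases le_total tt (D.time t0 D.kt) with h | h
      · rwa [max_eq_right h]
      · rw [max_eq_left h]; simpa using hη.le)
    have e2 := norm_sub_le (D.x D.kt - x tt) (x (max tt (D.time t0 D.kt)) - x tt)
    rw [sub_sub_sub_cancel_right] at e2
    linarith
  · intro j hj hjK hjρ
    have hh := hD.sol.h_pos j hjK
    have htj := hD.sol.time_mem hjK.le
    have hmj := hmax _ htj
    have huj : D.u j = u2 (D.time t0 j) := hD.sol.control2 j hj hjK
    have hxj : D.x j ∈ K := htube _ hmj _ hjρ
    have huV : ‖u2 (D.time t0 j)‖ ≤ V := hV _ htj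
    have hs := hb.step (D.x j) hxj (D.u j) (by rw [huj]; exact huV) (D.h j) (a5.h_le j hjK) _ _
      (hD.isSlidingStep hr hj hjK)
    have hhC : C * (C * D.h j) ≤ δ := by
      have := a6.h_le j hjK
      rw [le_div_iff₀ (by positivity)] at this
      linarith
    rw [DiscreteRun.time_succ, add_sub_cancel_left, hD.sol.next2 hj hjK, add_sub_cancel_left,
      ← smul_sub, norm_smul, Real.norm_of_nonneg hh.le]
    refine mul_le_mul_of_nonneg_left ?_ hh.le
    have e1 : ∑ i, T.b i • S.f2 (D.xs (j + 1) i) (D.zs (j + 1) i) (D.u j)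
        - S.fred (x (max tt (D.time t0 j))) (u2 (D.time t0 j))
        = (S.fred (D.x j) (u2 (D.time t0 j))
            - S.fred (x (max tt (D.time t0 j))) (u2 (D.time t0 j)))
          + ∑ i, T.A r i • (S.f2 (D.xs (j + 1) i) (D.zs (j + 1) i) (D.u j)
            - S.fred (D.x j) (D.u j)) := by
      simp only [smul_sub, Finset.sum_sub_distrib, ← Finset.sum_smul]
      simp_rw [hr]
      rw [hT.sum_b, one_smul, huj]
      abel
    rw [e1]
    have e2 := hL _ hxj _ (hxK _ hmj) _ huV
    have e3 := hb.A_sum r _ _ fun i => (hs i).2.2.1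
    exact (norm_add_le _ _).trans (add_le_add e2 (e3.trans hhC))

/-- The terminal value of a tangent adjoint is the projection of the negative cost gradient. -/
theorem HybridSystem.eq_neg_tanProj_gradient {y l : State d} {ν : ℝ} (hy : S.gxT y ≠ 0)
    (h1 : gradient S.phi y + l = ν • S.gxT y) (h2 : inner ℝ l (S.gxT y) = 0) :
    l = -S.tanProj y (gradient S.phi y) := by
  have h3 : S.tanProj y (S.gxT y) = 0 := by
    have : ‖S.gxT y‖ ^ 2 ≠ 0 := pow_ne_zero _ (norm_ne_zero_iff.mpr hy)
    rw [tanProj_apply, real_inner_self_eq_norm_sq, inv_mul_cancel₀ this, one_smul, sub_self]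
  have h4 := congrArg (S.tanProj y) h1
  have h5 : S.tanProj y l = l := tanProj_of_tangent (by rwa [real_inner_comm])
  rw [map_add, map_smul, h3, smul_zero, h5] at h4
  exact eq_neg_of_add_eq_zero_right h4

/-- The tangential parts of the discrete adjoints converge uniformly to the continuous adjoint. -/
theorem exists_adjoint_convergence (hS : S.Smooth) (hT : T.StifflyAccurate)
    (hu1 : PiecewiseControl u1 t0 tf B) (hu2 : PiecewiseControl u2 t0 tf B)
    (hx : IsHybridTrajectory S u1 u2 B t0 tt tf x z) (httB : tt ∉ B)
    (hreg : fderiv ℝ S.g (x tt) (S.f1 (x tt) (u1 tt)) ≠ 0)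
    (hindex : ∀ t ∈ Icc tt tf, fderiv ℝ S.g (x t) (S.gxT (x t)) ≠ 0)
    (hlf : IsSlidingAdjoint S u2 B tt tf x z lf lg) {M : ℝ} (hM : 0 ≤ M)
    {ε : ℝ} (hε : 0 < ε) :
    ∃ δ > 0, ∀ D : DiscreteRun d m s, IsFineRun S T u1 u2 t0 tf (x t0) M δ D →
      D.Invertible S T → ∀ L : ℕ → Aug2 d s →L[ℝ] ℝ, D.IsAdjoint S T L →
      ∀ k, D.kt ≤ k → k ≤ D.K →
        ‖S.tanProj (D.x k) (DiscreteRun.lamPart (L k)) - lf (max tt (D.time t0 k))‖ ≤ ε := by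
  obtain ⟨r, hr⟩ := hT.row
  obtain ⟨ρ, hρ, K, hK, hK0, htube⟩ := exists_sliding_tube hS hx hindex
  obtain ⟨V, hV0, hV⟩ := hu2.exists_bound
  obtain ⟨C, δ₀, hb⟩ := exists_slidingBounds hS hT hK hK0 V hM
  have hxK : ∀ t ∈ Icc tt tf, x t ∈ K := fun t ht => htube t ht _ (by simpa using hρ.le)
  have hmax : ∀ t ∈ Icc t0 tf, max tt t ∈ Icc tt tf := fun t ht =>
    ⟨le_max_left _ _, max_le hx.lt_final.le ht.2⟩
  have hmaxeq : ∀ t ∈ Icc tt tf, max tt t = t := fun t ht => max_eq_right ht.1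
  have hsub : Icc tt tf \ (B : Set ℝ) ⊆ Icc t0 tf \ B :=
    sdiff_subset_sdiff_left (Icc_subset_Icc hx.start_lt.le le_rfl)
  -- bounds for the matrix of the adjoint equation and for the adjoint
  have hKW : IsCompact (K ×ˢ Metric.closedBall (0 : Control m) V) :=
    hK.prod (isCompact_closedBall _ _)
  have hRc : ∀ p ∈ K ×ˢ Metric.closedBall (0 : Control m) V,
      ContinuousAt (fun p : State d × Control m => S.adjMatrix p.1 p.2) p :=
    fun p hp => hS.continuousAt_adjMatrix (hK0 _ hp.1)
  obtain ⟨CR, hCR0, hCR⟩ := hKW.exists_norm_le_of_continuousOn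
    fun p hp => (hRc p hp).continuousWithinAt
  obtain ⟨Λ, hΛ0, hΛ⟩ := isCompact_Icc.exists_norm_le_of_continuousOn hlf.cont
  obtain ⟨δ, hδ, H⟩ := exists_backward_convergence (y := lf)
    (v := fun t => -S.adjMatrix (x (max tt t)) (u2 t) (lf (max tt t))) (c := t0) (a := tt)
    (b := tf) (M := CR * Λ) (L := CR + 1)
    (B := B) hx.start_lt.le hx.lt_final.le hlf.cont
    (fun t ht htB => by
      simp only [hmaxeq t (Ioo_subset_Icc_self ht)]
      exact hlf.hasDerivAt_reduced hS hx hindex ht htB)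
    (fun t ht => by
      rw [norm_neg]
      exact ((S.adjMatrix _ _).le_opNorm _).trans (mul_le_mul
        (hCR (_, u2 t) ⟨hxK _ (hmax t ht), by simpa using hV t ht⟩) (hΛ _ (hmax t ht))
        (norm_nonneg _) hCR0))
    (by
      have h1 : ContinuousOn (fun t => -S.adjMatrix (x t) (u2 t) (lf t)) (Icc tt tf \ B) :=
        fun t ht => by
        have h2 : ContinuousAt (fun p : State d × Control m => S.adjMatrix p.1 p.2) (x t, u2 t) :=
          hS.continuousAt_adjMatrix (gxT_ne_zero_of_index hindex ht.1)
        exact ((h2.comp_continuousWithinAt (f := fun t => (x t, u2 t))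
          (((hx.cont_right t ht.1).mono sdiff_subset).prodMk ((hu2.cont t (hsub ht)).mono hsub))
          ).clm_apply ((hlf.cont t ht.1).mono sdiff_subset)).neg
      exact h1.congr fun t ht => by simp only [hmaxeq t ht.1]) (by positivity) hε
  -- tolerances for the perturbations of one step
  set ε₁ := δ / (3 * (Λ + 1)) with hε₁
  have hε₁0 : 0 < ε₁ := by positivity
  set ε₂ := δ / (3 * (CR + 1)) with hε₂
  have hε₂0 : 0 < ε₂ := by positivity
  obtain ⟨δ₁, hδ₁, h1⟩ := hb.exists_adjoint_tangent_bound hS hT hK hK0 hr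
    (show 0 < min 1 ε₁ by positivity)
  obtain ⟨δ₂, hδ₂, h2⟩ := Metric.uniformContinuousOn_iff.mp
    (isCompact_Icc.uniformContinuousOn_of_continuous hlf.cont) ε₂ hε₂0
  obtain ⟨ρ₃, hρ₃, h3⟩ := hKW.exists_forall_dist_le hRc hε₁0
  have htfI : tf ∈ Icc tt tf := right_mem_Icc.mpr hx.lt_final.le
  have hterm : ContinuousAt (fun y => -S.tanProj y (gradient S.phi y)) (x tf) := by
    have hp : Continuous (gradient S.phi) :=
      (InnerProductSpace.toDual ℝ (State d)).symm.continuous.comp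
        (hS.phi.continuous_fderiv one_ne_zero)
    exact ((hS.continuousAt_tanProj (gxT_ne_zero_of_index hindex htfI)).clm_apply
      hp.continuousAt).neg
  obtain ⟨ρ₄, hρ₄, h4⟩ := Metric.continuousAt_iff.mp hterm δ hδ
  obtain ⟨δ₅, hδ₅, h5⟩ := exists_phase2_convergence hS hT hu1 hu2 hx httB hreg hindex hM
    (show 0 < min ρ (min (ρ₃ / 2) (ρ₄ / 2)) by positivity)
  obtain ⟨δ₆, hδ₆, h6⟩ := exists_transition_time (u2 := u2) hS hT hu1 hx httB hreg hM hδ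
  refine ⟨min (min δ₁ (δ₂ / 2)) (min (min δ₅ δ₆) δ), by positivity,
    fun D hD hinv L hL k hk hkK => ?_⟩
  have c1 := hD.mono ((min_le_left _ _).trans (min_le_left δ₁ (δ₂ / 2)))
  have c2 := hD.mono ((min_le_left _ _).trans (min_le_right δ₁ (δ₂ / 2)))
  have c5 := hD.mono ((min_le_right _ _).trans ((min_le_left _ _).trans (min_le_left δ₅ δ₆)))
  have c6 := hD.mono ((min_le_right _ _).trans ((min_le_left _ _).trans (min_le_right δ₅ δ₆)))
  have c7 := hD.mono ((min_le_right _ _).trans (min_le_right (min δ₅ δ₆) δ))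
  have hconv := h5 D c5
  have htkt := hD.sol.time_mem hD.sol.kt_lt.le
  refine H (D.time t0) D.kt D.K hD.sol.kt_lt.le (fun j _ hj => c7.time_step hj) htkt.1
    (by linarith [(abs_le.mp (h6 D c6)).1]) hD.sol.final.le
    (fun k => S.tanProj (D.x k) (DiscreteRun.lamPart (L k))) ?_ ?_ k hk hkK
  · -- the terminal values
    have e1 := hconv D.K hD.sol.kt_lt.le le_rfl
    rw [hD.sol.final, max_eq_right hx.lt_final.le] at e1 ⊢
    have e2 := h4 (x := D.x D.K) (by
      rw [dist_eq_norm]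
      refine e1.trans_lt ?_
      have := (min_le_right ρ (min (ρ₃ / 2) (ρ₄ / 2))).trans (min_le_right _ _)
      linarith)
    have hK1 : S.gxT (D.x D.K) ≠ 0 := hK0 _ (htube tf htfI _ (e1.trans (min_le_left _ _)))
    obtain ⟨e3, ν, e4⟩ := hL.terminal_tangent
    obtain ⟨ν', e5⟩ := hlf.terminal
    rw [HybridSystem.tanProj_of_tangent (by rwa [real_inner_comm]),
      HybridSystem.eq_neg_tanProj_gradient hK1 e4 e3,
      HybridSystem.eq_neg_tanProj_gradient (gxT_ne_zero_of_index hindex htfI) e5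
        (hlf.alg tf htfI), ← dist_eq_norm]
    exact e2.le
  · intro j hj hjK
    have hh := hD.sol.h_pos j hjK
    have htj := hD.sol.time_mem hjK.le
    have htj' := hD.sol.time_mem (show j + 1 ≤ D.K from hjK)
    have hmj := hmax _ htj
    have hmj' := hmax _ htj'
    have huj : D.u j = u2 (D.time t0 j) := hD.sol.control2 j hj hjK
    have huV : ‖D.u j‖ ≤ V := by rw [huj]; exact hV _ htj
    have hxj := hconv j hj hjK.le
    have hxjK : D.x j ∈ K := htube _ hmj _ (hxj.trans (min_le_left _ _))
    have hstep := h1 (D.x j) hxjK (D.u j) huV (D.h j) (c1.h_le j hjK) _ _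
      (hD.isSlidingStep hr hj hjK) (DiscreteRun.lamPart (L j)) (DiscreteRun.lamPart (L (j + 1)))
      (fun v => hL.exists_tangent_step hS hinv hr hj hjK v)
    rw [← hD.sol.next2_eq_stage hr hj hjK] at hstep
    set p := S.tanProj (D.x j) (DiscreteRun.lamPart (L j)) with hp
    set p' := S.tanProj (D.x (j + 1)) (DiscreteRun.lamPart (L (j + 1))) with hp'
    set y := lf (max tt (D.time t0 j)) with hy
    set y' := lf (max tt (D.time t0 (j + 1))) with hy'
    set R := S.adjMatrix (D.x j) (D.u j) with hR
    set R₀ := S.adjMatrix (x (max tt (D.time t0 j))) (u2 (D.time t0 j)) with hR₀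
    have b1 : ‖R‖ ≤ CR := hCR (D.x j, D.u j) ⟨hxjK, by simpa using huV⟩
    have b2 : ‖y' - y‖ ≤ ε₂ := by
      have := h2 _ hmj' _ hmj (by
        rw [Real.dist_eq, DiscreteRun.time_succ]
        refine (abs_max_sub_max_le_max _ _ _ _).trans_lt ?_
        simp only [sub_self, abs_zero, add_sub_cancel_left]
        rw [abs_of_pos hh]
        exact max_lt hδ₂ ((c2.h_le j hjK).trans_lt (by linarith)))
      rw [dist_eq_norm] at this
      exact this.le
    have b3 : ‖R₀ - R‖ ≤ ε₁ := by
      have := h3 (x (max tt (D.time t0 j)), u2 (D.time t0 j)) ⟨hxK _ hmj, by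
        simpa using hV _ htj⟩ (D.x j, D.u j) (by
        rw [huj, Prod.dist_eq, dist_self, max_lt_iff, dist_comm, dist_eq_norm]
        refine ⟨hxj.trans_lt ?_, hρ₃⟩
        have := (min_le_right ρ (min (ρ₃ / 2) (ρ₄ / 2))).trans (min_le_left _ _)
        linarith)
      rwa [dist_eq_norm] at this
    have b4 : ‖y‖ ≤ Λ := hΛ _ hmj
    have b5 : ‖p'‖ ≤ Λ + ‖p' - y'‖ := by
      have := norm_add_le y' (p' - y')
      rw [add_sub_cancel] at this
      linarith [hΛ _ hmj']
    have e1 : p' - p - (D.time t0 (j + 1) - D.time t0 j) • -(R₀ y)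
        = (p' - p + D.h j • R p')
          - D.h j • (R (p' - y') + R (y' - y) - (R₀ - R) y) := by
      rw [DiscreteRun.time_succ, add_sub_cancel_left, sub_apply, map_sub, map_sub]
      module
    have e2 : ‖R (p' - y') + R (y' - y) - (R₀ - R) y‖
        ≤ CR * ‖p' - y'‖ + CR * ε₂ + ε₁ * Λ := by
      refine (norm_sub_le _ _).trans (add_le_add ((norm_add_le _ _).trans (add_le_add ?_ ?_)) ?_)
      · exact (R.le_opNorm _).trans (mul_le_mul_of_nonneg_right b1 (norm_nonneg _))
      · exact (R.le_opNorm _).trans (mul_le_mul b1 b2 (norm_nonneg _) hCR0)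
      · exact ((R₀ - R).le_opNorm _).trans (mul_le_mul b3 b4 (norm_nonneg _) hε₁0.le)
    have e3 : min 1 ε₁ * ‖p'‖ ≤ ε₁ * Λ + ‖p' - y'‖ := by
      have f1 : min 1 ε₁ * ‖p'‖ ≤ min 1 ε₁ * (Λ + ‖p' - y'‖) :=
        mul_le_mul_of_nonneg_left b5 (by positivity)
      have f2 : min 1 ε₁ * Λ ≤ ε₁ * Λ := mul_le_mul_of_nonneg_right (min_le_right _ _) hΛ0
      have f3 : min 1 ε₁ * ‖p' - y'‖ ≤ 1 * ‖p' - y'‖ :=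
        mul_le_mul_of_nonneg_right (min_le_left _ _) (norm_nonneg _)
      linarith
    have e4 : ε₁ * Λ ≤ δ / 3 := by
      rw [hε₁, div_mul_eq_mul_div, div_le_div_iff₀ (by positivity) (by norm_num)]
      nlinarith
    have e5 : CR * ε₂ ≤ δ / 3 := by
      rw [hε₂, mul_div_assoc', div_le_div_iff₀ (by positivity) (by norm_num)]
      nlinarith
    have hgoal : ‖p' - p - (D.time t0 (j + 1) - D.time t0 j) • -(R₀ y)‖
        ≤ (D.time t0 (j + 1) - D.time t0 j) * ((CR + 1) * ‖p' - y'‖ + δ) := by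
      rw [e1]
      refine (norm_sub_le _ _).trans ?_
      rw [norm_smul, Real.norm_of_nonneg hh.le, DiscreteRun.time_succ, add_sub_cancel_left]
      have f1 := mul_le_mul_of_nonneg_left e2 hh.le
      have f2 := mul_le_mul_of_nonneg_left e3 hh.le
      have f3 : D.h j * (ε₁ * Λ + ‖p' - y'‖) + D.h j * (CR * ‖p' - y'‖ + CR * ε₂ + ε₁ * Λ)
          ≤ D.h j * ((CR + 1) * ‖p' - y'‖ + δ) := by
        rw [← mul_add]
        exact mul_le_mul_of_nonneg_left (by linarith) hh.le
      linarith
    exact hgoal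

end Sliding

end

noncomputable section

variable {d m s : ℕ}

/-! ### Convergence of the discrete jump -/

theorem tendsto_of_eventually_norm_sub_le {E : Type*} [NormedAddCommGroup E] {a : ℕ → E} {b : E}
    (h : ∀ ε > 0, ∀ᶠ n in atTop, ‖a n - b‖ ≤ ε) : Tendsto a atTop (𝓝 b) := by
  refine Metric.tendsto_nhds.mpr fun ε hε => ?_
  filter_upwards [h (ε / 2) (by positivity)] with n hn
  rw [dist_eq_norm]
  linarith

section Limits

variable {S : HybridSystem d m} {T : RKTableau s} {u1 u2 : ℝ → Control m} {B : Finset ℝ}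
  {t0 tt tf : ℝ} {x : ℝ → State d} {z : ℝ → ℝ} {lf : ℝ → State d} {lg : ℝ → ℝ}
  {D : ℕ → DiscreteRun d m s} {M : ℝ}

theorem tendsto_transition_step
    (hfine : ∀ δ > 0, ∀ᶠ n in atTop, IsFineRun S T u1 u2 t0 tf (x t0) M δ (D n)) :
    Tendsto (fun n => (D n).h (D n).kt) atTop (𝓝 0) := by
  refine tendsto_of_eventually_norm_sub_le fun ε hε => ?_
  filter_upwards [hfine ε hε] with n hn
  rw [sub_zero, Real.norm_of_nonneg (hn.sol.h_pos _ hn.sol.kt_lt).le]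
  exact hn.h_le _ hn.sol.kt_lt

theorem tendsto_transition_time (hS : S.Smooth) (hT : T.StifflyAccurate)
    (hu1 : PiecewiseControl u1 t0 tf B)
    (hx : IsHybridTrajectory S u1 u2 B t0 tt tf x z) (httB : tt ∉ B)
    (hreg : fderiv ℝ S.g (x tt) (S.f1 (x tt) (u1 tt)) ≠ 0) (hM : 0 ≤ M)
    (hfine : ∀ δ > 0, ∀ᶠ n in atTop, IsFineRun S T u1 u2 t0 tf (x t0) M δ (D n)) :
    Tendsto (fun n => (D n).time t0 (D n).kt) atTop (𝓝 tt) := by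
  refine tendsto_of_eventually_norm_sub_le fun ε hε => ?_
  obtain ⟨δ, hδ, h⟩ := exists_transition_time (u2 := u2) hS hT hu1 hx httB hreg hM hε
  exact (hfine δ hδ).mono fun n hn => h _ hn

theorem tendsto_transition_state (hS : S.Smooth) (hT : T.StifflyAccurate)
    (hu1 : PiecewiseControl u1 t0 tf B)
    (hx : IsHybridTrajectory S u1 u2 B t0 tt tf x z) (httB : tt ∉ B)
    (hreg : fderiv ℝ S.g (x tt) (S.f1 (x tt) (u1 tt)) ≠ 0) (hM : 0 ≤ M)
    (hfine : ∀ δ > 0, ∀ᶠ n in atTop, IsFineRun S T u1 u2 t0 tf (x t0) M δ (D n)) :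
    Tendsto (fun n => (D n).x (D n).kt) atTop (𝓝 (x tt)) := by
  refine tendsto_of_eventually_norm_sub_le fun ε hε => ?_
  obtain ⟨δ, hδ, h⟩ := exists_transition_state (u2 := u2) hS hT hu1 hx httB hreg hM hε
  exact (hfine δ hδ).mono fun n hn => h _ hn

theorem tendsto_increment1 (hS : S.Smooth) (hT : T.StifflyAccurate)
    (hu1 : PiecewiseControl u1 t0 tf B)
    (hx : IsHybridTrajectory S u1 u2 B t0 tt tf x z) (httB : tt ∉ B)
    (hreg : fderiv ℝ S.g (x tt) (S.f1 (x tt) (u1 tt)) ≠ 0) (hM : 0 ≤ M)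
    (hfine : ∀ δ > 0, ∀ᶠ n in atTop, IsFineRun S T u1 u2 t0 tf (x t0) M δ (D n))
    (hinv : ∀ n, (D n).Invertible S T) :
    Tendsto (fun n => (D n).increment1 S T) atTop (𝓝 (-S.f1 (x tt) (u1 tt))) := by
  refine tendsto_of_eventually_norm_sub_le fun ε hε => ?_
  obtain ⟨δ, hδ, h⟩ := exists_increment1_limit (u2 := u2) hS hT hu1 hx httB hreg hM hε
  filter_upwards [hfine δ hδ] with n hn
  rw [sub_neg_eq_add]
  exact h _ hn (hinv n)

/-- The derivative of the first sliding step with respect to its length tends to the negative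
of the sliding vector field at the transition. -/
theorem tendsto_increment2 (hS : S.Smooth) (hT : T.StifflyAccurate)
    (hu1 : PiecewiseControl u1 t0 tf B) (hu2 : PiecewiseControl u2 t0 tf B)
    (hx : IsHybridTrajectory S u1 u2 B t0 tt tf x z) (httB : tt ∉ B)
    (hreg : fderiv ℝ S.g (x tt) (S.f1 (x tt) (u1 tt)) ≠ 0)
    (hindex : ∀ t ∈ Icc tt tf, fderiv ℝ S.g (x t) (S.gxT (x t)) ≠ 0) (hM : 0 ≤ M)
    (hfine : ∀ δ > 0, ∀ᶠ n in atTop, IsFineRun S T u1 u2 t0 tf (x t0) M δ (D n))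
    (hinv : ∀ n, (D n).Invertible S T) :
    Tendsto (fun n => (D n).increment2 S T) atTop (𝓝 (-S.fred (x tt) (u2 tt))) := by
  obtain ⟨r, hr⟩ := hT.row
  obtain ⟨ρ, hρ, K, hK, hK0, htube⟩ := exists_sliding_tube hS hx hindex
  obtain ⟨V, -, hV⟩ := hu2.exists_bound
  obtain ⟨C, δ₀, hb⟩ := exists_slidingBounds hS hT hK hK0 V hM
  obtain ⟨C', -, δ, hδ, hstep⟩ := hb.exists_stepsize_derivative_bound hT hM hr
  have htt : tt ∈ Icc tt tf := left_mem_Icc.mpr hx.lt_final.le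
  have hxt := tendsto_transition_state hS hT hu1 hx httB hreg hM hfine
  have hut : Tendsto (fun n => (D n).u (D n).kt) atTop (𝓝 (u2 tt)) := by
    have h1 : ContinuousAt u2 tt := hu2.cont.continuousAt (inter_mem
      (Icc_mem_nhds hx.start_lt hx.lt_final)
      (B.finite_toSet.isClosed.isOpen_compl.mem_nhds httB))
    refine (h1.tendsto.comp (tendsto_transition_time hS hT hu1 hx httB hreg hM hfine)).congr' ?_
    filter_upwards [hfine 1 one_pos] with n hn
    exact (hn.sol.control2 _ le_rfl hn.sol.kt_lt).symm
  have hf : Tendsto (fun n => S.fred ((D n).x (D n).kt) ((D n).u (D n).kt)) atTop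
      (𝓝 (S.fred (x tt) (u2 tt))) :=
    ((hS.contDiffAt_fred (p := (x tt, u2 tt))
      (gxT_ne_zero_of_index hindex htt)).continuousAt.tendsto.comp (hxt.prodMk_nhds hut))
  have hsum : Tendsto (fun n => (D n).increment2 S T
      + S.fred ((D n).x (D n).kt) ((D n).u (D n).kt)) atTop (𝓝 0) := by
    have h0 : Tendsto (fun n => C' * (D n).h (D n).kt) atTop (𝓝 0) := by
      simpa using (tendsto_transition_step hfine).const_mul C'
    refine squeeze_zero_norm' ?_ h0
    obtain ⟨δ₁, hδ₁, h1⟩ := exists_transition_state (u2 := u2) hS hT hu1 hx httB hreg hM hρ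
    filter_upwards [hfine δ hδ, hfine δ₁ hδ₁] with n hn hn1
    obtain ⟨ξ, ζ, e1, e2, e3, -⟩ := DiscreteRun.exists_stepsize_derivative2 hS (hinv n) hr
      hn.sol.kt_lt
    rw [e3]
    refine hstep _ (htube tt htt _ (h1 _ hn1)) _ ?_ _ (hn.h_le _ hn.sol.kt_lt) _ _
      (hn.isSlidingStep hr le_rfl hn.sol.kt_lt) ξ ζ e1 e2
    rw [hn.sol.control2 _ le_rfl hn.sol.kt_lt]
    exact hV _ (hn.sol.time_mem hn.sol.kt_lt.le)
  have := hsum.sub hf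
  simpa only [add_sub_cancel_right, zero_sub] using this

/-- The tangential parts of the discrete adjoint at both ends of the first sliding step converge
to the continuous adjoint at the transition. -/
theorem tendsto_tanProj_adjoint (hS : S.Smooth) (hT : T.StifflyAccurate)
    (hu1 : PiecewiseControl u1 t0 tf B) (hu2 : PiecewiseControl u2 t0 tf B)
    (hx : IsHybridTrajectory S u1 u2 B t0 tt tf x z) (httB : tt ∉ B)
    (hreg : fderiv ℝ S.g (x tt) (S.f1 (x tt) (u1 tt)) ≠ 0)
    (hindex : ∀ t ∈ Icc tt tf, fderiv ℝ S.g (x t) (S.gxT (x t)) ≠ 0)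
    (hlf : IsSlidingAdjoint S u2 B tt tf x z lf lg) (hM : 0 ≤ M)
    (hfine : ∀ δ > 0, ∀ᶠ n in atTop, IsFineRun S T u1 u2 t0 tf (x t0) M δ (D n))
    (hinv : ∀ n, (D n).Invertible S T)
    {L : ℕ → ℕ → Aug2 d s →L[ℝ] ℝ} (hL : ∀ n, (D n).IsAdjoint S T (L n)) {k : ℕ → ℕ}
    (hk : ∀ n, k n = (D n).kt ∨ k n = (D n).kt + 1) :
    Tendsto (fun n => S.tanProj ((D n).x (k n)) (DiscreteRun.lamPart (L n (k n)))) atTop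
      (𝓝 (lf tt)) := by
  have hkK : ∀ᶠ n in atTop, (D n).kt ≤ k n ∧ k n ≤ (D n).K := by
    filter_upwards [hfine 1 one_pos] with n hn
    have := hn.sol.kt_lt
    rcases hk n with h | h <;> omega
  have htime : Tendsto (fun n => (D n).time t0 (k n)) atTop (𝓝 tt) := by
    have h1 := tendsto_transition_time hS hT hu1 hx httB hreg hM hfine
    have h2 : Tendsto (fun n => (D n).time t0 (k n) - (D n).time t0 (D n).kt) atTop (𝓝 0) := by
      refine squeeze_zero_norm' ?_ (tendsto_transition_step hfine)
      filter_upwards [hfine 1 one_pos] with n hn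
      have hpos := (hn.sol.h_pos _ hn.sol.kt_lt).le
      rcases hk n with h | h
      · simpa [h] using hpos
      · rw [h, DiscreteRun.time_succ, add_sub_cancel_left, Real.norm_of_nonneg hpos]
    simpa using h2.add h1
  have hmax : Tendsto (fun n => max tt ((D n).time t0 (k n))) atTop (𝓝[Icc tt tf] tt) := by
    refine tendsto_nhdsWithin_iff.mpr ⟨by
      simpa using (tendsto_const_nhds (x := tt)).max htime, ?_⟩
    filter_upwards [hfine 1 one_pos, hkK] with n hn hkn
    exact ⟨le_max_left _ _, max_le hx.lt_final.le (hn.sol.time_mem hkn.2).2⟩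
  have hlim := (hlf.cont tt (left_mem_Icc.mpr hx.lt_final.le)).tendsto.comp hmax
  have hdiff : Tendsto (fun n => S.tanProj ((D n).x (k n)) (DiscreteRun.lamPart (L n (k n)))
      - lf (max tt ((D n).time t0 (k n)))) atTop (𝓝 0) := by
    refine tendsto_of_eventually_norm_sub_le fun ε hε => ?_
    obtain ⟨δ, hδ, h⟩ := exists_adjoint_convergence hS hT hu1 hu2 hx httB hreg hindex hlf hM hε
    filter_upwards [hfine δ hδ, hkK] with n hn hkn
    rw [sub_zero]
    exact h _ hn (hinv n) _ (hL n) _ hkn.1 hkn.2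
  simpa using hdiff.add hlim

/-- The full discrete adjoint at the transition converges, since its normal component is of the
order of the step size. -/
theorem tendsto_adjoint_transition (hS : S.Smooth) (hT : T.StifflyAccurate)
    (hu1 : PiecewiseControl u1 t0 tf B) (hu2 : PiecewiseControl u2 t0 tf B)
    (hx : IsHybridTrajectory S u1 u2 B t0 tt tf x z) (httB : tt ∉ B)
    (hreg : fderiv ℝ S.g (x tt) (S.f1 (x tt) (u1 tt)) ≠ 0)
    (hindex : ∀ t ∈ Icc tt tf, fderiv ℝ S.g (x t) (S.gxT (x t)) ≠ 0)
    (hlf : IsSlidingAdjoint S u2 B tt tf x z lf lg) (hM : 0 ≤ M)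
    (hfine : ∀ δ > 0, ∀ᶠ n in atTop, IsFineRun S T u1 u2 t0 tf (x t0) M δ (D n))
    (hinv : ∀ n, (D n).Invertible S T)
    {L : ℕ → ℕ → Aug2 d s →L[ℝ] ℝ} (hL : ∀ n, (D n).IsAdjoint S T (L n)) :
    Tendsto (fun n => DiscreteRun.lamPart (L n (D n).kt)) atTop (𝓝 (lf tt)) := by
  obtain ⟨r, hr⟩ := hT.row
  obtain ⟨ρ, hρ, K, hK, hK0, htube⟩ := exists_sliding_tube hS hx hindex
  obtain ⟨V, -, hV⟩ := hu2.exists_bound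
  obtain ⟨C, δ₀, hb⟩ := exists_slidingBounds hS hT hK hK0 V hM
  obtain ⟨C', -, δ, hδ, hstep⟩ := hb.exists_adjoint_normal_bound (r := r) hT
  have htt : tt ∈ Icc tt tf := left_mem_Icc.mpr hx.lt_final.le
  have hG : Tendsto (fun n => S.gxT ((D n).x (D n).kt)) atTop (𝓝 (S.gxT (x tt))) :=
    (hS.continuous_gxT.tendsto _).comp
      (tendsto_transition_state hS hT hu1 hx httB hreg hM hfine)
  have hG0 : ‖S.gxT (x tt)‖ ^ 2 ≠ 0 :=
    pow_ne_zero _ (norm_ne_zero_iff.mpr (gxT_ne_zero_of_index hindex htt))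
  have hm := tendsto_tanProj_adjoint hS hT hu1 hu2 hx httB hreg hindex hlf hM hfine hinv hL
    (k := fun n => (D n).kt) (fun n => Or.inl rfl)
  have hm' := tendsto_tanProj_adjoint hS hT hu1 hu2 hx httB hreg hindex hlf hM hfine hinv hL
    (k := fun n => (D n).kt + 1) (fun n => Or.inr rfl)
  have hnormal : Tendsto (fun n => inner ℝ (S.gxT ((D n).x (D n).kt))
      (DiscreteRun.lamPart (L n (D n).kt))) atTop (𝓝 0) := by
    have h0 : Tendsto (fun n => C' * (D n).h (D n).kt * ‖S.tanProj ((D n).x ((D n).kt + 1))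
        (DiscreteRun.lamPart (L n ((D n).kt + 1)))‖) atTop (𝓝 0) := by
      simpa using ((tendsto_transition_step hfine).const_mul C').mul hm'.norm
    refine squeeze_zero_norm' ?_ h0
    obtain ⟨δ₁, hδ₁, h1⟩ := exists_transition_state (u2 := u2) hS hT hu1 hx httB hreg hM hρ
    filter_upwards [hfine δ hδ, hfine δ₁ hδ₁] with n hn hn1
    rw [real_inner_comm, Real.norm_eq_abs, hn.sol.next2_eq_stage hr le_rfl hn.sol.kt_lt]
    refine hstep _ (htube tt htt _ (h1 _ hn1)) ((D n).u (D n).kt) ?_ _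
      (hn.h_le _ hn.sol.kt_lt) _ _ (hn.isSlidingStep hr le_rfl hn.sol.kt_lt) _ _
      fun v => (hL n).exists_tangent_step hS (hinv n) hr le_rfl hn.sol.kt_lt v
    rw [hn.sol.control2 _ le_rfl hn.sol.kt_lt]
    exact hV _ (hn.sol.time_mem hn.sol.kt_lt.le)
  have := hm.add ((((hG.norm.pow 2).inv₀ hG0).mul hnormal).smul hG)
  simpa only [HybridSystem.tanProj_apply, sub_add_cancel, mul_zero, zero_smul, add_zero] using this

/-- In the Hamiltonian of the sliding phase only the tangential part of the adjoint matters. -/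
theorem tendsto_inner_increment2 (hS : S.Smooth) (hT : T.StifflyAccurate)
    (hu1 : PiecewiseControl u1 t0 tf B) (hu2 : PiecewiseControl u2 t0 tf B)
    (hx : IsHybridTrajectory S u1 u2 B t0 tt tf x z) (httB : tt ∉ B)
    (hreg : fderiv ℝ S.g (x tt) (S.f1 (x tt) (u1 tt)) ≠ 0)
    (hindex : ∀ t ∈ Icc tt tf, fderiv ℝ S.g (x t) (S.gxT (x t)) ≠ 0)
    (hlf : IsSlidingAdjoint S u2 B tt tf x z lf lg) (hM : 0 ≤ M)
    (hfine : ∀ δ > 0, ∀ᶠ n in atTop, IsFineRun S T u1 u2 t0 tf (x t0) M δ (D n))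
    (hinv : ∀ n, (D n).Invertible S T)
    {L : ℕ → ℕ → Aug2 d s →L[ℝ] ℝ} (hL : ∀ n, (D n).IsAdjoint S T (L n)) :
    Tendsto (fun n => inner ℝ (DiscreteRun.lamPart (L n ((D n).kt + 1)))
      (-(D n).increment2 S T)) atTop (𝓝 (inner ℝ (lf tt) (S.fred (x tt) (u2 tt)))) := by
  obtain ⟨r, hr⟩ := hT.row
  have hm := tendsto_tanProj_adjoint hS hT hu1 hu2 hx httB hreg hindex hlf hM hfine hinv hL
    (k := fun n => (D n).kt + 1) (fun n => Or.inr rfl)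
  have hi := (tendsto_increment2 hS hT hu1 hu2 hx httB hreg hindex hM hfine hinv).neg
  rw [neg_neg] at hi
  refine (hm.inner hi).congr' ?_
  filter_upwards [hfine 1 one_pos] with n hn
  obtain ⟨ξ, ζ, -, e2, e3, -⟩ := DiscreteRun.exists_stepsize_derivative2 hS (hinv n) hr
    hn.sol.kt_lt
  refine HybridSystem.inner_tanProj_of_tangent ?_
  rw [e3, hn.sol.next2_eq_stage hr le_rfl hn.sol.kt_lt, inner_neg_right, e2 r, neg_zero]

end Limits

/-- The continuous jump is the limit of the explicit formula: the multiplier `z` drops out since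
`λ_f` is tangent to the switching surface. -/
theorem ContinuousJump.eq_div {S : HybridSystem d m} (hS : S.Smooth) {u1 u2 : ℝ → Control m}
    {tt : ℝ} {x : ℝ → State d} {z : ℝ → ℝ} {lf : ℝ → State d} {lg : ℝ → ℝ} {lm : State d} {p : ℝ}
    (h : ContinuousJump S u1 u2 tt x z lf lg lm p) (hg : S.g (x tt) = 0)
    (hl : inner ℝ (lf tt) (S.gxT (x tt)) = 0)
    (hreg : fderiv ℝ S.g (x tt) (S.f1 (x tt) (u1 tt)) ≠ 0) :
    p = (inner ℝ (lf tt) (S.fred (x tt) (u2 tt)) - inner ℝ (lf tt) (S.f1 (x tt) (u1 tt)))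
      / -fderiv ℝ S.g (x tt) (S.f1 (x tt) (u1 tt)) := by
  obtain ⟨rfl, h2⟩ := h
  rw [inner_sub_left, real_inner_smul_left, HybridSystem.inner_gxT hS, inner_smul_right, hl,
    hg] at h2
  rw [eq_div_iff (neg_ne_zero.mpr hreg), HybridSystem.fred, HybridSystem.f2, inner_add_right,
    inner_smul_right, hl]
  linarith

end

theorem mainTheorem4 {d m s : ℕ} (S : HybridSystem d m) (hS : S.Smooth)
    (T : RKTableau s) (hT : T.StifflyAccurate)
    -- the continuous trajectory, its adjoint and the continuous jump
    (u1 u2 : ℝ → Control m) (B : Finset ℝ) (t0 tt tf : ℝ)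
    (hu1 : PiecewiseControl u1 t0 tf B) (hu2 : PiecewiseControl u2 t0 tf B) (httB : tt ∉ B)
    (x : ℝ → State d) (z : ℝ → ℝ) (hx : IsHybridTrajectory S u1 u2 B t0 tt tf x z)
    (hindex : ∀ t ∈ Icc tt tf, fderiv ℝ S.g (x t) (S.gxT (x t)) ≠ 0)
    (hreg : fderiv ℝ S.g (x tt) (S.f1 (x tt) (u1 tt)) ≠ 0)
    (lf : ℝ → State d) (lg : ℝ → ℝ) (hlf : IsSlidingAdjoint S u2 B tt tf x z lf lg)
    (lminus : State d) (pit : ℝ) (hpit : ContinuousJump S u1 u2 tt x z lf lg lminus pit)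
    -- the discrete trajectories and their adjoints, with step sizes tending to zero
    (D : ℕ → DiscreteRun d m s) (hD : ∀ n, (D n).IsSolution S T u1 u2 t0 tf (x t0))
    (H : ℕ → ℝ) (hH : ∀ n, ∀ k < (D n).K, (D n).h k ≤ H n) (hH0 : Tendsto H atTop (𝓝 0))
    (hinv : ∀ n, (D n).Invertible S T)
    (N1 : Set (State d × Control m)) (N2 : Set (State d × ℝ × Control m)) (M : ℝ)
    (hN : ∀ n, (D n).StagesIn N1 N2)
    (hN1 : ∀ y v, (y, v) ∈ N1 → ‖S.f1 y v‖ ≤ M ∧ ‖S.f1x y v‖ ≤ M)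
    (hN2 : ∀ y ζ v, (y, ζ, v) ∈ N2 →
      ‖S.f2 y ζ v‖ ≤ M ∧ ‖S.f2x y ζ v‖ ≤ M ∧ ‖S.f2z y ζ v‖ ≤ M)
    (L : ℕ → ℕ → Aug2 d s →L[ℝ] ℝ) (hL : ∀ n, (D n).IsAdjoint S T (L n)) :
    -- the discrete jump conditions determine the jump by the explicit formula
    (∀ n, (D n).jumpDenom S T ≠ 0 → ∀ (lm : State d) (p : ℝ),
      (D n).Jump S T (L n) lm p ↔
        p = (D n).jumpFormula S T (L n) ∧
        lm = DiscreteRun.lamPart (L n (D n).kt) - p • S.gxT ((D n).x (D n).kt)) ∧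
    (∀ᶠ n in atTop, (D n).jumpDenom S T ≠ 0) ∧
    -- convergence of the discrete jump
    Tendsto (fun n => (D n).jumpFormula S T (L n)) atTop (𝓝 pit) ∧
    (∀ (lm : ℕ → State d) (p : ℕ → ℝ),
      (∀ᶠ n in atTop, (D n).Jump S T (L n) (lm n) (p n)) → Tendsto p atTop (𝓝 pit)) := by
  obtain ⟨r, hr⟩ := hT.row
  have hM : 0 ≤ M := (norm_nonneg _).trans
    (hN1 _ _ ((hN 0).phase1 0 (hD 0).kt_pos r)).1
  have hfine : ∀ δ > 0, ∀ᶠ n in atTop, IsFineRun S T u1 u2 t0 tf (x t0) M δ (D n) := by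
    intro δ hδ
    filter_upwards [hH0.eventually_le_const hδ] with n hn
    exact ⟨hD n, fun k hk => (hH n k hk).trans hn,
      fun k hk i => (hN1 _ _ ((hN n).phase1 k hk i)).1,
      fun k hk i => (hN1 _ _ ((hN n).phase1 k hk i)).2,
      fun k hk hkK i => (hN2 _ _ _ ((hN n).phase2 k hk hkK i)).1⟩
  have htt : tt ∈ Icc tt tf := left_mem_Icc.mpr hx.lt_final.le
  have hI1 := tendsto_increment1 hS hT hu1 hx httB hreg hM hfine hinv
  have hden : Tendsto (fun n => (D n).jumpDenom S T) atTop
      (𝓝 (-fderiv ℝ S.g (x tt) (S.f1 (x tt) (u1 tt)))) := by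
    have hG := (hS.continuous_gxT.tendsto _).comp
      (tendsto_transition_state hS hT hu1 hx httB hreg hM hfine)
    rw [← HybridSystem.inner_gxT hS, ← inner_neg_right]
    simpa only [DiscreteRun.jumpDenom_eq hS, Function.comp_def] using hG.inner hI1
  have hne : ∀ᶠ n in atTop, (D n).jumpDenom S T ≠ 0 :=
    hden.eventually_ne (neg_ne_zero.mpr hreg)
  have hsolve : ∀ n, (D n).jumpDenom S T ≠ 0 → ∀ (lm : State d) (p : ℝ),
      (D n).Jump S T (L n) lm p ↔ p = (D n).jumpFormula S T (L n) ∧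
        lm = DiscreteRun.lamPart (L n (D n).kt) - p • S.gxT ((D n).x (D n).kt) :=
    fun n h lm p => DiscreteRun.jump_iff_eq_jumpFormula hS (hD n) (hL n) (hinv n) hr h lm p
  have hlim : Tendsto (fun n => (D n).jumpFormula S T (L n)) atTop (𝓝 pit) := by
    have hl := tendsto_adjoint_transition hS hT hu1 hu2 hx httB hreg hindex hlf hM hfine hinv hL
    have hI2 := tendsto_inner_increment2 hS hT hu1 hu2 hx httB hreg hindex hlf hM hfine hinv hL
    rw [hpit.eq_div hS (hx.dae_alg tt htt) (hlf.alg tt htt) hreg]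
    refine (hI2.sub ?_).div hden (neg_ne_zero.mpr hreg)
    simpa only [neg_neg] using hl.inner hI1.neg
  refine ⟨hsolve, hne, hlim, fun lm p hp => hlim.congr' ?_⟩
  filter_upwards [hne, hp] with n h1 h2
  exact ((hsolve n h1 _ _).mp h2).1.symm
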